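/- Let $N\ge 1$, $0<\alpha'\le\alpha$, $0<\beta\le 2$, $\delta\ge 0$, $\varepsilon>0$ and $1\le p,q\le\infty$, and let $w_{\alpha,\beta,\delta}(v)=(1+|v|^2)^{\delta}e^{\alpha|v|^\beta}$ for $v\in\mathbb{R}^N$. Consider the BGK model on $\mathbb{R}^N_x\times\mathbb{R}^N_v$, $$\partial_t f+v\cdot\nabla_x f=\mathcal{M}(f)-f,\qquad f(0,x,v)=f_0(x,v),\qquad \mathcal{M}(f)=\frac{\rho}{(2\pi T)^{N/2}}\exp\Big(-\frac{|v-u|^2}{2T}\Big),$$ where $\rho=\int f\,dv$, $\rho u=\int vf\,dv$, $\rho(|u|^2+NT)=\int|v|^2f\,dv$. Solutions are non-negative measurable mild solutions with finite mass, momentum and energy densities, i.e. for each $t$ and almost all $(x,v)$ $$f(t,x,v)=e^{-t}f_0(x-tv,v)+\int_0^t e^{-(t-s)}\mathcal{M}(f)(s,x-(t-s)v,v)\,ds .$$ Let $\|\cdot\|_{X}$ be either of the norms $\|g\|_{L^p_xL^q_v}=\big\|\,\|g(x,\cdot)\|_{L^q_v}\big\|_{L^p_x}$ or $\|g\|_{L^q_vL^p_x}=\big\|\,\|g(\cdot,v)\|_{L^p_x}\big\|_{L^q_v}$.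 Then there are $\gamma\in\big[\tfrac13,\min\{\tfrac1{\beta+1},\tfrac12\}\big]$, $\omega\ge0$ and $c>0$ such that the non-negative, measurable, spatially inhomogeneous function $$f_0(x,v)=c\,(1+|x|)^{-\omega}(1+|v|^2)^{-\delta}e^{-\alpha|v|^\beta}\mathbf 1_{|x|^\gamma\le|v|\le 2|x|^\gamma+10}$$ satisfies $$\|w_{\alpha,\beta,\delta}f_0\|_{X}+\|w_{\alpha,\beta,\delta}f_0\|_{L^\infty_{x,v}}\le\varepsilon$$ and the following hold. For some $T_0>0$ there is a solution on $[0,T_0]$ with datum $f_0$ which satisfies, for some constants $C_1,\dots,C_5>0$, all $t\in[0,T_0]$ and almost all $x$, the bounds $$C_1\le\frac{\rho(t,x)}{(1+|x|)^{(N-2\delta-\beta)\gamma-\omega}e^{-\alpha|x|^{\beta\gamma}}}\le C_2,\qquad |u(t,x)|\le C_3(1+|x|^\gamma)t^{1/4},\qquad C_4\le\frac{T(t,x)}{1+|x|^{2\gamma}}\le C_5 .\qquad(*)$$ On every interval $[0,T_1]$, $T_1>0$, there is, up to null sets at each time, at most one solution with datum $f_0$ that satisfies $(*)$ on $[0,T_1]$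 for some constants $C_i>0$. Finally, for every $T_1>0$, every solution $f$ on $[0,T_1]$ with datum $f_0$ that satisfies $(*)$ on some initial interval $[0,s]$, $0<s\le T_1$ (so the above solution and each of its continuations), satisfies $$\|w_{\alpha',\beta,\delta}f(t)\|_{X}=\infty\qquad\text{for every } 0<t\le T_1 .$$ -/

import Mathlib

open MeasureTheory Set
open scoped ENNReal

namespace BGK

noncomputable section

/-- The common space `ℝᴺ` of positions and of velocities, with its Euclidean norm. -/
abbrev Space (N : ℕ) : Type := EuclideanSpace ℝ (Fin N)

/-- The weight `w_{α,β,δ}(v) = (1 + |v|²)^δ e^{α |v|^β}`. -/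
def weight {N : ℕ} (α β δ : ℝ) (v : Space N) : ℝ :=
  (1 + ‖v‖ ^ 2) ^ δ * Real.exp (α * ‖v‖ ^ β)

/-! ### Mixed norms of functions of `(x, v)` -/

/-- `‖g‖_{L^p_x L^q_v}`: first the `L^q` norm in `v`, then the `L^p` norm in `x`. -/
def normXV {N : ℕ} (p q : ℝ≥0∞) (g : Space N → Space N → ℝ) : ℝ≥0∞ :=
  eLpNorm (fun x : Space N => eLpNorm (fun v : Space N => g x v) q volume) p volume

/-- `‖g‖_{L^q_v L^p_x}`: first the `L^p` norm in `x`, then the `L^q` norm in `v`. -/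
def normVX {N : ℕ} (p q : ℝ≥0∞) (g : Space N → Space N → ℝ) : ℝ≥0∞ :=
  eLpNorm (fun v : Space N => eLpNorm (fun x : Space N => g x v) p volume) q volume

/-- `‖g‖_{L^∞_{x,v}}`. -/
def normSup {N : ℕ} (g : Space N → Space N → ℝ) : ℝ≥0∞ :=
  eLpNorm (fun z : Space N × Space N => g z.1 z.2) ∞ volume

/-! ### Macroscopic fields and the local Maxwellian of a velocity distribution `g` -/

/-- The density `ρ = ∫ g dv`. -/
def density {N : ℕ} (g : Space N → ℝ) : ℝ := ∫ v, g v

/-- The bulk velocity `u`, with `ρ u = ∫ v g dv`. -/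
def bulkVelocity {N : ℕ} (g : Space N → ℝ) : Space N := (density g)⁻¹ • ∫ v, g v • v

/-- The temperature `T`, with `ρ (|u|² + N T) = ∫ |v|² g dv`. -/
def temperature {N : ℕ} (g : Space N → ℝ) : ℝ :=
  ((∫ v, ‖v‖ ^ 2 * g v) / density g - ‖bulkVelocity g‖ ^ 2) / N

/-- The local Maxwellian `M(g)(v) = ρ (2πT)^{-N/2} exp (-|v - u|² / (2T))`. -/
def localMaxwellian {N : ℕ} (g : Space N → ℝ) (v : Space N) : ℝ :=
  density g / (2 * Real.pi * temperature g) ^ ((N : ℝ) / 2) *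
    Real.exp (-‖v - bulkVelocity g‖ ^ 2 / (2 * temperature g))

/-! ### Solutions -/

/-- `f` is a non-negative mild solution on the time interval `[0, T]` of
`∂_t f + v · ∇_x f = M(f) - f`, `f(0) = f₀`, posed for `(x, v) ∈ ℝᴺ × ℝᴺ`: its mass, momentum and
energy densities are finite, and at every time `t ∈ [0, T]`, for almost every `(x, v)`,
`f(t,x,v) = e^{-t} f₀(x - tv, v) + ∫₀ᵗ e^{-(t-s)} M(f)(s, x - (t-s)v, v) ds`. -/
structure IsMildSolution {N : ℕ} (T : ℝ) (f₀ : Space N → Space N → ℝ)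
    (f : ℝ → Space N → Space N → ℝ) : Prop where
  measurable : Measurable fun z : ℝ × Space N × Space N => f z.1 z.2.1 z.2.2
  nonneg : ∀ t ∈ Icc 0 T, ∀ᵐ z : Space N × Space N, 0 ≤ f t z.1 z.2
  moments : ∀ t ∈ Icc 0 T, ∀ᵐ x : Space N, Integrable fun v : Space N => (1 + ‖v‖ ^ 2) * f t x v
  intervalIntegrable : ∀ t ∈ Icc 0 T, ∀ᵐ z : Space N × Space N,
    IntervalIntegrable
      (fun s => Real.exp (-(t - s)) * localMaxwellian (f s (z.1 - (t - s) • z.2)) z.2) volume 0 t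
  duhamel : ∀ t ∈ Icc 0 T, ∀ᵐ z : Space N × Space N,
    f t z.1 z.2 = Real.exp (-t) * f₀ (z.1 - t • z.2) z.2 +
      ∫ s in (0 : ℝ)..t, Real.exp (-(t - s)) * localMaxwellian (f s (z.1 - (t - s) • z.2)) z.2

/-- The macroscopic fields of `f` satisfy, for `t ∈ [0, T]` and almost every `x`, with some
positive constants `C₁, …, C₅` independent of `t` and `x`,
`C₁ ≤ ρ(t,x) / ((1+|x|)^{(N-2δ-β)γ-ω} e^{-α|x|^{βγ}}) ≤ C₂`, `|u(t,x)| ≤ C₃ (1+|x|^γ) t^{1/4}`,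
`C₄ ≤ T(t,x) / (1+|x|^{2γ}) ≤ C₅`. -/
def HasMacroscopicBounds {N : ℕ} (α β γ δ ω T : ℝ) (f : ℝ → Space N → Space N → ℝ) : Prop :=
  ∃ C₁ > 0, ∃ C₂ > 0, ∃ C₃ > 0, ∃ C₄ > 0, ∃ C₅ > 0, ∀ t ∈ Icc 0 T, ∀ᵐ x : Space N,
    density (f t x) / ((1 + ‖x‖) ^ ((N - 2 * δ - β) * γ - ω) *
      Real.exp (-α * ‖x‖ ^ (β * γ))) ∈ Icc C₁ C₂ ∧
    ‖bulkVelocity (f t x)‖ ≤ C₃ * (1 + ‖x‖ ^ γ) * t ^ (1 / 4 : ℝ) ∧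
    temperature (f t x) / (1 + ‖x‖ ^ (2 * γ)) ∈ Icc C₄ C₅

open Classical in
/-- The truncated datum
`c (1+|x|)^{-ω} (1+|v|²)^{-δ} e^{-α|v|^β}` on `|x|^γ ≤ |v| ≤ 2|x|^γ + 10`, and `0` elsewhere. -/
def truncatedDatum {N : ℕ} (α β γ δ ω c : ℝ) (x v : Space N) : ℝ :=
  if ‖x‖ ^ γ ≤ ‖v‖ ∧ ‖v‖ ≤ 2 * ‖x‖ ^ γ + 10 then
    c * (1 + ‖x‖) ^ (-ω) * (1 + ‖v‖ ^ 2) ^ (-δ) * Real.exp (-α * ‖v‖ ^ β)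
  else 0

/-- `f₀(x, v)` does not depend on `x`, up to null sets. -/
def SpatiallyHomogeneous {N : ℕ} (f₀ : Space N → Space N → ℝ) : Prop :=
  ∃ h : Space N → ℝ, ∀ᵐ z : Space N × Space N, f₀ z.1 z.2 = h z.2

end

end BGK

/-! The mechanism is a mismatch of tails. Take γ = 1/3 and put L = (1+|x|)^{1/3}. At x the datum
lives on speeds at least |x|^{1/3}, and e^{-α s^β} falls off on the scale L^{1-β}, so the mass sits
essentially in a shell of that thickness at |v| ≈ L. The density is therefore comparable with b L^N,
where b = L^{-m} e^{-α L^β} and m = 3ω + 2δ + β, while the mean energy is of order L². Relaxation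
creates a Maxwellian of temperature ≈ L², that is, of size b e^{-κ|v|²/L²}. At |v| = BL this is
still a constant times b, but the weight there is at least e^{α' B^β L^β}. A large B beats e^{-α
L^β} for every α' > 0, and letting |x| → ∞ makes the weighted solution arbitrarily large on sets of
volume at least one, at every positive time (`Profile.exists_le_solution`, `exists_le_weight_mul`,
`mixedNorm_eq_top`).

This needs fields that stay comparable with the profile for a short time. The local Maxwellian
depends on the solution only through its moments, and does so in a Lipschitz way at the scale L
(`exists_localMaxwellian_lipschitz`). Free transport does not keep a Gaussian profile Gaussian, but
the result is dominated by b e^{-|v|/L} (`exists_amplitude_transport`), whose moments have the right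
size. The loop from envelope to moments to Gaussian and back to envelope thus closes. It makes
Duhamel's formula a contraction on a short interval (`Profile.CentredDatum.exists_solution`) and,
with an exponential weight in time, gives uniqueness on every interval (`Profile.unique`).

The remaining input is that the moments of the discontinuous datum vary slowly under transport. A
displacement t|v| ≲ tL of x moves the edge |x|^{1/3} by about t/L away from the origin, and for β ≤
2 this is at most a fraction t of the shell thickness L^{1-β}. Near the origin the cube root is only
Hölder continuous, and t^{1/4} is used instead (`abs_cbrt_sub_le`, `exists_momentDist_le`). The
datum has zero momentum by symmetry, so the bulk velocity starts at zero and is of order t^{1/4} L.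
Finally ω = 4(N+1)/3 makes the weighted datum integrable: on its support |v| ≲ L, so decay in x also
pays for decay in v, and c makes it small. -/

namespace BGK

noncomputable section

/-! ### Maxwellians with comparable macroscopic fields -/

/-- The Maxwellian with density `ρ`, temperature `θ` and bulk velocity `u`. -/
def maxwellian {N : ℕ} (ρ θ : ℝ) (u v : Space N) : ℝ :=
  ρ / (2 * Real.pi * θ) ^ ((N : ℝ) / 2) * Real.exp (-‖v - u‖ ^ 2 / (2 * θ))

/-- The fields `ρ, θ, u` are comparable with `b Lᴺ, L²` and dominated by `L`, up to the factor
`A`. -/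
structure FieldBounds {N : ℕ} (A b L ρ θ : ℝ) (u : Space N) : Prop where
  le_density : b * L ^ N / A ≤ ρ
  density_le : ρ ≤ A * (b * L ^ N)
  norm_le : ‖u‖ ≤ A * L
  le_temp : L ^ 2 / A ≤ θ
  temp_le : θ ≤ A * L ^ 2

theorem FieldBounds.mono {N : ℕ} {A A' b L ρ θ : ℝ} {u : Space N} (hA : 0 < A) (hAA : A ≤ A')
    (hb : 0 < b) (hL : 0 < L) (h : FieldBounds A b L ρ θ u) : FieldBounds A' b L ρ θ u where
  le_density := le_trans (by gcongr) h.le_density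
  density_le := h.density_le.trans (by gcongr)
  norm_le := h.norm_le.trans (by gcongr)
  le_temp := le_trans (by gcongr) h.le_temp
  temp_le := h.temp_le.trans (by gcongr)

section

variable {N : ℕ} {A b L ρ θ : ℝ} {u : Space N}

theorem FieldBounds.density_pos (hA : 0 < A) (hb : 0 < b) (hL : 0 < L)
    (h : FieldBounds A b L ρ θ u) : 0 < ρ :=
  lt_of_lt_of_le (by positivity) h.le_density

theorem FieldBounds.temp_pos (hA : 0 < A) (hL : 0 < L)
    (h : FieldBounds A b L ρ θ u) : 0 < θ :=
  lt_of_lt_of_le (by positivity) h.le_temp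

theorem rpow_half_mul_sq {a L : ℝ} (N : ℕ) (ha : 0 ≤ a) (hL : 0 ≤ L) :
    (a * L ^ 2) ^ ((N : ℝ) / 2) = a ^ ((N : ℝ) / 2) * L ^ N := by
  rw [Real.mul_rpow ha (by positivity), ← Real.rpow_natCast L 2, ← Real.rpow_mul hL]
  congr 1
  rw [← Real.rpow_natCast]
  congr 1
  push_cast
  ring

theorem maxwellian_nonneg {v : Space N} (hρ : 0 ≤ ρ) (hθ : 0 ≤ θ) : 0 ≤ maxwellian ρ θ u v := by
  unfold maxwellian
  positivity

/-- The factor `L ^ N` of the density cancels against the normalisation `(2πθ)^{N/2}`, which is of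
order `L ^ N`. So `b` is the size of the Maxwellian itself. -/
theorem FieldBounds.prefactor_le (hA : 0 < A) (hb : 0 < b) (hL : 0 < L)
    (h : FieldBounds A b L ρ θ u) :
    ρ / (2 * Real.pi * θ) ^ ((N : ℝ) / 2) ≤ A / (2 * Real.pi / A) ^ ((N : ℝ) / 2) * b := by
  have h1 : (2 * Real.pi / A) ^ ((N : ℝ) / 2) * L ^ N ≤ (2 * Real.pi * θ) ^ ((N : ℝ) / 2) := by
    rw [← rpow_half_mul_sq N (by positivity) hL.le]
    apply Real.rpow_le_rpow (by positivity) _ (by positivity)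
    have := h.le_temp
    calc 2 * Real.pi / A * L ^ 2 = 2 * Real.pi * (L ^ 2 / A) := by ring
      _ ≤ _ := by gcongr
  calc ρ / (2 * Real.pi * θ) ^ ((N : ℝ) / 2)
      ≤ A * (b * L ^ N) / ((2 * Real.pi / A) ^ ((N : ℝ) / 2) * L ^ N) := by
        gcongr
        exact h.density_le
    _ = _ := by field_simp

theorem FieldBounds.le_prefactor (hA : 0 < A) (hb : 0 < b) (hL : 0 < L)
    (h : FieldBounds A b L ρ θ u) :
    (A * (2 * Real.pi * A) ^ ((N : ℝ) / 2))⁻¹ * b ≤ ρ / (2 * Real.pi * θ) ^ ((N : ℝ) / 2) := by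
  have hθ := h.temp_pos hA hL
  have h1 : (2 * Real.pi * θ) ^ ((N : ℝ) / 2) ≤ (2 * Real.pi * A) ^ ((N : ℝ) / 2) * L ^ N := by
    rw [← rpow_half_mul_sq N (by positivity) hL.le]
    apply Real.rpow_le_rpow (by positivity) _ (by positivity)
    have := h.temp_le
    calc 2 * Real.pi * θ ≤ 2 * Real.pi * (A * L ^ 2) := by gcongr
      _ = _ := by ring
  calc (A * (2 * Real.pi * A) ^ ((N : ℝ) / 2))⁻¹ * b
      = (b * L ^ N / A) / ((2 * Real.pi * A) ^ ((N : ℝ) / 2) * L ^ N) := by field_simp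
    _ ≤ _ := by
        gcongr
        · exact (h.density_pos hA hb hL).le
        · exact h.le_density

/-- Since `|u|²/θ` is bounded in terms of `A`, recentring the Gaussian at the origin costs only a
constant in the exponent. -/
theorem FieldBounds.le_energy (hA : 0 < A) (hL : 0 < L)
    (h : FieldBounds A b L ρ θ u) (v : Space N) :
    (‖v‖ / L) ^ 2 / (4 * A) - A ^ 3 / 2 ≤ ‖v - u‖ ^ 2 / (2 * θ) := by
  have hθ := h.temp_pos hA hL
  have h1 : ‖v‖ ^ 2 / 2 - ‖u‖ ^ 2 ≤ ‖v - u‖ ^ 2 := by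
    have : ‖v‖ ≤ ‖v - u‖ + ‖u‖ := by simpa using norm_add_le (v - u) u
    nlinarith [norm_nonneg v, norm_nonneg u, norm_nonneg (v - u), sq_nonneg (‖v - u‖ - ‖u‖)]
  have h2 : (‖v‖ / L) ^ 2 / (4 * A) ≤ ‖v‖ ^ 2 / 2 / (2 * θ) := by
    rw [div_pow, div_div, div_div]
    apply div_le_div_of_nonneg_left (by positivity) (by positivity)
    linarith [h.temp_le]
  have h3 : ‖u‖ ^ 2 / (2 * θ) ≤ A ^ 3 / 2 := by
    have hu : ‖u‖ ^ 2 ≤ (A * L) ^ 2 := by gcongr; exact h.norm_le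
    have : ‖u‖ ^ 2 / (2 * θ) ≤ (A * L) ^ 2 / (2 * (L ^ 2 / A)) := by
      gcongr
      exact h.le_temp
    refine this.trans (le_of_eq ?_)
    field_simp
  calc _ ≤ ‖v‖ ^ 2 / 2 / (2 * θ) - ‖u‖ ^ 2 / (2 * θ) := by linarith
    _ = (‖v‖ ^ 2 / 2 - ‖u‖ ^ 2) / (2 * θ) := by ring
    _ ≤ _ := by gcongr

theorem FieldBounds.energy_le (hA : 0 < A) (hL : 0 < L)
    (h : FieldBounds A b L ρ θ u) (v : Space N) :
    ‖v - u‖ ^ 2 / (2 * θ) ≤ A * (‖v‖ / L) ^ 2 + A ^ 3 := by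
  have hθ := h.temp_pos hA hL
  have h1 : ‖v - u‖ ^ 2 ≤ 2 * ‖v‖ ^ 2 + 2 * (A * L) ^ 2 := by
    have h2 : ‖v - u‖ ≤ ‖v‖ + ‖u‖ := norm_sub_le v u
    have h3 := h.norm_le
    have hu : ‖u‖ ^ 2 ≤ (A * L) ^ 2 := by gcongr
    have h4 : ‖v - u‖ ^ 2 ≤ (‖v‖ + ‖u‖) ^ 2 := by gcongr
    nlinarith [sq_nonneg (‖v‖ - ‖u‖)]
  calc ‖v - u‖ ^ 2 / (2 * θ) ≤ (2 * ‖v‖ ^ 2 + 2 * (A * L) ^ 2) / (2 * (L ^ 2 / A)) := by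
        gcongr
        exact h.le_temp
    _ = _ := by field_simp

/-- Upper Gaussian bound for a Maxwellian with comparable fields. -/
theorem FieldBounds.maxwellian_le (hA : 0 < A) (hb : 0 < b) (hL : 0 < L)
    (h : FieldBounds A b L ρ θ u) (v : Space N) :
    maxwellian ρ θ u v ≤ A / (2 * Real.pi / A) ^ ((N : ℝ) / 2) * Real.exp (A ^ 3 / 2) *
      (b * Real.exp (-(1 / (4 * A)) * (‖v‖ / L) ^ 2)) := by
  have h1 := h.le_energy hA hL v
  calc maxwellian ρ θ u v
      ≤ (A / (2 * Real.pi / A) ^ ((N : ℝ) / 2) * b) *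
        Real.exp (A ^ 3 / 2 + -(1 / (4 * A)) * (‖v‖ / L) ^ 2) := by
        unfold maxwellian
        gcongr
        · exact h.prefactor_le hA hb hL
        · have : (‖v‖ / L) ^ 2 / (4 * A) = 1 / (4 * A) * (‖v‖ / L) ^ 2 := by ring
          rw [neg_div]; linarith
    _ = _ := by rw [Real.exp_add]; ring

/-- Lower Gaussian bound for a Maxwellian with comparable fields. -/
theorem FieldBounds.le_maxwellian (hA : 0 < A) (hb : 0 < b) (hL : 0 < L)
    (h : FieldBounds A b L ρ θ u) (v : Space N) :
    (A * (2 * Real.pi * A) ^ ((N : ℝ) / 2))⁻¹ * Real.exp (-A ^ 3) *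
      (b * Real.exp (-A * (‖v‖ / L) ^ 2)) ≤ maxwellian ρ θ u v := by
  have h1 := h.energy_le hA hL v
  have hρ := h.density_pos hA hb hL
  have hθ := h.temp_pos hA hL
  calc _ = ((A * (2 * Real.pi * A) ^ ((N : ℝ) / 2))⁻¹ * b) *
        Real.exp (-A ^ 3 + -A * (‖v‖ / L) ^ 2) := by rw [Real.exp_add]; ring
    _ ≤ _ := by
        unfold maxwellian
        gcongr
        · exact h.le_prefactor hA hb hL
        · rw [neg_div]; linarith

end

/-! ### Lipschitz dependence of Maxwellians on their fields. -/

theorem abs_log_sub_log_le {m a b : ℝ} (hm : 0 < m) (ha : m ≤ a) (hb : m ≤ b) :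
    |Real.log a - Real.log b| ≤ |a - b| / m := by
  wlog h : b ≤ a generalizing a b
  · rw [abs_sub_comm, abs_sub_comm a]
    exact this hb ha (le_of_not_ge h)
  have hb0 : 0 < b := hm.trans_le hb
  have ha0 : 0 < a := hm.trans_le ha
  rw [abs_of_nonneg (sub_nonneg.2 (Real.log_le_log hb0 h)), abs_of_nonneg (sub_nonneg.2 h),
    ← Real.log_div ha0.ne' hb0.ne']
  calc Real.log (a / b) ≤ a / b - 1 := Real.log_le_sub_one_of_pos (by positivity)
    _ = (a - b) / b := by field_simp
    _ ≤ (a - b) / m := by gcongr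

theorem abs_exp_sub_exp_le (p q : ℝ) :
    |Real.exp p - Real.exp q| ≤ |p - q| * (Real.exp p + Real.exp q) := by
  wlog h : q ≤ p generalizing p q
  · rw [abs_sub_comm, abs_sub_comm p, add_comm]
    exact this q p (le_of_not_ge h)
  rw [abs_of_nonneg (sub_nonneg.2 (Real.exp_le_exp.2 h)), abs_of_nonneg (sub_nonneg.2 h)]
  have h1 : Real.exp q = Real.exp p * Real.exp (q - p) := by rw [← Real.exp_add]; ring_nf
  have h2 := Real.add_one_le_exp (q - p)
  have h3 := Real.exp_pos p
  have h4 := Real.exp_pos q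
  nlinarith [mul_nonneg (sub_nonneg.2 h) h4.le, mul_le_mul_of_nonneg_left h2 h3.le]

/-- With the prefactor moved into the exponent, a difference of Maxwellians reduces to a difference
of exponents, where the three fields enter additively. -/
theorem maxwellian_eq_exp {N : ℕ} {ρ θ : ℝ} (hρ : 0 < ρ) (hθ : 0 < θ) (u v : Space N) :
    maxwellian ρ θ u v = Real.exp (Real.log ρ - (N : ℝ) / 2 * Real.log (2 * Real.pi * θ) -
      ‖v - u‖ ^ 2 / (2 * θ)) := by
  unfold maxwellian
  rw [Real.exp_sub, Real.exp_sub, Real.exp_log hρ, Real.rpow_def_of_pos (by positivity),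
    neg_div, Real.exp_neg, mul_comm (Real.log _)]
  rfl

/-- Change `u` first, with `1/θ₁` fixed, then change `1/θ`. In the scaled speed `|v|/L` both
contributions are `d` times a quadratic polynomial. -/
theorem abs_energy_sub_le {N : ℕ} {A L d θ₁ θ₂ : ℝ} {u₁ u₂ : Space N} (hA : 0 < A)
    (hL : 0 < L) (hd : 0 ≤ d) (h₁ : ‖u₁‖ ≤ A * L) (h₂ : ‖u₂‖ ≤ A * L) (hθ₁ : L ^ 2 / A ≤ θ₁)
    (hθ₂ : L ^ 2 / A ≤ θ₂) (hu : ‖u₁ - u₂‖ ≤ d * L) (hθ : |θ₁ - θ₂| ≤ d * L ^ 2) (v : Space N) :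
    |‖v - u₁‖ ^ 2 / (2 * θ₁) - ‖v - u₂‖ ^ 2 / (2 * θ₂)| ≤
      d * (A + A ^ 2) * (1 + (‖v‖ / L + A) ^ 2) := by
  have hθ₁' : 0 < θ₁ := lt_of_lt_of_le (by positivity) hθ₁
  have hθ₂' : 0 < θ₂ := lt_of_lt_of_le (by positivity) hθ₂
  set w := ‖v‖ / L with hw
  have hwv : ‖v‖ = w * L := by rw [hw]; field_simp
  have hw0 : 0 ≤ w := by positivity
  have n₁ : ‖v - u₁‖ ≤ (w + A) * L := by
    have := norm_sub_le v u₁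
    linarith
  have n₂ : ‖v - u₂‖ ≤ (w + A) * L := by
    have := norm_sub_le v u₂
    linarith
  have e1 : |‖v - u₁‖ - ‖v - u₂‖| ≤ d * L := by
    refine (abs_norm_sub_norm_le _ _).trans ?_
    rw [show v - u₁ - (v - u₂) = -(u₁ - u₂) by abel, norm_neg]
    exact hu
  have e2 : |‖v - u₁‖ ^ 2 - ‖v - u₂‖ ^ 2| ≤ d * L * (2 * ((w + A) * L)) := by
    rw [sq_sub_sq, abs_mul, mul_comm]
    apply mul_le_mul e1 _ (abs_nonneg _) (by positivity)
    rw [abs_of_nonneg (by positivity)]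
    linarith
  have e3 : |1 / θ₁ - 1 / θ₂| ≤ d * A ^ 2 / L ^ 2 := by
    rw [div_sub_div _ _ hθ₁'.ne' hθ₂'.ne', abs_div, abs_of_pos (mul_pos hθ₁' hθ₂')]
    calc |1 * θ₂ - θ₁ * 1| / (θ₁ * θ₂) ≤ d * L ^ 2 / (L ^ 2 / A * (L ^ 2 / A)) := by
          gcongr
          rw [one_mul, mul_one, abs_sub_comm]
          exact hθ
      _ = _ := by field_simp
  have e4 : 1 / θ₁ ≤ A / L ^ 2 := by
    rw [div_le_div_iff₀ hθ₁' (by positivity)]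
    rw [div_le_iff₀ hA] at hθ₁
    linarith
  have e5 : ‖v - u₂‖ ^ 2 ≤ ((w + A) * L) ^ 2 := by gcongr
  calc |‖v - u₁‖ ^ 2 / (2 * θ₁) - ‖v - u₂‖ ^ 2 / (2 * θ₂)|
      = |(‖v - u₁‖ ^ 2 - ‖v - u₂‖ ^ 2) * (1 / θ₁) / 2 +
          ‖v - u₂‖ ^ 2 * (1 / θ₁ - 1 / θ₂) / 2| := by
        congr 1
        field_simp
        ring
    _ ≤ |‖v - u₁‖ ^ 2 - ‖v - u₂‖ ^ 2| * (1 / θ₁) / 2 +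
          ‖v - u₂‖ ^ 2 * |1 / θ₁ - 1 / θ₂| / 2 := by
        refine (abs_add_le _ _).trans (le_of_eq ?_)
        rw [abs_div, abs_div, abs_mul, abs_mul, abs_of_pos (by positivity : 0 < 1 / θ₁),
          abs_of_nonneg (by positivity : 0 ≤ ‖v - u₂‖ ^ 2), abs_of_pos (by norm_num : (0:ℝ) < 2)]
    _ ≤ d * L * (2 * ((w + A) * L)) * (A / L ^ 2) / 2 +
          ((w + A) * L) ^ 2 * (d * A ^ 2 / L ^ 2) / 2 := by gcongr
    _ = d * (A * (w + A) + A ^ 2 * (w + A) ^ 2 / 2) := by field_simp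
    _ ≤ _ := by
      rw [mul_assoc]
      apply mul_le_mul_of_nonneg_left _ hd
      have : 0 < A ^ 2 := by positivity
      nlinarith [mul_nonneg hA.le (sq_nonneg (w + A - 1)), mul_nonneg this.le (sq_nonneg (w + A)),
        mul_nonneg hA.le (sq_nonneg (w + A))]

/-- Half of the Gaussian exponent pays for the quadratic factor: `(w+A)² ≤ 2w² + 2A²` and `2w² =
(2/κ)(κw²)`. -/
theorem exists_sq_mul_exp_le (A κ : ℝ) (hκ : 0 < κ) :
    ∃ C > 0, ∀ w : ℝ, 0 ≤ w →
      (1 + (w + A) ^ 2) * Real.exp (-(2 * κ) * w ^ 2) ≤ C * Real.exp (-κ * w ^ 2) := by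
  refine ⟨1 + 2 * A ^ 2 + 2 / κ, by positivity, fun w _ => ?_⟩
  have h1 : 1 + (w + A) ^ 2 ≤ (1 + 2 * A ^ 2 + 2 / κ) * Real.exp (κ * w ^ 2) := by
    have h2 := Real.add_one_le_exp (κ * w ^ 2)
    have h3 : (1 + 2 * A ^ 2 + 2 / κ) * (κ * w ^ 2 + 1) ≤
      (1 + 2 * A ^ 2 + 2 / κ) * Real.exp (κ * w ^ 2) := by gcongr
    refine le_trans ?_ h3
    have h4 : 2 / κ * (κ * w ^ 2) = 2 * w ^ 2 := by field_simp
    have h5 : 0 < 2 / κ := by positivity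
    nlinarith [sq_nonneg (w - A), mul_nonneg (by positivity : 0 ≤ (1 + 2 * A ^ 2))
      (by positivity : 0 ≤ κ * w ^ 2)]
  calc _ ≤ (1 + 2 * A ^ 2 + 2 / κ) * Real.exp (κ * w ^ 2) * Real.exp (-(2 * κ) * w ^ 2) := by
        gcongr
    _ = _ := by
        rw [mul_assoc, ← Real.exp_add]
        ring_nf

/-- Maxwellians depend in a Lipschitz way on comparable fields, with a Gaussian weight. -/
theorem exists_maxwellian_lipschitz (N : ℕ) {A : ℝ} (hA : 0 < A) :
    ∃ C > 0, ∀ (b L d ρ₁ ρ₂ θ₁ θ₂ : ℝ) (u₁ u₂ v : Space N), 0 < b → 0 < L → 0 ≤ d →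
      FieldBounds A b L ρ₁ θ₁ u₁ → FieldBounds A b L ρ₂ θ₂ u₂ →
      |ρ₁ - ρ₂| ≤ d * (b * L ^ N) → ‖u₁ - u₂‖ ≤ d * L → |θ₁ - θ₂| ≤ d * L ^ 2 →
      |maxwellian ρ₁ θ₁ u₁ v - maxwellian ρ₂ θ₂ u₂ v| ≤
        C * d * (b * Real.exp (-(1 / (8 * A)) * (‖v‖ / L) ^ 2)) := by
  obtain ⟨C₁, hC₁, h₁⟩ := exists_sq_mul_exp_le A (1 / (8 * A)) (by positivity)
  set C₂ := A / (2 * Real.pi / A) ^ ((N : ℝ) / 2) * Real.exp (A ^ 3 / 2) with hC₂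
  have hC₂' : 0 < C₂ := by positivity
  refine ⟨(A + N / 2 * A + (A + A ^ 2)) * (2 * C₂) * C₁, by positivity, ?_⟩
  intro b L d ρ₁ ρ₂ θ₁ θ₂ u₁ u₂ v hb hL hd F₁ F₂ hρ hu hθ
  have hρ₁ := F₁.density_pos hA hb hL
  have hρ₂ := F₂.density_pos hA hb hL
  have hθ₁ := F₁.temp_pos hA hL
  have hθ₂ := F₂.temp_pos hA hL
  have m₁ := F₁.maxwellian_le hA hb hL v
  have m₂ := F₂.maxwellian_le hA hb hL v
  -- The upper bound has exponent `1/(4A)`. Written as twice `1/(8A)`, one half absorbs the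
  -- polynomial and the other survives in the statement.
  rw [← hC₂, show -(1 / (4 * A)) = -(2 * (1 / (8 * A))) by field_simp; norm_num] at m₁ m₂
  have hw : 0 ≤ ‖v‖ / L := by positivity
  set w := ‖v‖ / L
  have key : |(Real.log ρ₁ - (N : ℝ) / 2 * Real.log (2 * Real.pi * θ₁) -
      ‖v - u₁‖ ^ 2 / (2 * θ₁)) - (Real.log ρ₂ - (N : ℝ) / 2 * Real.log (2 * Real.pi * θ₂) -
      ‖v - u₂‖ ^ 2 / (2 * θ₂))| ≤ d * (A + N / 2 * A + (A + A ^ 2)) * (1 + (w + A) ^ 2) := by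
    have l1 : |Real.log ρ₁ - Real.log ρ₂| ≤ d * A := by
      refine (abs_log_sub_log_le (by positivity) F₁.le_density F₂.le_density).trans ?_
      rw [div_le_iff₀ (by positivity)]
      refine hρ.trans (le_of_eq ?_)
      field_simp
    have l2 : |Real.log (2 * Real.pi * θ₁) - Real.log (2 * Real.pi * θ₂)| ≤ d * A := by
      rw [Real.log_mul (by positivity) hθ₁.ne', Real.log_mul (by positivity) hθ₂.ne',
        add_sub_add_left_eq_sub]
      refine (abs_log_sub_log_le (by positivity) F₁.le_temp F₂.le_temp).trans ?_
      rw [div_le_iff₀ (by positivity)]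
      refine hθ.trans (le_of_eq ?_)
      field_simp
    have l3 := abs_energy_sub_le hA hL hd F₁.norm_le F₂.norm_le F₁.le_temp F₂.le_temp hu hθ v
    have l4 : |(N : ℝ) / 2 * (Real.log (2 * Real.pi * θ₁) - Real.log (2 * Real.pi * θ₂))| ≤
        N / 2 * (d * A) := by
      rw [abs_mul, abs_of_nonneg (by positivity : (0 : ℝ) ≤ (N : ℝ) / 2)]
      gcongr
    calc _ = |(Real.log ρ₁ - Real.log ρ₂) -
          (N : ℝ) / 2 * (Real.log (2 * Real.pi * θ₁) - Real.log (2 * Real.pi * θ₂)) -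
          (‖v - u₁‖ ^ 2 / (2 * θ₁) - ‖v - u₂‖ ^ 2 / (2 * θ₂))| := by ring_nf
      _ ≤ d * A + N / 2 * (d * A) + d * (A + A ^ 2) * (1 + (w + A) ^ 2) := by
          refine (abs_sub _ _).trans ?_
          refine add_le_add ((abs_sub _ _).trans (add_le_add l1 l4)) l3
      _ ≤ _ := by
          have : 0 ≤ (d * A + N / 2 * (d * A)) * (w + A) ^ 2 := by positivity
          nlinarith
  rw [maxwellian_eq_exp hρ₁ hθ₁, maxwellian_eq_exp hρ₂ hθ₂] at *
  refine (abs_exp_sub_exp_le _ _).trans ?_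
  calc _ ≤ d * (A + N / 2 * A + (A + A ^ 2)) * (1 + (w + A) ^ 2) *
        (C₂ * (b * Real.exp (-(2 * (1 / (8 * A))) * w ^ 2)) +
          C₂ * (b * Real.exp (-(2 * (1 / (8 * A))) * w ^ 2))) := by
        gcongr
    _ = d * (A + N / 2 * A + (A + A ^ 2)) * (2 * C₂) * b *
        ((1 + (w + A) ^ 2) * Real.exp (-(2 * (1 / (8 * A))) * w ^ 2)) := by ring
    _ ≤ d * (A + N / 2 * A + (A + A ^ 2)) * (2 * C₂) * b *
        (C₁ * Real.exp (-(1 / (8 * A)) * w ^ 2)) :=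
        mul_le_mul_of_nonneg_left (h₁ w hw) (by positivity)
    _ = _ := by ring

/-! ### Moments -/

section

variable {N : ℕ}

/-- Solutions only come with an integrable weighted slice. Dividing by the positive weight recovers
measurability of the slice. -/
theorem aestronglyMeasurable_of_weighted {g : Space N → ℝ}
    (h : Integrable fun v : Space N => (1 + ‖v‖ ^ 2) * g v) : AEStronglyMeasurable g volume := by
  have h1 : AEStronglyMeasurable (fun v : Space N => (1 + ‖v‖ ^ 2)⁻¹ * ((1 + ‖v‖ ^ 2) * g v))
      volume := by
    apply AEStronglyMeasurable.mul _ h.aestronglyMeasurable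
    exact (by fun_prop : Measurable fun v : Space N => (1 + ‖v‖ ^ 2)⁻¹).aestronglyMeasurable
  refine h1.congr (Filter.Eventually.of_forall fun v => ?_)
  have : 0 < 1 + ‖v‖ ^ 2 := by positivity
  field_simp

theorem integrable_of_weighted {g : Space N → ℝ}
    (h : Integrable fun v : Space N => (1 + ‖v‖ ^ 2) * g v) : Integrable g := by
  refine h.mono (aestronglyMeasurable_of_weighted h) (Filter.Eventually.of_forall fun v => ?_)
  rw [norm_mul, Real.norm_of_nonneg (by positivity : 0 ≤ 1 + ‖v‖ ^ 2)]
  nlinarith [norm_nonneg (g v), sq_nonneg ‖v‖]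

theorem integrable_normSq_mul_of_weighted {g : Space N → ℝ}
    (h : Integrable fun v : Space N => (1 + ‖v‖ ^ 2) * g v) :
    Integrable fun v : Space N => ‖v‖ ^ 2 * g v := by
  have := h.sub (integrable_of_weighted h)
  refine this.congr (Filter.Eventually.of_forall fun v => ?_)
  simp only [Pi.sub_apply]
  ring

theorem integrable_smul_of_weighted {g : Space N → ℝ}
    (h : Integrable fun v : Space N => (1 + ‖v‖ ^ 2) * g v) :
    Integrable fun v : Space N => g v • v := by
  refine h.mono ((aestronglyMeasurable_of_weighted h).smul aestronglyMeasurable_id)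
    (Filter.Eventually.of_forall fun v => ?_)
  rw [norm_smul, norm_mul, Real.norm_of_nonneg (by positivity : 0 ≤ 1 + ‖v‖ ^ 2), mul_comm]
  gcongr
  nlinarith [sq_nonneg (‖v‖ - 1), norm_nonneg v]

theorem integrable_scaled_of_weighted {g : Space N → ℝ} (L : ℝ)
    (h : Integrable fun v : Space N => (1 + ‖v‖ ^ 2) * g v) :
    Integrable fun v : Space N => (1 + (‖v‖ / L) ^ 2) * |g v| := by
  have h1 := (integrable_of_weighted h).abs.add
    ((integrable_normSq_mul_of_weighted h).abs.const_mul (1 / L ^ 2))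
  refine h1.congr (Filter.Eventually.of_forall fun v => ?_)
  simp only [Pi.add_apply, abs_mul, abs_of_nonneg (by positivity : 0 ≤ ‖v‖ ^ 2)]
  ring

/-- The scaled weighted `L¹` distance of two velocity distributions. -/
def momentDist (L : ℝ) (g₁ g₂ : Space N → ℝ) : ℝ :=
  ∫ v, (1 + (‖v‖ / L) ^ 2) * |g₁ v - g₂ v|

/-- The momentum `∫ v g dv`. -/
def momentum (g : Space N → ℝ) : Space N := ∫ v, g v • v

/-- The energy `∫ |v|² g dv`. -/
def energy (g : Space N → ℝ) : ℝ := ∫ v, ‖v‖ ^ 2 * g v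

theorem momentDist_nonneg (L : ℝ) (g₁ g₂ : Space N → ℝ) : 0 ≤ momentDist L g₁ g₂ :=
  integral_nonneg fun v => by positivity

/-! ### Control of the moments by the scaled weighted distance. -/

section Dist

variable {g₁ g₂ : Space N → ℝ} {L : ℝ}

theorem integrable_momentDist
    (h₁ : Integrable fun v : Space N => (1 + ‖v‖ ^ 2) * g₁ v)
    (h₂ : Integrable fun v : Space N => (1 + ‖v‖ ^ 2) * g₂ v) :
    Integrable fun v : Space N => (1 + (‖v‖ / L) ^ 2) * |g₁ v - g₂ v| := by
  apply integrable_scaled_of_weighted L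
  refine (h₁.sub h₂).congr (Filter.Eventually.of_forall fun v => ?_)
  simp only [Pi.sub_apply]
  ring

theorem abs_density_sub_le
    (h₁ : Integrable fun v : Space N => (1 + ‖v‖ ^ 2) * g₁ v)
    (h₂ : Integrable fun v : Space N => (1 + ‖v‖ ^ 2) * g₂ v) :
    |density g₁ - density g₂| ≤ momentDist L g₁ g₂ := by
  unfold density momentDist
  rw [← integral_sub (integrable_of_weighted h₁) (integrable_of_weighted h₂), ← Real.norm_eq_abs]
  refine norm_integral_le_of_norm_le (integrable_momentDist h₁ h₂)
    (Filter.Eventually.of_forall fun v => ?_)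
  rw [Real.norm_eq_abs]
  nlinarith [abs_nonneg (g₁ v - g₂ v), sq_nonneg (‖v‖ / L)]

theorem norm_momentum_sub_le (hL : 0 < L)
    (h₁ : Integrable fun v : Space N => (1 + ‖v‖ ^ 2) * g₁ v)
    (h₂ : Integrable fun v : Space N => (1 + ‖v‖ ^ 2) * g₂ v) :
    ‖momentum g₁ - momentum g₂‖ ≤ momentDist L g₁ g₂ * L := by
  unfold momentum momentDist
  rw [← integral_sub (integrable_smul_of_weighted h₁) (integrable_smul_of_weighted h₂),
    ← integral_mul_const]
  refine norm_integral_le_of_norm_le ((integrable_momentDist h₁ h₂).mul_const L)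
    (Filter.Eventually.of_forall fun v => ?_)
  rw [← sub_smul, norm_smul, Real.norm_eq_abs]
  have e : ‖v‖ = ‖v‖ / L * L := by field_simp
  have h0 : ‖v‖ / L ≤ 1 + (‖v‖ / L) ^ 2 := by nlinarith [sq_nonneg (‖v‖ / L - 1)]
  calc |g₁ v - g₂ v| * ‖v‖ = ‖v‖ / L * |g₁ v - g₂ v| * L := by rw [e]; field_simp
    _ ≤ _ := by gcongr

theorem abs_energy_sub_energy_le (hL : 0 < L)
    (h₁ : Integrable fun v : Space N => (1 + ‖v‖ ^ 2) * g₁ v)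
    (h₂ : Integrable fun v : Space N => (1 + ‖v‖ ^ 2) * g₂ v) :
    |energy g₁ - energy g₂| ≤ momentDist L g₁ g₂ * L ^ 2 := by
  unfold energy momentDist
  rw [← integral_sub (integrable_normSq_mul_of_weighted h₁)
    (integrable_normSq_mul_of_weighted h₂), ← integral_mul_const, ← Real.norm_eq_abs]
  refine norm_integral_le_of_norm_le ((integrable_momentDist h₁ h₂).mul_const _)
    (Filter.Eventually.of_forall fun v => ?_)
  rw [← mul_sub, norm_mul, Real.norm_eq_abs (g₁ v - g₂ v), Real.norm_of_nonneg (by positivity)]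
  calc ‖v‖ ^ 2 * |g₁ v - g₂ v| = (‖v‖ / L) ^ 2 * |g₁ v - g₂ v| * L ^ 2 := by field_simp
    _ ≤ _ := by gcongr; linarith

end Dist

theorem temperature_eq (g : Space N → ℝ) :
    temperature g = (energy g / density g - ‖bulkVelocity g‖ ^ 2) / N := rfl

theorem bulkVelocity_eq (g : Space N → ℝ) :
    bulkVelocity g = (density g)⁻¹ • momentum g := rfl

/-- The fields of `g` are comparable with `b Lᴺ, L, L²`. -/
abbrev HasFieldBounds (A b L : ℝ) (g : Space N → ℝ) : Prop :=
  FieldBounds A b L (density g) (temperature g) (bulkVelocity g)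

/-- Fields depend in a Lipschitz way on the moments. -/
theorem exists_fields_lipschitz (hN : 1 ≤ N) {A : ℝ} (hA : 0 < A) :
    ∃ C > 0, ∀ (b L d : ℝ) (g₁ g₂ : Space N → ℝ), 0 < b → 0 < L → 0 ≤ d →
      (Integrable fun v : Space N => (1 + ‖v‖ ^ 2) * g₁ v) →
      (Integrable fun v : Space N => (1 + ‖v‖ ^ 2) * g₂ v) →
      HasFieldBounds A b L g₁ → HasFieldBounds A b L g₂ →
      momentDist L g₁ g₂ ≤ d * (b * L ^ N) →
      |density g₁ - density g₂| ≤ C * d * (b * L ^ N) ∧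
      ‖bulkVelocity g₁ - bulkVelocity g₂‖ ≤ C * d * L ∧
      |temperature g₁ - temperature g₂| ≤ C * d * L ^ 2 := by
  set C₁ := A * (1 + A) with hC₁
  have hC₁' : 0 < C₁ := by positivity
  set C₂ := A * (1 + (N * A + A ^ 2)) with hC₂
  have hC₂' : 0 < C₂ := by positivity
  refine ⟨1 + C₁ + C₂ + 2 * A * C₁, by positivity, ?_⟩
  intro b L d g₁ g₂ hb hL hd i₁ i₂ F₁ F₂ hdist
  have hρ₁ := F₁.density_pos hA hb hL
  have hρ₂ := F₂.density_pos hA hb hL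
  have hB : 0 < b * L ^ N := by positivity
  set B := b * L ^ N with hB'
  have e1 : |density g₁ - density g₂| ≤ d * B := (abs_density_sub_le i₁ i₂).trans hdist
  have e2 : ‖momentum g₁ - momentum g₂‖ ≤ d * B * L :=
    (norm_momentum_sub_le hL i₁ i₂).trans (by gcongr)
  have e3 : |energy g₁ - energy g₂| ≤ d * B * L ^ 2 :=
    (abs_energy_sub_energy_le hL i₁ i₂).trans (by gcongr)
  have inv : (density g₁)⁻¹ * B ≤ A := by
    have := F₁.le_density
    rw [div_le_iff₀ hA] at this
    rw [inv_mul_le_iff₀ hρ₁]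
    linarith
  have hinv : 0 < (density g₁)⁻¹ := by positivity
  have f2 : ‖bulkVelocity g₁ - bulkVelocity g₂‖ ≤ C₁ * d * L := by
    -- The decomposition leaves `bulkVelocity g₂` rather than a momentum, so that only the assumed
    -- field bounds and `1/ρ₁` enter.
    have : bulkVelocity g₁ - bulkVelocity g₂ = (density g₁)⁻¹ • (momentum g₁ - momentum g₂) +
        ((density g₁)⁻¹ * (density g₂ - density g₁)) • bulkVelocity g₂ := by
      rw [bulkVelocity_eq, bulkVelocity_eq, smul_smul, smul_sub, mul_sub, sub_mul,
        inv_mul_cancel₀ hρ₁.ne', mul_assoc, mul_inv_cancel₀ hρ₂.ne', sub_smul]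
      simp
    rw [this]
    refine (norm_add_le _ _).trans ?_
    rw [norm_smul, norm_smul, norm_mul, Real.norm_of_nonneg hinv.le, Real.norm_eq_abs,
      abs_sub_comm]
    calc _ ≤ (density g₁)⁻¹ * (d * B * L) + (density g₁)⁻¹ * (d * B) * (A * L) := by
          gcongr
          exact F₂.norm_le
      _ = ((density g₁)⁻¹ * B) * (d * L * (1 + A)) := by ring
      _ ≤ A * (d * L * (1 + A)) := by gcongr
      _ = _ := by rw [hC₁]; ring
  have hN0 : (0 : ℝ) < N := by exact_mod_cast hN
  have hN1 : (1 : ℝ) ≤ N := by exact_mod_cast hN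
  -- No bound on the energy is assumed; it is read off from the temperature and the velocity.
  have T2 : energy g₂ / density g₂ = N * temperature g₂ + ‖bulkVelocity g₂‖ ^ 2 := by
    rw [temperature_eq]; field_simp; ring
  have T2' : |energy g₂ / density g₂| ≤ (N * A + A ^ 2) * L ^ 2 := by
    rw [T2, abs_of_nonneg (by have := F₂.temp_pos hA hL; positivity)]
    have h1 : ‖bulkVelocity g₂‖ ^ 2 ≤ (A * L) ^ 2 := by gcongr; exact F₂.norm_le
    have h2 := F₂.temp_le
    calc _ ≤ N * (A * L ^ 2) + (A * L) ^ 2 := by gcongr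
      _ = _ := by ring
  have f3 : |energy g₁ / density g₁ - energy g₂ / density g₂| ≤ C₂ * d * L ^ 2 := by
    have : energy g₁ / density g₁ - energy g₂ / density g₂ =
        (density g₁)⁻¹ * (energy g₁ - energy g₂) +
        (density g₁)⁻¹ * (density g₂ - density g₁) * (energy g₂ / density g₂) := by
      field_simp
      ring
    rw [this]
    refine (abs_add_le _ _).trans ?_
    rw [abs_mul, abs_mul, abs_mul, abs_of_pos hinv, abs_sub_comm (density g₂)]
    calc _ ≤ (density g₁)⁻¹ * (d * B * L ^ 2) +
          (density g₁)⁻¹ * (d * B) * ((N * A + A ^ 2) * L ^ 2) := by gcongr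
      _ = ((density g₁)⁻¹ * B) * (d * L ^ 2 * (1 + (N * A + A ^ 2))) := by ring
      _ ≤ A * (d * L ^ 2 * (1 + (N * A + A ^ 2))) := by gcongr
      _ = _ := by rw [hC₂]; ring
  have f4 : |‖bulkVelocity g₁‖ ^ 2 - ‖bulkVelocity g₂‖ ^ 2| ≤ 2 * A * C₁ * d * L ^ 2 := by
    rw [sq_sub_sq, abs_mul, abs_of_nonneg (by positivity)]
    have h1 := (abs_norm_sub_norm_le (bulkVelocity g₁) (bulkVelocity g₂)).trans f2
    have h2 : ‖bulkVelocity g₁‖ + ‖bulkVelocity g₂‖ ≤ 2 * (A * L) := by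
      linarith [F₁.norm_le, F₂.norm_le]
    calc _ ≤ 2 * (A * L) * (C₁ * d * L) := by gcongr
      _ = _ := by ring
  have dL : 0 ≤ d * L := by positivity
  have dL2 : 0 ≤ d * L ^ 2 := by positivity
  have dB : 0 ≤ d * B := by positivity
  have pA : 0 ≤ 2 * A * C₁ := by positivity
  refine ⟨e1.trans ?_, f2.trans ?_, ?_⟩
  · have : 0 ≤ (C₁ + C₂ + 2 * A * C₁) * (d * B) := by positivity
    linarith
  · have : 0 ≤ (1 + C₂ + 2 * A * C₁) * (d * L) := by positivity
    linarith
  · rw [temperature_eq, temperature_eq, ← sub_div, abs_div, abs_of_pos hN0]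
    refine (div_le_self (abs_nonneg _) hN1).trans ?_
    calc _ = |(energy g₁ / density g₁ - energy g₂ / density g₂) -
          (‖bulkVelocity g₁‖ ^ 2 - ‖bulkVelocity g₂‖ ^ 2)| := by ring_nf
      _ ≤ C₂ * d * L ^ 2 + 2 * A * C₁ * d * L ^ 2 :=
          (abs_sub _ _).trans (add_le_add f3 f4)
      _ ≤ _ := by
        have : 0 ≤ (1 + C₁) * (d * L ^ 2) := by positivity
        linarith

/-- Lipschitz dependence of local Maxwellians on the distribution. -/
theorem exists_localMaxwellian_lipschitz (hN : 1 ≤ N) {A : ℝ} (hA : 0 < A) :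
    ∃ C > 0, ∀ (b L d : ℝ) (g₁ g₂ : Space N → ℝ) (v : Space N), 0 < b → 0 < L → 0 ≤ d →
      (Integrable fun v : Space N => (1 + ‖v‖ ^ 2) * g₁ v) →
      (Integrable fun v : Space N => (1 + ‖v‖ ^ 2) * g₂ v) →
      HasFieldBounds A b L g₁ → HasFieldBounds A b L g₂ →
      momentDist L g₁ g₂ ≤ d * (b * L ^ N) →
      |localMaxwellian g₁ v - localMaxwellian g₂ v| ≤
        C * d * (b * Real.exp (-(1 / (8 * A)) * (‖v‖ / L) ^ 2)) := by
  obtain ⟨C₁, hC₁, h₁⟩ := exists_fields_lipschitz hN hA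
  obtain ⟨C₂, hC₂, h₂⟩ := exists_maxwellian_lipschitz N hA
  refine ⟨C₂ * C₁, by positivity, ?_⟩
  intro b L d g₁ g₂ v hb hL hd i₁ i₂ F₁ F₂ hdist
  obtain ⟨k1, k2, k3⟩ := h₁ b L d g₁ g₂ hb hL hd i₁ i₂ F₁ F₂ hdist
  rw [mul_assoc C₂]
  exact h₂ b L (C₁ * d) _ _ _ _ _ _ v hb hL (by positivity) F₁ F₂ k1 k2 k3

/-- A distribution whose moments are close to those of a centred reference distribution has
comparable fields and small bulk velocity. -/
theorem fieldBounds_of_close (hN : 1 ≤ N) {a b L d : ℝ} {g g₀ : Space N → ℝ} (ha : 0 < a)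
    (ha1 : a ≤ 1) (hb : 0 < b) (hL : 0 < L) (hd : d ≤ a ^ 2 / 8)
    (i : Integrable fun v : Space N => (1 + ‖v‖ ^ 2) * g v)
    (i₀ : Integrable fun v : Space N => (1 + ‖v‖ ^ 2) * g₀ v)
    (hρ₀ : density g₀ ∈ Icc (a * (b * L ^ N)) (b * L ^ N / a))
    (hE₀ : energy g₀ ∈ Icc (a * (b * L ^ N) * L ^ 2) (b * L ^ N * L ^ 2 / a))
    (hP₀ : momentum g₀ = 0) (hdist : momentDist L g g₀ ≤ d * (b * L ^ N)) :
    HasFieldBounds (8 * N / a ^ 2) b L g ∧ ‖bulkVelocity g‖ ≤ 2 / a * d * L := by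
  have hB : 0 < b * L ^ N := by positivity
  set B := b * L ^ N with hB'
  have hd0 : 0 ≤ d := by
    have := (momentDist_nonneg L g g₀).trans hdist
    exact nonneg_of_mul_nonneg_left this hB
  have hN0 : (0 : ℝ) < N := by exact_mod_cast hN
  have hN1 : (1 : ℝ) ≤ N := by exact_mod_cast hN
  have e1 : |density g - density g₀| ≤ d * B := (abs_density_sub_le i i₀).trans hdist
  have e2 : ‖momentum g - momentum g₀‖ ≤ d * B * L :=
    (norm_momentum_sub_le hL i i₀).trans (by gcongr)
  have e3 : |energy g - energy g₀| ≤ d * B * L ^ 2 :=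
    (abs_energy_sub_energy_le hL i i₀).trans (by gcongr)
  rw [hP₀, sub_zero] at e2
  rw [abs_le] at e1 e3
  have hda : d ≤ a / 2 := by nlinarith
  have hda' : d ≤ 1 / a := by
    rw [le_div_iff₀ ha]; nlinarith
  have hBL : 0 < B * L ^ 2 := by positivity
  have r1 : a / 2 * B ≤ density g := by nlinarith [hρ₀.1]
  have r2 : density g ≤ 2 / a * B := by
    have h1 : d * B ≤ 1 / a * B := by gcongr
    have h2 : 2 / a * B = B / a + 1 / a * B := by ring
    linarith [hρ₀.2]
  have E1 : a / 2 * (B * L ^ 2) ≤ energy g := by nlinarith [hE₀.1]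
  have E2 : energy g ≤ 2 / a * (B * L ^ 2) := by
    have h1 : d * (B * L ^ 2) ≤ 1 / a * (B * L ^ 2) := by gcongr
    have h2 : 2 / a * (B * L ^ 2) = B * L ^ 2 / a + 1 / a * (B * L ^ 2) := by ring
    linarith [hE₀.2]
  have hρ : 0 < density g := lt_of_lt_of_le (by positivity) r1
  have hu : ‖bulkVelocity g‖ ≤ 2 / a * d * L := by
    rw [bulkVelocity_eq, norm_smul, norm_inv, Real.norm_of_nonneg hρ.le, inv_mul_le_iff₀ hρ]
    calc ‖momentum g‖ ≤ d * B * L := e2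
      _ = a / 2 * B * (2 / a * d * L) := by field_simp
      _ ≤ _ := by gcongr
  -- The threshold `a²/8` on `d` serves here: `|u|²` takes at most `a²L²/16` out of the mean energy,
  -- which is at least `a²L²/4`, so the temperature stays of order `L²`.
  have hu2 : ‖bulkVelocity g‖ ≤ a / 4 * L := by
    refine hu.trans ?_
    gcongr
    calc 2 / a * d ≤ 2 / a * (a ^ 2 / 8) := by gcongr
      _ = a / 4 := by field_simp; norm_num
  have hu3 : ‖bulkVelocity g‖ ^ 2 ≤ a ^ 2 / 16 * L ^ 2 := by
    calc _ ≤ (a / 4 * L) ^ 2 := by gcongr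
      _ = _ := by ring
  have q1 : a ^ 2 / 4 * L ^ 2 ≤ energy g / density g := by
    rw [le_div_iff₀ hρ]
    calc a ^ 2 / 4 * L ^ 2 * density g ≤ a ^ 2 / 4 * L ^ 2 * (2 / a * B) := by gcongr
      _ = a / 2 * (B * L ^ 2) := by field_simp; norm_num
      _ ≤ _ := E1
  have q2 : energy g / density g ≤ 4 / a ^ 2 * L ^ 2 := by
    rw [div_le_iff₀ hρ]
    calc energy g ≤ 2 / a * (B * L ^ 2) := E2
      _ = 4 / a ^ 2 * L ^ 2 * (a / 2 * B) := by field_simp; norm_num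
      _ ≤ _ := by gcongr
  have ha2 : a ^ 2 ≤ 1 := by nlinarith
  have hL2 : 0 < L ^ 2 := by positivity
  refine ⟨⟨?_, ?_, ?_, ?_, ?_⟩, hu⟩
  · refine le_trans ?_ r1
    rw [div_div_eq_mul_div, div_le_iff₀ (by positivity)]
    nlinarith [mul_nonneg hB.le ha.le, mul_nonneg (mul_nonneg hB.le ha.le) (sub_nonneg.2 hN1),
      mul_nonneg (mul_nonneg hB.le ha.le) (sub_nonneg.2 ha1)]
  · refine r2.trans ?_
    gcongr ?_ * B
    rw [div_le_div_iff₀ ha (by positivity)]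
    nlinarith [mul_nonneg ha.le (sub_nonneg.2 hN1), mul_nonneg ha.le (sub_nonneg.2 ha1)]
  · refine hu2.trans ?_
    gcongr <;> linarith
  · rw [temperature_eq, le_div_iff₀ hN0]
    have : L ^ 2 / (8 * N / a ^ 2) * N = a ^ 2 / 8 * L ^ 2 := by field_simp
    rw [this]
    linarith [mul_pos (by positivity : 0 < a ^ 2) hL2]
  · rw [temperature_eq, div_le_iff₀ hN0]
    have h1 : 4 / a ^ 2 * L ^ 2 ≤ 8 * N / a ^ 2 * L ^ 2 * N := by
      have h4 : 4 / a ^ 2 ≤ 8 * N / a ^ 2 := by gcongr; linarith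
      calc _ ≤ 8 * N / a ^ 2 * L ^ 2 := by gcongr
        _ ≤ _ := le_mul_of_one_le_right (by positivity) hN1
    linarith [sq_nonneg ‖bulkVelocity g‖]

/-! ### The exponential envelope -/

/-- One term of the exponential series gives `e^{1+|w|} ≥ (1+|w|)^{N+3}/(N+3)!`. Two powers absorb
the weight, and the other `N + 1` exceed the dimension. -/
theorem integrable_expEnvelope (N : ℕ) :
    Integrable fun w : Space N => (1 + ‖w‖ ^ 2) * Real.exp (-‖w‖) := by
  have h := (integrable_one_add_norm (E := Space N) (μ := volume) (r := N + 1)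
    (by simp)).const_mul ((N + 3).factorial * Real.exp 1)
  refine h.mono' (by fun_prop) (Filter.Eventually.of_forall fun w => ?_)
  rw [Real.norm_of_nonneg (by positivity)]
  have h1 := Real.pow_div_factorial_le_exp (1 + ‖w‖) (by positivity) (N + 3)
  rw [div_le_iff₀ (by positivity), Real.exp_add] at h1
  have h0 : 0 < 1 + ‖w‖ := by positivity
  rw [Real.rpow_neg h0.le, show ((N : ℝ) + 1) = ((N + 1 : ℕ) : ℝ) by push_cast; ring,
    Real.rpow_natCast, ← div_eq_mul_inv, le_div_iff₀ (by positivity), Real.exp_neg,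
    mul_right_comm, ← div_eq_mul_inv, div_le_iff₀ (Real.exp_pos _)]
  calc (1 + ‖w‖ ^ 2) * (1 + ‖w‖) ^ (N + 1) ≤ (1 + ‖w‖) ^ 2 * (1 + ‖w‖) ^ (N + 1) := by
        gcongr
        nlinarith [norm_nonneg w]
    _ = (1 + ‖w‖) ^ (N + 3) := by ring
    _ ≤ _ := h1.trans (le_of_eq (by ring))

/-- The mass-plus-energy integral of `e^{-|w|}`. -/
def envelopeMass (N : ℕ) : ℝ := ∫ w : Space N, (1 + ‖w‖ ^ 2) * Real.exp (-‖w‖)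

theorem envelopeMass_nonneg (N : ℕ) : 0 ≤ envelopeMass N :=
  integral_nonneg fun w => by positivity

theorem integrable_scaledEnvelope {L : ℝ} (hL : 0 < L) :
    Integrable fun v : Space N => (1 + (‖v‖ / L) ^ 2) * Real.exp (-(‖v‖ / L)) := by
  have h := (integrable_expEnvelope N).comp_smul (R := L⁻¹) (by positivity)
  refine h.congr (Filter.Eventually.of_forall fun v => ?_)
  simp only [norm_smul, norm_inv, Real.norm_of_nonneg hL.le, inv_mul_eq_div]

theorem integral_scaledEnvelope {L : ℝ} (hL : 0 < L) :
    ∫ v : Space N, (1 + (‖v‖ / L) ^ 2) * Real.exp (-(‖v‖ / L)) = envelopeMass N * L ^ N := by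
  have h := Measure.integral_comp_inv_smul_of_nonneg (volume : Measure (Space N))
    (fun w : Space N => (1 + ‖w‖ ^ 2) * Real.exp (-‖w‖)) hL.le
  simp only [norm_smul, norm_inv, Real.norm_of_nonneg hL.le, inv_mul_eq_div, finrank_euclideanSpace,
    Fintype.card_fin, smul_eq_mul] at h
  rw [h, envelopeMass, mul_comm]

theorem weighted_le_scaled {L : ℝ} (hL : 0 < L) (s : ℝ) :
    1 + s ^ 2 ≤ (1 + L ^ 2) * (1 + (s / L) ^ 2) := by
  have : s ^ 2 = L ^ 2 * (s / L) ^ 2 := by field_simp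
  nlinarith [sq_nonneg (s / L), sq_nonneg L]

theorem integrable_weighted_envelope {L : ℝ} (hL : 0 < L) :
    Integrable fun v : Space N => (1 + ‖v‖ ^ 2) * Real.exp (-(‖v‖ / L)) := by
  refine ((integrable_scaledEnvelope hL).const_mul (1 + L ^ 2)).mono' (by fun_prop)
    (Filter.Eventually.of_forall fun v => ?_)
  rw [Real.norm_of_nonneg (by positivity), ← mul_assoc]
  gcongr
  exact weighted_le_scaled hL _

/-- This converts pointwise control by the exponential envelope into moment control; the factor `L ^
N` is the Jacobian of `v = L w`. -/
theorem momentDist_le_of_envelope {g₁ g₂ : Space N → ℝ} {L D b : ℝ} (hL : 0 < L)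
    (h : ∀ᵐ v : Space N, |g₁ v - g₂ v| ≤ D * (b * Real.exp (-(‖v‖ / L)))) :
    momentDist L g₁ g₂ ≤ envelopeMass N * D * (b * L ^ N) := by
  calc momentDist L g₁ g₂
      ≤ ∫ v : Space N, D * b * ((1 + (‖v‖ / L) ^ 2) * Real.exp (-(‖v‖ / L))) := by
        apply integral_mono_of_nonneg (Filter.Eventually.of_forall fun v => by positivity)
          ((integrable_scaledEnvelope hL).const_mul _)
        filter_upwards [h] with v hv
        calc _ ≤ (1 + (‖v‖ / L) ^ 2) * (D * (b * Real.exp (-(‖v‖ / L)))) := by gcongr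
          _ = _ := by ring
    _ = _ := by
        rw [integral_const_mul, integral_scaledEnvelope hL]
        ring

end

/-! ### Measurability of the gain term and transport of null sets -/

section

variable {N : ℕ}

theorem measurable_localMaxwellian {f : ℝ → Space N → Space N → ℝ}
    (hf : Measurable fun z : ℝ × Space N × Space N => f z.1 z.2.1 z.2.2) :
    Measurable fun z : ℝ × Space N × Space N => localMaxwellian (f z.1 z.2.1) z.2.2 := by
  have hg : Measurable fun z : (ℝ × Space N) × Space N => f z.1.1 z.1.2 z.2 :=
    hf.comp (by fun_prop : Measurable fun z : (ℝ × Space N) × Space N => (z.1.1, z.1.2, z.2))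
  have hρ : Measurable fun p : ℝ × Space N => density (f p.1 p.2) :=
    (StronglyMeasurable.integral_prod_right (ν := (volume : Measure (Space N)))
      (f := fun (p : ℝ × Space N) v => f p.1 p.2 v) hg.stronglyMeasurable).measurable
  have hP : Measurable fun p : ℝ × Space N => ∫ v, f p.1 p.2 v • v :=
    (StronglyMeasurable.integral_prod_right (ν := (volume : Measure (Space N)))
      (f := fun (p : ℝ × Space N) v => f p.1 p.2 v • v)
      (hg.smul measurable_snd).stronglyMeasurable).measurable
  have hg2 : Measurable fun z : (ℝ × Space N) × Space N => ‖z.2‖ ^ 2 * f z.1.1 z.1.2 z.2 :=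
    (measurable_snd.norm.pow_const 2).mul hg
  have hE : Measurable fun p : ℝ × Space N => ∫ v, ‖v‖ ^ 2 * f p.1 p.2 v :=
    (StronglyMeasurable.integral_prod_right (ν := (volume : Measure (Space N)))
      (f := fun (p : ℝ × Space N) v => ‖v‖ ^ 2 * f p.1 p.2 v)
      hg2.stronglyMeasurable).measurable
  have hu : Measurable fun p : ℝ × Space N => bulkVelocity (f p.1 p.2) := hρ.inv.smul hP
  have hT : Measurable fun p : ℝ × Space N => temperature (f p.1 p.2) :=
    ((hE.div hρ).sub (hu.norm.pow_const 2)).div_const _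
  have hπ : Measurable fun z : ℝ × Space N × Space N => (z.1, z.2.1) := by fun_prop
  have hv : Measurable fun z : ℝ × Space N × Space N => z.2.2 := by fun_prop
  exact ((hρ.comp hπ).div (((hT.comp hπ).const_mul (2 * Real.pi)).pow_const ((N : ℝ) / 2))).mul
    (Real.measurable_exp.comp
      (((hv.sub (hu.comp hπ)).norm.pow_const 2).neg.div ((hT.comp hπ).const_mul 2)))

/-- The gain term of Duhamel's formula. -/
def gain (f : ℝ → Space N → Space N → ℝ) (t : ℝ) (x v : Space N) : ℝ :=
  ∫ s in (0 : ℝ)..t, Real.exp (-(t - s)) * localMaxwellian (f s (x - (t - s) • v)) v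

theorem measurable_gainIntegrand {f : ℝ → Space N → Space N → ℝ}
    (hf : Measurable fun z : ℝ × Space N × Space N => f z.1 z.2.1 z.2.2) :
    Measurable fun p : (ℝ × Space N × Space N) × ℝ => Real.exp (-(p.1.1 - p.2)) *
      localMaxwellian (f p.2 (p.1.2.1 - (p.1.1 - p.2) • p.1.2.2)) p.1.2.2 := by
  apply Measurable.mul (by fun_prop)
  exact (measurable_localMaxwellian hf).comp
    (by fun_prop : Measurable fun p : (ℝ × Space N × Space N) × ℝ =>
      (p.2, p.1.2.1 - (p.1.1 - p.2) • p.1.2.2, p.1.2.2))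

theorem measurable_gain {f : ℝ → Space N → Space N → ℝ}
    (hf : Measurable fun z : ℝ × Space N × Space N => f z.1 z.2.1 z.2.2) :
    Measurable fun z : ℝ × Space N × Space N => gain f z.1 z.2.1 z.2.2 := by
  have hF := measurable_gainIntegrand hf
  -- The limits of integration depend on the point. Each of the two oriented halves of the interval
  -- integral becomes an integral over the whole line of a jointly measurable indicator.
  have key : ∀ S : Set ((ℝ × Space N × Space N) × ℝ), MeasurableSet S →
      Measurable fun z : ℝ × Space N × Space N => ∫ s, S.indicator (fun p => Real.exp
        (-(p.1.1 - p.2)) * localMaxwellian (f p.2 (p.1.2.1 - (p.1.1 - p.2) • p.1.2.2)) p.1.2.2)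
        (z, s) := fun S hS =>
    (StronglyMeasurable.integral_prod_right (ν := (volume : Measure ℝ))
      (f := fun z s => S.indicator (fun p : (ℝ × Space N × Space N) × ℝ => Real.exp
        (-(p.1.1 - p.2)) * localMaxwellian (f p.2 (p.1.2.1 - (p.1.1 - p.2) • p.1.2.2)) p.1.2.2)
        (z, s)) (hF.indicator hS).stronglyMeasurable).measurable
  have h1 := key {p | p.2 ∈ Ioc 0 p.1.1} ((measurableSet_lt measurable_const measurable_snd).inter
    (measurableSet_le measurable_snd (by fun_prop)))
  have h2 := key {p | p.2 ∈ Ioc p.1.1 0} ((measurableSet_lt (by fun_prop) measurable_snd).inter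
    (measurableSet_le measurable_snd measurable_const))
  convert h1.sub h2 using 1
  funext z
  simp only [gain, intervalIntegral, ← integral_indicator measurableSet_Ioc, Pi.sub_apply]
  rfl

/-- The shear `(x, v) ↦ (x - τ v, v)` preserves Lebesgue measure. -/
theorem measurePreserving_shear (τ : ℝ) :
    MeasurePreserving (fun z : Space N × Space N => (z.1 - τ • z.2, z.2)) := by
  have h1 : MeasurePreserving (fun z : Space N × Space N => (z.1, z.2 - τ • z.1))
      (volume.prod volume) (volume.prod volume) := by
    refine MeasurePreserving.skew_product (f := id) (g := fun v x => x - τ • v)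
      (MeasurePreserving.id _) (by fun_prop) (Filter.Eventually.of_forall fun v => ?_)
    exact (measurePreserving_sub_right volume (τ • v)).map_eq
  exact Measure.measurePreserving_swap.comp (h1.comp Measure.measurePreserving_swap)

theorem ae_shear {P : Space N → Space N → Prop} (τ : ℝ)
    (h : ∀ᵐ z : Space N × Space N, P z.1 z.2) :
    ∀ᵐ z : Space N × Space N, P (z.1 - τ • z.2) z.2 :=
  (measurePreserving_shear τ).quasiMeasurePreserving.ae h

/-- A measurable property that holds at almost every `(x, v)` at every time holds, for almost
every `(x, v)`, along almost all of the characteristic through `(x, v)`. -/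
theorem ae_along_characteristics {P : ℝ → Space N → Space N → Prop} {I : Set ℝ} {t : ℝ}
    (hI : MeasurableSet I)
    (hP : MeasurableSet {z : ℝ × Space N × Space N | P z.1 z.2.1 z.2.2})
    (h : ∀ s ∈ I, ∀ᵐ z : Space N × Space N, P s z.1 z.2) :
    ∀ᵐ z : Space N × Space N, ∀ᵐ s ∂volume.restrict I, P s (z.1 - (t - s) • z.2) z.2 := by
  have h1 : ∀ᵐ s ∂volume.restrict I, ∀ᵐ z : Space N × Space N,
      P s (z.1 - (t - s) • z.2) z.2 := by
    filter_upwards [ae_restrict_mem hI] with s hs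
    exact ae_shear (t - s) (h s hs)
  -- Exchanging the two almost-everywhere quantifiers is Fubini's theorem, and is why `P` has to be
  -- jointly measurable.
  rw [Measure.ae_ae_comm] at h1
  · exact h1
  · exact hP.preimage (by fun_prop : Measurable fun p : ℝ × Space N × Space N =>
      (p.1, p.2.1 - (t - p.1) • p.2.2, p.2.2))

theorem ae_ae_of_ae_phase {P : Space N → Space N → Prop}
    (h : ∀ᵐ z : Space N × Space N, P z.1 z.2) : ∀ᵐ x : Space N, ∀ᵐ v : Space N, P x v :=
  Measure.ae_ae_of_ae_prod h

theorem ae_phase_of_ae {P : Space N → Prop} (h : ∀ᵐ x : Space N, P x) :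
    ∀ᵐ z : Space N × Space N, P z.1 :=
  Measure.quasiMeasurePreserving_fst.ae h

/-- Bochner moments of a non-negative distribution give a non-negative local Maxwellian. -/
theorem localMaxwellian_nonneg {g : Space N → ℝ} (h0 : ∀ᵐ v, 0 ≤ g v)
    (i : Integrable fun v : Space N => (1 + ‖v‖ ^ 2) * g v) (v : Space N) :
    0 ≤ localMaxwellian g v := by
  have hρ : 0 ≤ density g := integral_nonneg_of_ae h0
  rcases hρ.eq_or_lt with h | h
  · simp [localMaxwellian, ← h]
  apply maxwellian_nonneg hρ
  rw [temperature_eq]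
  apply div_nonneg _ (Nat.cast_nonneg N)
  have hP : momentum g = density g • bulkVelocity g := by
    rw [bulkVelocity_eq, smul_smul, mul_inv_cancel₀ h.ne', one_smul]
  set u := bulkVelocity g
  -- Up to the factor `N ρ` the temperature is the variance, so expanding this square shows that it
  -- is non-negative.
  have key : 0 ≤ ∫ v, ‖v - u‖ ^ 2 * g v := by
    apply integral_nonneg_of_ae
    filter_upwards [h0] with v hv
    positivity
  have e : ∫ v, ‖v - u‖ ^ 2 * g v = energy g - density g * ‖u‖ ^ 2 := by
    have i1 := integrable_normSq_mul_of_weighted i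
    have i2 := integrable_smul_of_weighted i
    have i3 := integrable_of_weighted i
    have : ∀ v, ‖v - u‖ ^ 2 * g v = ‖v‖ ^ 2 * g v - 2 * inner ℝ u (g v • v) + ‖u‖ ^ 2 * g v := by
      intro v
      rw [norm_sub_sq_real, inner_smul_right, real_inner_comm]
      ring
    simp_rw [this]
    have i4 : Integrable fun v => 2 * inner ℝ u (g v • v) := (i2.const_inner u).const_mul 2
    have i5 : Integrable fun v => ‖v‖ ^ 2 * g v - 2 * inner ℝ u (g v • v) := i1.sub i4
    rw [integral_add i5 (i3.const_mul _), integral_sub i1 i4, integral_const_mul,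
      integral_const_mul, integral_inner i2]
    change energy g - 2 * inner ℝ u (momentum g) + ‖u‖ ^ 2 * density g = _
    rw [hP, inner_smul_right, real_inner_self_eq_norm_sq]
    ring
  rw [e] at key
  rw [sub_nonneg, le_div_iff₀ h]
  linarith

end

/-! ### Transport of envelopes along characteristics -/

section

variable {N : ℕ}

/-- A pair of profiles `b, Λ` such that Gaussians with amplitude `b` and width `Λ` are, after free
transport over bounded times, dominated by exponentials with the same amplitude and width. -/
structure Profile (N : ℕ) where
  amp : Space N → ℝ
  width : Space N → ℝ
  amp_pos : ∀ x, 0 < amp x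
  width_pos : ∀ x, 0 < width x
  measurable_amp : Measurable amp
  measurable_width : Measurable width
  transport : ∀ κ > 0, ∀ T > 0, ∃ C > 0, ∀ (x v : Space N), ∀ τ ∈ Icc (0 : ℝ) T,
    amp (x - τ • v) * Real.exp (-κ * (‖v‖ / width (x - τ • v)) ^ 2) ≤
      C * (amp x * Real.exp (-(‖v‖ / width x)))

/-- The Gaussian attached to a profile. -/
def Profile.gauss (p : Profile N) (κ : ℝ) (x v : Space N) : ℝ :=
  p.amp x * Real.exp (-κ * (‖v‖ / p.width x) ^ 2)

/-- The exponential envelope attached to a profile. -/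
def Profile.envelope (p : Profile N) (x v : Space N) : ℝ :=
  p.amp x * Real.exp (-(‖v‖ / p.width x))

/-- The fields of `g` are comparable with the profile at `x`. -/
abbrev Profile.Bounds (p : Profile N) (A : ℝ) (x : Space N) (g : Space N → ℝ) : Prop :=
  HasFieldBounds A (p.amp x) (p.width x) g

theorem Profile.envelope_pos (p : Profile N) (x v : Space N) : 0 < p.envelope x v :=
  mul_pos (p.amp_pos x) (Real.exp_pos _)

theorem Profile.measurable_gauss (p : Profile N) (κ : ℝ) :
    Measurable fun z : ℝ × Space N × Space N => p.gauss κ z.2.1 z.2.2 := by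
  have h1 := p.measurable_amp
  have h2 := p.measurable_width
  unfold Profile.gauss
  fun_prop

theorem Profile.gauss_anti (p : Profile N) {κ κ' : ℝ} (h : κ ≤ κ') (x v : Space N) :
    p.gauss κ' x v ≤ p.gauss κ x v := by
  have := p.amp_pos x
  unfold Profile.gauss
  gcongr

theorem Profile.exists_localMaxwellian_le (p : Profile N) {A : ℝ} (hA : 0 < A) :
    ∃ C > 0, ∀ x g v, p.Bounds A x g → localMaxwellian g v ≤ C * p.gauss (1 / (8 * A)) x v := by
  refine ⟨A / (2 * Real.pi / A) ^ ((N : ℝ) / 2) * Real.exp (A ^ 3 / 2), by positivity, ?_⟩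
  intro x g v h
  refine (h.maxwellian_le hA (p.amp_pos x) (p.width_pos x) v).trans ?_
  change _ * p.gauss _ x v ≤ _
  gcongr
  -- The exponent is weakened from `1/(4A)` to the `1/(8A)` of the Lipschitz bound, so that one
  -- transport constant serves both estimates.
  exact p.gauss_anti (by gcongr; norm_num) x v

theorem Profile.exists_le_localMaxwellian (p : Profile N) {A : ℝ} (hA : 0 < A) :
    ∃ C > 0, ∀ x g v, p.Bounds A x g → C * p.gauss A x v ≤ localMaxwellian g v :=
  ⟨(A * (2 * Real.pi * A) ^ ((N : ℝ) / 2))⁻¹ * Real.exp (-A ^ 3), by positivity,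
    fun x _ v h => h.le_maxwellian hA (p.amp_pos x) (p.width_pos x) v⟩

theorem Profile.Bounds.localMaxwellian_nonneg {p : Profile N} {A : ℝ} (hA : 0 < A) {x : Space N}
    {g : Space N → ℝ} (h : p.Bounds A x g) (v : Space N) : 0 ≤ localMaxwellian g v :=
  maxwellian_nonneg (h.density_pos hA (p.amp_pos x) (p.width_pos x)).le
    (h.temp_pos hA (p.width_pos x)).le

/-- The return half of the loop: a difference controlled only by the exponential envelope gives
local Maxwellians whose difference is again controlled by a Gaussian, because only moments enter. -/
theorem Profile.exists_lipschitz (p : Profile N) (hN : 1 ≤ N) {A : ℝ} (hA : 0 < A) :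
    ∃ C > 0, ∀ (x : Space N) (D : ℝ) (g₁ g₂ : Space N → ℝ), 0 ≤ D →
      (Integrable fun v : Space N => (1 + ‖v‖ ^ 2) * g₁ v) →
      (Integrable fun v : Space N => (1 + ‖v‖ ^ 2) * g₂ v) →
      p.Bounds A x g₁ → p.Bounds A x g₂ →
      (∀ᵐ v, |g₁ v - g₂ v| ≤ D * p.envelope x v) → ∀ v,
      |localMaxwellian g₁ v - localMaxwellian g₂ v| ≤ C * D * p.gauss (1 / (8 * A)) x v := by
  obtain ⟨C, hC, h⟩ := exists_localMaxwellian_lipschitz hN hA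
  refine ⟨C * (envelopeMass N + 1), mul_pos hC (by linarith [envelopeMass_nonneg N]), ?_⟩
  intro x D g₁ g₂ hD i₁ i₂ F₁ F₂ hd v
  have e0 := envelopeMass_nonneg N
  have hb := p.amp_pos x
  have hw := p.width_pos x
  have h1 := momentDist_le_of_envelope (p.width_pos x) hd
  have h2 := h (p.amp x) (p.width x) ((envelopeMass N + 1) * D) g₁ g₂ v hb hw (by positivity)
    i₁ i₂ F₁ F₂ (h1.trans (by gcongr; linarith))
  exact h2.trans (le_of_eq (by unfold Profile.gauss; ring))

theorem abs_gain_sub_gain_le {f g : ℝ → Space N → Space N → ℝ} {t E : ℝ} {D : ℝ → ℝ}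
    {x v : Space N} (ht : 0 ≤ t) (hD : Continuous D)
    (hf : IntervalIntegrable (fun s => Real.exp (-(t - s)) *
      localMaxwellian (f s (x - (t - s) • v)) v) volume 0 t)
    (hg : IntervalIntegrable (fun s => Real.exp (-(t - s)) *
      localMaxwellian (g s (x - (t - s) • v)) v) volume 0 t)
    (h : ∀ᵐ s ∂volume.restrict (Ioc 0 t), |localMaxwellian (f s (x - (t - s) • v)) v -
      localMaxwellian (g s (x - (t - s) • v)) v| ≤ D s * E) :
    |gain f t x v - gain g t x v| ≤ (∫ s in (0 : ℝ)..t, D s) * E := by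
  unfold gain
  rw [← intervalIntegral.integral_sub hf hg, ← intervalIntegral.integral_mul_const,
    ← Real.norm_eq_abs]
  refine intervalIntegral.norm_integral_le_of_norm_le ht ?_
    ((hD.intervalIntegrable 0 t).mul_const E)
  rw [ae_restrict_iff' measurableSet_Ioc] at h
  filter_upwards [h] with s hs hst
  rw [← mul_sub, norm_mul, Real.norm_eq_abs, Real.norm_eq_abs, abs_of_pos (Real.exp_pos _)]
  refine (mul_le_of_le_one_left (abs_nonneg _) ?_).trans (hs hst)
  rw [Real.exp_le_one_iff]
  linarith [hst.2]

/-- Propagation of a bound on the difference of local Maxwellians to the difference of two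
solutions. -/
theorem IsMildSolution.abs_sub_le {p : Profile N} {f g f₀ : _} {T κ C : ℝ} {D : ℝ → ℝ}
    (hf : IsMildSolution T f₀ f) (hg : IsMildSolution T f₀ g) (hD : Continuous D)
    (hD0 : ∀ s, 0 ≤ D s)
    (hC : ∀ (x v : Space N), ∀ τ ∈ Icc (0 : ℝ) T, p.gauss κ (x - τ • v) v ≤ C * p.envelope x v)
    (h : ∀ s ∈ Icc 0 T, ∀ᵐ y : Space N, ∀ v, |localMaxwellian (f s y) v -
      localMaxwellian (g s y) v| ≤ D s * p.gauss κ y v) {t : ℝ} (ht : t ∈ Icc 0 T) :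
    ∀ᵐ z : Space N × Space N, |f t z.1 z.2 - g t z.1 z.2| ≤
      C * (∫ s in (0 : ℝ)..t, D s) * p.envelope z.1 z.2 := by
  have hP : MeasurableSet {z : ℝ × Space N × Space N | |localMaxwellian (f z.1 z.2.1) z.2.2 -
      localMaxwellian (g z.1 z.2.1) z.2.2| ≤ D z.1 * p.gauss κ z.2.1 z.2.2} := by
    apply measurableSet_le
    · exact ((measurable_localMaxwellian hf.measurable).sub
        (measurable_localMaxwellian hg.measurable)).abs
    · exact (hD.measurable.comp measurable_fst).mul (p.measurable_gauss κ)
  have h1 := ae_along_characteristics (I := Ioc 0 t) (t := t)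
    (P := fun s y v => |localMaxwellian (f s y) v - localMaxwellian (g s y) v| ≤
      D s * p.gauss κ y v) measurableSet_Ioc hP (fun s hs => by
        filter_upwards [ae_phase_of_ae (h s ⟨hs.1.le, hs.2.trans ht.2⟩)] with z hz
        exact hz z.2)
  filter_upwards [h1, hf.duhamel t ht, hg.duhamel t ht, hf.intervalIntegrable t ht,
    hg.intervalIntegrable t ht] with z hz ef eg i_f i_g
  rw [ef, eg, add_sub_add_left_eq_sub]
  refine (abs_gain_sub_gain_le (D := D) (E := C * p.envelope z.1 z.2) ht.1 hD i_f i_g ?_).trans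
    (le_of_eq (by ring))
  filter_upwards [hz, ae_restrict_mem measurableSet_Ioc] with s hs hst
  refine hs.trans ?_
  have := hD0 s
  gcongr
  exact hC z.1 z.2 (t - s) ⟨by linarith [hst.2], by linarith [hst.1, ht.2]⟩

theorem integral_exp_mul_le {l t : ℝ} (hl : 0 < l) :
    ∫ s in (0 : ℝ)..t, Real.exp (l * s) ≤ Real.exp (l * t) / l := by
  rw [intervalIntegral.integral_comp_mul_left (f := Real.exp) hl.ne', integral_exp, smul_eq_mul,
    inv_mul_eq_div]
  gcongr
  linarith [Real.exp_pos (l * 0)]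

/-- Two solutions with the same datum and comparable fields coincide. -/
theorem Profile.unique (p : Profile N) (hN : 1 ≤ N) {f g f₀ : _} {T A : ℝ} (hT : 0 < T)
    (hA : 0 < A) (hf : IsMildSolution T f₀ f) (hg : IsMildSolution T f₀ g)
    (bf : ∀ t ∈ Icc 0 T, ∀ᵐ x : Space N, p.Bounds A x (f t x))
    (bg : ∀ t ∈ Icc 0 T, ∀ᵐ x : Space N, p.Bounds A x (g t x)) :
    ∀ t ∈ Icc 0 T, ∀ᵐ z : Space N × Space N, f t z.1 z.2 = g t z.1 z.2 := by
  obtain ⟨C₁, hC₁, h₁⟩ := p.exists_lipschitz hN hA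
  obtain ⟨C₂, hC₂, h₂⟩ := p.transport (1 / (8 * A)) (by positivity) T hT
  obtain ⟨C₃, hC₃, h₃⟩ := p.exists_localMaxwellian_le hA
  -- One pass through Duhamel's formula costs `C₁ C₂`, and integrating `e^{ls}` gains `1/l`. With
  -- this rate each pass halves the bound, however long the interval is.
  set l := 2 * (C₁ * C₂) with hl
  have hl0 : 0 < l := by positivity
  set K := C₂ * (T * (2 * C₃)) with hK
  have hK0 : 0 < K := by positivity
  -- The base case needs no smallness: the free parts cancel, and both gain terms are bounded
  -- through the field bounds alone.
  have claim : ∀ n : ℕ, ∀ t ∈ Icc 0 T, ∀ᵐ z : Space N × Space N,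
      |f t z.1 z.2 - g t z.1 z.2| ≤ K * (1 / 2) ^ n * Real.exp (l * t) * p.envelope z.1 z.2 := by
    intro n
    induction n with
    | zero =>
      intro t ht
      have := hf.abs_sub_le (p := p) (C := C₂) (D := fun _ => 2 * C₃) hg continuous_const
        (fun _ => by positivity) h₂ (fun s hs => by
          filter_upwards [bf s hs, bg s hs] with y F G v
          have f1 := h₃ y _ v F
          have g1 := h₃ y _ v G
          have f2 := F.localMaxwellian_nonneg hA v
          have g2 := G.localMaxwellian_nonneg hA v
          rw [abs_le]
          constructor <;> linarith) ht
      filter_upwards [this] with z hz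
      refine hz.trans ?_
      have hE := (p.envelope_pos z.1 z.2).le
      refine mul_le_mul_of_nonneg_right ?_ hE
      rw [intervalIntegral.integral_const, smul_eq_mul, sub_zero, pow_zero, mul_one]
      calc C₂ * (t * (2 * C₃)) ≤ K * 1 := by
            rw [mul_one, hK]
            gcongr
            exact ht.2
        _ ≤ _ := by
            gcongr
            exact Real.one_le_exp (mul_nonneg hl0.le ht.1)
    | succ n ih =>
      intro t ht
      have := hf.abs_sub_le (p := p) (C := C₂)
        (D := fun s => C₁ * (K * (1 / 2) ^ n * Real.exp (l * s))) hg (by fun_prop)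
        (fun _ => by positivity) h₂ (fun s hs => by
          filter_upwards [bf s hs, bg s hs, hf.moments s hs, hg.moments s hs,
            ae_ae_of_ae_phase (P := fun y v => |f s y v - g s y v| ≤
              K * (1 / 2) ^ n * Real.exp (l * s) * p.envelope y v) (ih s hs)] with y F G mf mg hd
          exact h₁ y _ _ _ (by positivity) mf mg F G hd) ht
      filter_upwards [this] with z hz
      refine hz.trans ?_
      have hE := (p.envelope_pos z.1 z.2).le
      refine mul_le_mul_of_nonneg_right ?_ hE
      rw [intervalIntegral.integral_const_mul, intervalIntegral.integral_const_mul]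
      calc _ ≤ C₂ * (C₁ * (K * (1 / 2) ^ n * (Real.exp (l * t) / l))) := by
            gcongr
            exact integral_exp_mul_le hl0
        _ = _ := by
            rw [hl, pow_succ]
            field_simp
  intro t ht
  filter_upwards [ae_all_iff.2 fun n => claim n t ht] with z hz
  have lim : Filter.Tendsto (fun n : ℕ => K * (1 / 2 : ℝ) ^ n * Real.exp (l * t) *
      p.envelope z.1 z.2) Filter.atTop (nhds (K * 0 * Real.exp (l * t) * p.envelope z.1 z.2)) :=
    (((tendsto_pow_atTop_nhds_zero_of_lt_one (by norm_num) (by norm_num)).const_mul K).mul_const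
      _).mul_const _
  have h0 := ge_of_tendsto' lim hz
  rw [mul_zero, zero_mul, zero_mul] at h0
  exact sub_eq_zero.1 (abs_nonpos_iff.1 h0)

/-- Lower bound for a solution by the gain along its characteristics. -/
theorem Profile.exists_le_solution (p : Profile N) {f f₀ : _} {T S A t : ℝ}
    (hA : 0 < A) (hf : IsMildSolution T f₀ f) (h₀ : ∀ x v, 0 ≤ f₀ x v) (hS : S ∈ Ioc 0 T)
    (bf : ∀ t ∈ Icc 0 S, ∀ᵐ x : Space N, p.Bounds A x (f t x)) (ht : t ∈ Ioc 0 T) :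
    ∃ c > 0, ∀ᵐ z : Space N × Space N, ∀ m : ℝ,
      (∀ τ ∈ Icc 0 T, m ≤ p.gauss A (z.1 - τ • z.2) z.2) → c * m ≤ f t z.1 z.2 := by
  obtain ⟨C, hC, h⟩ := p.exists_le_localMaxwellian hA
  -- The field bounds are available only up to `S`. The gain over `(0, r]` gives the lower bound,
  -- and later times contribute non-negatively because the solution itself is non-negative.
  set r := min S t with hr
  have hr0 : 0 < r := lt_min hS.1 ht.1
  have hrt : r ≤ t := min_le_right _ _
  have hrS : r ≤ S := min_le_left _ _
  refine ⟨Real.exp (-t) * C * r, by positivity, ?_⟩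
  have m1 := measurable_localMaxwellian hf.measurable
  have a1 := ae_along_characteristics (I := Ioc 0 t) (t := t)
    (P := fun s y v => 0 ≤ localMaxwellian (f s y) v) measurableSet_Ioc
    (measurableSet_le measurable_const m1) (fun s hs => by
      have hs' : s ∈ Icc 0 T := ⟨hs.1.le, hs.2.trans ht.2⟩
      have : ∀ᵐ y : Space N, ∀ v, 0 ≤ localMaxwellian (f s y) v := by
        filter_upwards [hf.moments s hs', ae_ae_of_ae_phase (P := fun y v => 0 ≤ f s y v)
          (hf.nonneg s hs')] with y i n v
        exact BGK.localMaxwellian_nonneg n i v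
      filter_upwards [ae_phase_of_ae this] with z hz
      exact hz z.2)
  have a2 := ae_along_characteristics (I := Ioc 0 r) (t := t)
    (P := fun s y v => C * p.gauss A y v ≤ localMaxwellian (f s y) v) measurableSet_Ioc
    (measurableSet_le ((p.measurable_gauss A).const_mul C) m1) (fun s hs => by
      filter_upwards [ae_phase_of_ae (bf s ⟨hs.1.le, hs.2.trans hrS⟩)] with z hz
      exact h _ _ _ hz)
  have ht' : t ∈ Icc 0 T := ⟨ht.1.le, ht.2⟩
  filter_upwards [a1, a2, hf.duhamel t ht', hf.intervalIntegrable t ht'] with z n1 n2 e i m hm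
  rw [e]
  refine le_add_of_nonneg_of_le (mul_nonneg (Real.exp_pos _).le (h₀ _ _)) ?_
  have i' := (intervalIntegrable_iff_integrableOn_Ioc_of_le ht.1.le).1 i
  rw [intervalIntegral.integral_of_le ht.1.le]
  have sub : Ioc 0 r ⊆ Ioc 0 t := Ioc_subset_Ioc_right hrt
  calc Real.exp (-t) * C * r * m = ∫ _ in Ioc 0 r, Real.exp (-t) * C * m := by
        rw [setIntegral_const, measureReal_def, Real.volume_Ioc, sub_zero,
          ENNReal.toReal_ofReal hr0.le, smul_eq_mul]
        ring
    _ ≤ ∫ s in Ioc 0 r, Real.exp (-(t - s)) *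
          localMaxwellian (f s (z.1 - (t - s) • z.2)) z.2 := by
        apply integral_mono_ae (integrable_const _) (i'.mono_set sub)
        filter_upwards [n2, ae_restrict_mem measurableSet_Ioc,
          ae_mono (Measure.restrict_mono sub le_rfl) n1] with s hs hsr h0
        have k1 := hm (t - s) ⟨by linarith [hsr.2], by linarith [hsr.1, ht.2]⟩
        have k2 : C * m ≤ localMaxwellian (f s (z.1 - (t - s) • z.2)) z.2 :=
          le_trans (by gcongr) hs
        calc Real.exp (-t) * C * m = Real.exp (-t) * (C * m) := by ring
          _ ≤ Real.exp (-t) * localMaxwellian (f s (z.1 - (t - s) • z.2)) z.2 := by gcongr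
          _ ≤ _ := by
            gcongr
            linarith [hsr.1]
    _ ≤ _ := by
        apply setIntegral_mono_set i' _ sub.eventuallyLE
        filter_upwards [n1] with s hs
        exact mul_nonneg (Real.exp_pos _).le hs

end

/-! ### Existence of a local solution -/

section

variable {N : ℕ}

/-- A centred datum whose fields are comparable with a profile, and whose moments vary slowly
under free transport. -/
structure Profile.CentredDatum (p : Profile N) (f₀ : Space N → Space N → ℝ) (a K τ₀ : ℝ) :
    Prop where
  measurable : Measurable fun z : Space N × Space N => f₀ z.1 z.2
  nonneg : ∀ x v, 0 ≤ f₀ x v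
  integrable : ∀ t ∈ Icc 0 τ₀, ∀ x,
    Integrable fun v : Space N => (1 + ‖v‖ ^ 2) * f₀ (x - t • v) v
  density_mem : ∀ x, density (f₀ x) ∈
    Icc (a * (p.amp x * p.width x ^ N)) (p.amp x * p.width x ^ N / a)
  energy_mem : ∀ x, energy (f₀ x) ∈ Icc (a * (p.amp x * p.width x ^ N) * p.width x ^ 2)
    (p.amp x * p.width x ^ N * p.width x ^ 2 / a)
  momentum_eq : ∀ x, momentum (f₀ x) = 0
  dist_le : ∀ t ∈ Icc 0 τ₀, ∀ x, momentDist (p.width x) (fun v => f₀ (x - t • v) v) (f₀ x) ≤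
    K * t ^ (1 / 4 : ℝ) * (p.amp x * p.width x ^ N)

/-- Free transport with damping. -/
def freeFlow (f₀ : Space N → Space N → ℝ) (t : ℝ) (x v : Space N) : ℝ :=
  Real.exp (-t) * f₀ (x - t • v) v

theorem measurable_freeFlow {f₀ : Space N → Space N → ℝ}
    (h : Measurable fun z : Space N × Space N => f₀ z.1 z.2) :
    Measurable fun z : ℝ × Space N × Space N => freeFlow f₀ z.1 z.2.1 z.2.2 :=
  Measurable.mul (by fun_prop) (h.comp (by fun_prop :
    Measurable fun z : ℝ × Space N × Space N => (z.2.1 - z.1 • z.2.2, z.2.2)))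

theorem le_rpow_quarter {t : ℝ} (h0 : 0 ≤ t) (h1 : t ≤ 1) : t ≤ t ^ (1 / 4 : ℝ) :=
  Real.self_le_rpow_of_le_one h0 h1 (by norm_num)

/-! ### Moments of distributions close to the free flow. -/

section Perturbation

variable {p : Profile N} {f₀ : Space N → Space N → ℝ} {a K τ₀ : ℝ}

theorem Profile.integrable_envelope (p : Profile N) (x : Space N) :
    Integrable fun v : Space N => (1 + ‖v‖ ^ 2) * p.envelope x v := by
  refine ((integrable_weighted_envelope (p.width_pos x)).const_mul (p.amp x)).congr
    (Filter.Eventually.of_forall fun v => ?_)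
  simp only [Profile.envelope]
  ring

theorem Profile.integrable_scaled_envelope (p : Profile N) (x : Space N) :
    Integrable fun v : Space N => (1 + (‖v‖ / p.width x) ^ 2) * p.envelope x v := by
  refine ((integrable_scaledEnvelope (p.width_pos x)).const_mul (p.amp x)).congr
    (Filter.Eventually.of_forall fun v => ?_)
  simp only [Profile.envelope]
  ring

theorem Profile.integral_scaled_envelope (p : Profile N) (x : Space N) :
    ∫ v : Space N, (1 + (‖v‖ / p.width x) ^ 2) * p.envelope x v =
      envelopeMass N * (p.amp x * p.width x ^ N) := by
  have : ∀ v : Space N, (1 + (‖v‖ / p.width x) ^ 2) * p.envelope x v =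
      p.amp x * ((1 + (‖v‖ / p.width x) ^ 2) * Real.exp (-(‖v‖ / p.width x))) := by
    intro v
    simp only [Profile.envelope]
    ring
  simp_rw [this]
  rw [integral_const_mul, integral_scaledEnvelope (p.width_pos x)]
  ring

theorem Profile.CentredDatum.integrable_freeFlow (h : p.CentredDatum f₀ a K τ₀) {t : ℝ}
    (ht : t ∈ Icc 0 τ₀) (x : Space N) :
    Integrable fun v : Space N => (1 + ‖v‖ ^ 2) * freeFlow f₀ t x v := by
  refine ((h.integrable t ht x).const_mul (Real.exp (-t))).congr
    (Filter.Eventually.of_forall fun v => ?_)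
  simp only [freeFlow]
  ring

theorem Profile.CentredDatum.integrable_perturbation (h : p.CentredDatum f₀ a K τ₀) {t D : ℝ}
    (ht : t ∈ Icc 0 τ₀) {x : Space N} {g : Space N → ℝ} (hg : Measurable g)
    (hd : ∀ v, |g v - freeFlow f₀ t x v| ≤ D * p.envelope x v) :
    Integrable fun v : Space N => (1 + ‖v‖ ^ 2) * g v := by
  refine ((h.integrable_freeFlow ht x).norm.add ((p.integrable_envelope x).const_mul D)).mono'
    (by fun_prop) (Filter.Eventually.of_forall fun v => ?_)
  simp only [Pi.add_apply, norm_mul, Real.norm_eq_abs]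
  have h0 : (0 : ℝ) ≤ 1 + ‖v‖ ^ 2 := by positivity
  rw [abs_of_nonneg h0]
  have h1 : |g v| ≤ |freeFlow f₀ t x v| + D * p.envelope x v := by
    have := abs_sub_abs_le_abs_sub (g v) (freeFlow f₀ t x v)
    linarith [hd v]
  calc _ ≤ (1 + ‖v‖ ^ 2) * (|freeFlow f₀ t x v| + D * p.envelope x v) := by gcongr
    _ = _ := by ring

/-- Three errors add up: the gain (`D t` times the envelope), the transport of the datum (`K
t^{1/4}`), and the damping `1 - e^{-t} ≤ t`, which multiplies mass plus scaled energy and gives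
`2/a`. For `t ≤ 1` all are of order `t^{1/4}`. -/
theorem Profile.CentredDatum.momentDist_perturbation_le (h : p.CentredDatum f₀ a K τ₀)
    {t D : ℝ} (hτ : 0 ≤ τ₀) (ht : t ∈ Icc 0 τ₀) (ht1 : t ≤ 1) (hD : 0 ≤ D)
    {x : Space N} {g : Space N → ℝ}
    (hd : ∀ v, |g v - freeFlow f₀ t x v| ≤ D * t * p.envelope x v) :
    momentDist (p.width x) g (f₀ x) ≤
      (envelopeMass N * D + K + 2 / a) * t ^ (1 / 4 : ℝ) * (p.amp x * p.width x ^ N) := by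
  set L := p.width x with hL
  have hLp : 0 < L := p.width_pos x
  have hB : 0 < p.amp x * L ^ N := mul_pos (p.amp_pos x) (by positivity)
  have i0 : Integrable fun v : Space N => (1 + ‖v‖ ^ 2) * f₀ x v := by
    simpa using h.integrable 0 ⟨le_rfl, hτ⟩ x
  have j1 := (p.integrable_scaled_envelope x).const_mul (D * t)
  have j2 := integrable_momentDist (L := L) (h.integrable t ht x) i0
  have j3' := (integrable_of_weighted i0).add
    ((integrable_normSq_mul_of_weighted i0).div_const (L ^ 2))
  have j3 : Integrable fun v : Space N => t * (f₀ x v + ‖v‖ ^ 2 * f₀ x v / L ^ 2) :=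
    j3'.const_mul t
  have hsum : momentDist L g (f₀ x) ≤
      ∫ v, (D * t * ((1 + (‖v‖ / p.width x) ^ 2) * p.envelope x v) +
        (1 + (‖v‖ / L) ^ 2) * |f₀ (x - t • v) v - f₀ x v|) +
        t * (f₀ x v + ‖v‖ ^ 2 * f₀ x v / L ^ 2) := by
    apply integral_mono_of_nonneg (Filter.Eventually.of_forall fun v => by positivity)
      ((j1.add j2).add j3)
    refine Filter.Eventually.of_forall fun v => ?_
    have e1 : 1 - t ≤ Real.exp (-t) := by linarith [Real.add_one_le_exp (-t)]
    have e2 : Real.exp (-t) ≤ 1 := Real.exp_le_one_iff.2 (by linarith [ht.1])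
    have h0 := h.nonneg x v
    have k : |freeFlow f₀ t x v - f₀ x v| ≤ |f₀ (x - t • v) v - f₀ x v| + t * f₀ x v := by
      have : freeFlow f₀ t x v - f₀ x v = Real.exp (-t) * (f₀ (x - t • v) v - f₀ x v) -
          (1 - Real.exp (-t)) * f₀ x v := by
        unfold freeFlow; ring
      rw [this]
      refine (abs_sub _ _).trans (add_le_add ?_ ?_)
      · rw [abs_mul, abs_of_pos (Real.exp_pos _)]
        exact mul_le_of_le_one_left (abs_nonneg _) e2
      · rw [abs_of_nonneg (mul_nonneg (by linarith) h0)]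
        gcongr
        linarith
    have k2 : |g v - f₀ x v| ≤ D * t * p.envelope x v +
        (|f₀ (x - t • v) v - f₀ x v| + t * f₀ x v) :=
      (abs_sub_le _ (freeFlow f₀ t x v) _).trans (add_le_add (hd v) k)
    calc (1 + (‖v‖ / L) ^ 2) * |g v - f₀ x v| ≤ (1 + (‖v‖ / L) ^ 2) *
          (D * t * p.envelope x v + (|f₀ (x - t • v) v - f₀ x v| + t * f₀ x v)) := by gcongr
      _ = _ := by
        simp only [Pi.add_apply]
        rw [← hL, div_pow]
        ring
  refine hsum.trans ?_
  have hk1 := integral_add (j1.add j2) j3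
  have hk2 := integral_add j1 j2
  simp only [Pi.add_apply] at hk1
  rw [hk1, hk2, integral_const_mul, integral_const_mul, p.integral_scaled_envelope]
  have hk3 : ∫ v, f₀ x v + ‖v‖ ^ 2 * f₀ x v / L ^ 2 = density (f₀ x) + energy (f₀ x) / L ^ 2 := by
    rw [integral_add (integrable_of_weighted i0)
      ((integrable_normSq_mul_of_weighted i0).div_const (L ^ 2)), integral_div]
    rfl
  rw [hk3]
  have d1 := h.dist_le t ht x
  have d2 := (h.density_mem x).2
  have d3 : energy (f₀ x) / L ^ 2 ≤ p.amp x * L ^ N / a := by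
    rw [div_le_iff₀ (by positivity)]
    refine (h.energy_mem x).2.trans (le_of_eq ?_)
    ring
  have hq := le_rpow_quarter ht.1 ht1
  have e0 := envelopeMass_nonneg N
  have ht0 := ht.1
  set q := t ^ (1 / 4 : ℝ)
  set B := p.amp x * L ^ N
  calc _ ≤ D * q * (envelopeMass N * B) + K * q * B + q * (B / a + B / a) := by
        gcongr
        · exact d1
        · exact add_nonneg (integral_nonneg fun v => h.nonneg x v) (div_nonneg
            (integral_nonneg fun v => mul_nonneg (by positivity) (h.nonneg x v)) (by positivity))
    _ = _ := by ring

end Perturbation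

/-- Picard iterates of Duhamel's formula. -/
def picard (f₀ : Space N → Space N → ℝ) : ℕ → ℝ → Space N → Space N → ℝ
  | 0 => freeFlow f₀
  | n + 1 => fun t x v => freeFlow f₀ t x v + gain (picard f₀ n) t x v

theorem measurable_picard {f₀ : Space N → Space N → ℝ}
    (h : Measurable fun z : Space N × Space N => f₀ z.1 z.2) (n : ℕ) :
    Measurable fun z : ℝ × Space N × Space N => picard f₀ n z.1 z.2.1 z.2.2 := by
  induction n with
  | zero => exact measurable_freeFlow h
  | succ n ih => exact (measurable_freeFlow h).add (measurable_gain ih)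

/-- Distributions close to the free flow on `[0, T]`. -/
structure Profile.Near (p : Profile N) (f₀ : Space N → Space N → ℝ) (C T : ℝ)
    (f : ℝ → Space N → Space N → ℝ) : Prop where
  measurable : Measurable fun z : ℝ × Space N × Space N => f z.1 z.2.1 z.2.2
  le : ∀ t ∈ Icc 0 T, ∀ x v, freeFlow f₀ t x v ≤ f t x v
  sub_le : ∀ t ∈ Icc 0 T, ∀ x v, f t x v - freeFlow f₀ t x v ≤ C * t * p.envelope x v

theorem Profile.Near.abs_sub_le {p : Profile N} {f₀ : Space N → Space N → ℝ} {C T : ℝ}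
    {f : ℝ → Space N → Space N → ℝ} (h : p.Near f₀ C T f) {t : ℝ} (ht : t ∈ Icc 0 T)
    (x v : Space N) : |f t x v - freeFlow f₀ t x v| ≤ C * t * p.envelope x v := by
  rw [abs_of_nonneg (sub_nonneg.2 (h.le t ht x v))]
  exact h.sub_le t ht x v

theorem Profile.Near.measurable_slice {p : Profile N} {f₀ : Space N → Space N → ℝ} {C T : ℝ}
    {f : ℝ → Space N → Space N → ℝ} (h : p.Near f₀ C T f) (t : ℝ) (x : Space N) :
    Measurable (f t x) :=
  h.measurable.comp (by fun_prop : Measurable fun v : Space N => (t, x, v))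

/-- The constant in the upper bound depends on the solution only through `A`, which makes the class
`Profile.Near` invariant under a Duhamel step. -/
theorem Profile.gain_bounds {p : Profile N} {A C₁ C₂ T : ℝ} (hA : 0 < A) (hC₁ : 0 ≤ C₁)
    (h₁ : ∀ x g v, p.Bounds A x g → localMaxwellian g v ≤ C₁ * p.gauss (1 / (8 * A)) x v)
    (h₂ : ∀ (x v : Space N), ∀ τ ∈ Icc (0 : ℝ) T,
      p.gauss (1 / (8 * A)) (x - τ • v) v ≤ C₂ * p.envelope x v)
    {f : ℝ → Space N → Space N → ℝ}
    (hf : Measurable fun z : ℝ × Space N × Space N => f z.1 z.2.1 z.2.2)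
    (bf : ∀ t ∈ Icc 0 T, ∀ x, p.Bounds A x (f t x)) {t : ℝ} (ht : t ∈ Icc 0 T) (x v : Space N) :
    IntervalIntegrable (fun s => Real.exp (-(t - s)) *
      localMaxwellian (f s (x - (t - s) • v)) v) volume 0 t ∧
    0 ≤ gain f t x v ∧ gain f t x v ≤ C₁ * C₂ * t * p.envelope x v := by
  have hm : Measurable fun s => Real.exp (-(t - s)) * localMaxwellian (f s (x - (t - s) • v)) v :=
    (measurable_gainIntegrand hf).comp (by fun_prop : Measurable fun s : ℝ => ((t, x, v), s))
  have h0 : ∀ s ∈ Ioc 0 t,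
      0 ≤ Real.exp (-(t - s)) * localMaxwellian (f s (x - (t - s) • v)) v := fun s hs =>
    mul_nonneg (Real.exp_pos _).le
      ((bf s ⟨hs.1.le, hs.2.trans ht.2⟩ _).localMaxwellian_nonneg hA v)
  have hle : ∀ s ∈ Ioc 0 t, Real.exp (-(t - s)) * localMaxwellian (f s (x - (t - s) • v)) v ≤
      C₁ * C₂ * p.envelope x v := fun s hs => by
    have b := bf s ⟨hs.1.le, hs.2.trans ht.2⟩ (x - (t - s) • v)
    refine (mul_le_of_le_one_left (b.localMaxwellian_nonneg hA v) ?_).trans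
      ((h₁ _ _ v b).trans ?_)
    · rw [Real.exp_le_one_iff]; linarith [hs.2]
    · rw [mul_assoc]
      gcongr
      exact h₂ x v (t - s) ⟨by linarith [hs.2], by linarith [hs.1, ht.2]⟩
  have i : IntervalIntegrable (fun s => Real.exp (-(t - s)) *
      localMaxwellian (f s (x - (t - s) • v)) v) volume 0 t := by
    refine (intervalIntegrable_const (c := C₁ * C₂ * p.envelope x v)).mono_fun
      hm.aestronglyMeasurable ?_
    filter_upwards [ae_restrict_mem measurableSet_uIoc] with s hs
    rw [uIoc_of_le ht.1] at hs
    rw [Real.norm_of_nonneg (h0 s hs)]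
    exact (hle s hs).trans (Real.le_norm_self _)
  refine ⟨i, ?_, ?_⟩
  · unfold gain
    rw [intervalIntegral.integral_of_le ht.1]
    exact setIntegral_nonneg measurableSet_Ioc h0
  · unfold gain
    calc _ ≤ ∫ _ in (0 : ℝ)..t, C₁ * C₂ * p.envelope x v := by
          rw [intervalIntegral.integral_of_le ht.1, intervalIntegral.integral_of_le ht.1]
          exact setIntegral_mono_on
            ((intervalIntegrable_iff_integrableOn_Ioc_of_le ht.1).1 i)
            (integrable_const _) measurableSet_Ioc hle
      _ = _ := by
          rw [intervalIntegral.integral_const, smul_eq_mul]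
          ring

/-- Existence of a local solution for centred data, with control of the fields. -/
theorem Profile.CentredDatum.exists_solution {p : Profile N} {f₀ : Space N → Space N → ℝ}
    {a K τ₀ : ℝ} (hN : 1 ≤ N) (ha : 0 < a) (ha1 : a ≤ 1) (hK : 0 ≤ K) (hτ : 0 < τ₀)
    (h : p.CentredDatum f₀ a K τ₀) :
    ∃ T > 0, ∃ f, IsMildSolution T f₀ f ∧ ∃ A > 0, ∃ C > 0, ∀ t ∈ Icc 0 T, ∀ x,
      p.Bounds A x (f t x) ∧ ‖bulkVelocity (f t x)‖ ≤ C * t ^ (1 / 4 : ℝ) * p.width x := by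
  have hN0 : (0 : ℝ) < N := by exact_mod_cast hN
  set A : ℝ := 8 * N / a ^ 2 with hAdef
  have hA : 0 < A := by positivity
  obtain ⟨C₁, hC₁, h₁⟩ := p.exists_localMaxwellian_le hA
  obtain ⟨C₂, hC₂, h₂⟩ := p.transport (1 / (8 * A)) (by positivity) 1 one_pos
  obtain ⟨C₃, hC₃, h₃⟩ := p.exists_lipschitz hN hA
  set C := C₁ * C₂ with hC
  have hC0 : 0 < C := by positivity
  set Q := envelopeMass N * C + K + 2 / a with hQ
  have e0 := envelopeMass_nonneg N
  have hQ0 : 0 < Q := by positivity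
  -- In order, the four constraints give `t ≤ t^{1/4}`, validity of the datum estimates, the
  -- closeness `Q t^{1/4} ≤ a²/8` that `fieldBounds_of_close` needs, and the contraction factor 1/2.
  set T := min (min 1 τ₀) (min ((a ^ 2 / 8 / Q) ^ (4 : ℝ)) (1 / (2 * (C₂ * C₃)))) with hTdef
  have hT0 : 0 < T := by positivity
  have hT1 : T ≤ 1 := (min_le_left _ _).trans (min_le_left _ _)
  have hTτ : T ≤ τ₀ := (min_le_left _ _).trans (min_le_right _ _)
  have hTQ : ∀ t ∈ Icc 0 T, Q * t ^ (1 / 4 : ℝ) ≤ a ^ 2 / 8 := by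
    intro t ht
    have h1 : t ≤ (a ^ 2 / 8 / Q) ^ (4 : ℝ) :=
      ht.2.trans ((min_le_right _ _).trans (min_le_left _ _))
    have h2 : t ^ (1 / 4 : ℝ) ≤ a ^ 2 / 8 / Q := by
      calc t ^ (1 / 4 : ℝ) ≤ ((a ^ 2 / 8 / Q) ^ (4 : ℝ)) ^ (1 / 4 : ℝ) :=
            Real.rpow_le_rpow ht.1 h1 (by norm_num)
        _ = _ := by
            rw [← Real.rpow_mul (by positivity)]
            norm_num
    rw [le_div_iff₀ hQ0] at h2
    linarith
  have hTL : ∀ t ∈ Icc 0 T, C₂ * C₃ * t ≤ 1 / 2 := by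
    intro t ht
    have h1 : t ≤ 1 / (2 * (C₂ * C₃)) := ht.2.trans ((min_le_right _ _).trans (min_le_right _ _))
    rw [le_div_iff₀ (by positivity)] at h1
    linarith
  have h₂' : ∀ (x v : Space N), ∀ τ ∈ Icc (0 : ℝ) T,
      p.gauss (1 / (8 * A)) (x - τ • v) v ≤ C₂ * p.envelope x v :=
    fun x v τ hτ => h₂ x v τ ⟨hτ.1, hτ.2.trans hT1⟩
  have near_int : ∀ {f}, p.Near f₀ C T f → ∀ t ∈ Icc 0 T, ∀ x,
      Integrable fun v : Space N => (1 + ‖v‖ ^ 2) * f t x v := fun {f} hf t ht x =>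
    h.integrable_perturbation ⟨ht.1, ht.2.trans hTτ⟩ (hf.measurable_slice t x)
      (hf.abs_sub_le ht x)
  have near_bounds : ∀ {f}, p.Near f₀ C T f → ∀ t ∈ Icc 0 T, ∀ x,
      p.Bounds A x (f t x) ∧
      ‖bulkVelocity (f t x)‖ ≤ 2 / a * (Q * t ^ (1 / 4 : ℝ)) * p.width x := by
    intro f hf t ht x
    have ht' : t ∈ Icc 0 τ₀ := ⟨ht.1, ht.2.trans hTτ⟩
    refine fieldBounds_of_close hN ha ha1 (p.amp_pos x) (p.width_pos x) (hTQ t ht)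
      (near_int hf t ht x) ?_ (h.density_mem x) (h.energy_mem x) (h.momentum_eq x)
      (h.momentDist_perturbation_le hτ.le ht' (ht.2.trans hT1) hC0.le (hf.abs_sub_le ht x))
    simpa using h.integrable 0 ⟨le_rfl, hτ.le⟩ x
  have near_gain : ∀ {f}, p.Near f₀ C T f → ∀ t ∈ Icc 0 T, ∀ x v,
      IntervalIntegrable (fun s => Real.exp (-(t - s)) *
        localMaxwellian (f s (x - (t - s) • v)) v) volume 0 t ∧
      0 ≤ gain f t x v ∧ gain f t x v ≤ C * t * p.envelope x v := fun {f} hf t ht x v =>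
    p.gain_bounds hA hC₁.le h₁ h₂' hf.measurable
      (fun s hs y => (near_bounds hf s hs y).1) ht x v
  -- Contraction in the supremum norm weighted by the envelope, with a bound at every point rather
  -- than almost everywhere.
  have contr : ∀ {f g}, p.Near f₀ C T f → p.Near f₀ C T g → ∀ D, 0 ≤ D →
      (∀ t ∈ Icc 0 T, ∀ x v, |f t x v - g t x v| ≤ D * p.envelope x v) →
      ∀ t ∈ Icc 0 T, ∀ x v, |gain f t x v - gain g t x v| ≤ D / 2 * p.envelope x v := by
    intro f g hf hg D hD hfg t ht x v
    have hE := (p.envelope_pos x v).le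
    have := abs_gain_sub_gain_le (D := fun _ => C₃ * D) (E := C₂ * p.envelope x v) ht.1
      continuous_const (near_gain hf t ht x v).1 (near_gain hg t ht x v).1 (by
        filter_upwards [ae_restrict_mem measurableSet_Ioc] with s hs
        have hs' : s ∈ Icc 0 T := ⟨hs.1.le, hs.2.trans ht.2⟩
        refine (h₃ (x - (t - s) • v) D _ _ hD (near_int hf s hs' _) (near_int hg s hs' _)
          (near_bounds hf s hs' _).1 (near_bounds hg s hs' _).1
          (Filter.Eventually.of_forall (hfg s hs' _)) v).trans ?_
        gcongr
        exact h₂' x v (t - s) ⟨by linarith [hs.2], by linarith [hs.1, ht.2]⟩)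
    refine this.trans ?_
    rw [intervalIntegral.integral_const, smul_eq_mul, sub_zero]
    calc t * (C₃ * D) * (C₂ * p.envelope x v) = C₂ * C₃ * t * D * p.envelope x v := by ring
      _ ≤ 1 / 2 * D * p.envelope x v := by
        gcongr
        exact hTL t ht
      _ = _ := by ring
  have near_step : ∀ {f}, p.Near f₀ C T f →
      p.Near f₀ C T fun t x v => freeFlow f₀ t x v + gain f t x v := fun {f} hf =>
    ⟨(measurable_freeFlow h.measurable).add (measurable_gain hf.measurable),
      fun t ht x v => by linarith [(near_gain hf t ht x v).2.1],
      fun t ht x v => by linarith [(near_gain hf t ht x v).2.2]⟩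
  have near_picard : ∀ n, p.Near f₀ C T (picard f₀ n) := by
    intro n
    induction n with
    | zero =>
      refine ⟨measurable_freeFlow h.measurable, fun t ht x v => le_rfl, fun t ht x v => ?_⟩
      change freeFlow f₀ t x v - freeFlow f₀ t x v ≤ _
      rw [sub_self]
      exact mul_nonneg (mul_nonneg hC0.le ht.1) (p.envelope_pos x v).le
    | succ n ih => exact near_step ih
  have step : ∀ n, ∀ t ∈ Icc 0 T, ∀ x v,
      |picard f₀ n t x v - picard f₀ (n + 1) t x v| ≤ C / 2 ^ n * p.envelope x v := by
    intro n
    induction n with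
    | zero =>
      intro t ht x v
      rw [abs_sub_comm]
      refine ((near_picard 1).abs_sub_le ht x v).trans ?_
      have := (p.envelope_pos x v).le
      rw [pow_zero, div_one]
      gcongr
      exact mul_le_of_le_one_right hC0.le (ht.2.trans hT1)
    | succ n ih =>
      intro t ht x v
      have := contr (near_picard n) (near_picard (n + 1)) (C / 2 ^ n) (by positivity) ih t ht x v
      change |freeFlow f₀ t x v + gain (picard f₀ n) t x v -
        (freeFlow f₀ t x v + gain (picard f₀ (n + 1)) t x v)| ≤ _
      rw [add_sub_add_left_eq_sub]
      refine this.trans (le_of_eq ?_)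
      rw [pow_succ]
      field_simp
  have geo : ∀ t ∈ Icc 0 T, ∀ x v n, dist (picard f₀ n t x v) (picard f₀ (n + 1) t x v) ≤
      2 * (C * p.envelope x v) / 2 / 2 ^ n := fun t ht x v n => by
    rw [Real.dist_eq]
    refine (step n t ht x v).trans (le_of_eq (by ring))
  -- Cutting off outside `[0, T]` makes the iterates converge at every point of the whole space, so
  -- the limit is measurable as a pointwise limit.
  have conv : ∀ z : ℝ × Space N × Space N, ∃ l, Filter.Tendsto
      (fun n => (Icc 0 T).indicator (fun t => picard f₀ n t z.2.1 z.2.2) z.1)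
      Filter.atTop (nhds l) := by
    intro z
    by_cases hz : z.1 ∈ Icc 0 T
    · simp only [indicator_of_mem hz]
      exact cauchySeq_tendsto_of_complete (cauchySeq_of_le_geometric_two (geo _ hz z.2.1 z.2.2))
    · simp only [indicator_of_notMem hz]
      exact ⟨0, tendsto_const_nhds⟩
  choose F hF using conv
  set f : ℝ → Space N → Space N → ℝ := fun t x v => F (t, x, v) with hf
  have lim : ∀ t ∈ Icc 0 T, ∀ x v, Filter.Tendsto (fun n => picard f₀ n t x v) Filter.atTop
      (nhds (f t x v)) := by
    intro t ht x v
    have := hF (t, x, v)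
    simpa only [indicator_of_mem ht] using this
  have hFm : Measurable F := by
    refine measurable_of_tendsto_metrizable (f := fun n (z : ℝ × Space N × Space N) =>
      (Icc 0 T).indicator (fun t => picard f₀ n t z.2.1 z.2.2) z.1) (fun n => ?_)
      (tendsto_pi_nhds.2 hF)
    exact (measurable_picard h.measurable n).indicator (measurable_fst measurableSet_Icc)
  have near_f : p.Near f₀ C T f := by
    refine ⟨hFm, fun t ht x v => ?_, fun t ht x v => ?_⟩
    · exact ge_of_tendsto' (lim t ht x v) fun n => (near_picard n).le t ht x v
    · exact le_of_tendsto' ((lim t ht x v).sub_const _) fun n => (near_picard n).sub_le t ht x v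
  have err : ∀ n, ∀ t ∈ Icc 0 T, ∀ x v,
      |picard f₀ n t x v - f t x v| ≤ 2 * C / 2 ^ n * p.envelope x v := by
    intro n t ht x v
    have := dist_le_of_le_geometric_two_of_tendsto (geo t ht x v) (lim t ht x v) n
    rw [Real.dist_eq] at this
    exact this.trans (le_of_eq (by ring))
  have fixed : ∀ t ∈ Icc 0 T, ∀ x v, f t x v = freeFlow f₀ t x v + gain f t x v := by
    intro t ht x v
    have l1 := (lim t ht x v).comp (Filter.tendsto_add_atTop_nat 1)
    refine tendsto_nhds_unique l1 ?_
    change Filter.Tendsto (fun n => freeFlow f₀ t x v + gain (picard f₀ n) t x v) _ _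
    apply Filter.Tendsto.const_add
    rw [tendsto_iff_dist_tendsto_zero]
    refine squeeze_zero (fun n => dist_nonneg) (fun n => ?_)
      (g := fun n : ℕ => C * p.envelope x v * (1 / 2) ^ n) ?_
    · rw [Real.dist_eq]
      refine (contr (near_picard n) near_f (2 * C / 2 ^ n) (by positivity) (err n)
        t ht x v).trans (le_of_eq ?_)
      rw [one_div, inv_pow]
      field_simp
    · have := (tendsto_pow_atTop_nhds_zero_of_lt_one (r := (1 / 2 : ℝ)) (by norm_num)
        (by norm_num)).const_mul (C * p.envelope x v)
      rwa [mul_zero] at this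
  refine ⟨T, hT0, f, ⟨hFm, ?_, ?_, ?_, ?_⟩, A, hA, 2 / a * Q, by positivity, fun t ht x => ?_⟩
  · intro t ht
    refine Filter.Eventually.of_forall fun z => le_trans ?_ (near_f.le t ht z.1 z.2)
    exact mul_nonneg (Real.exp_pos _).le (h.nonneg _ _)
  · exact fun t ht => Filter.Eventually.of_forall fun x => near_int near_f t ht x
  · exact fun t ht => Filter.Eventually.of_forall fun z => (near_gain near_f t ht z.1 z.2).1
  · exact fun t ht => Filter.Eventually.of_forall fun z => fixed t ht z.1 z.2
  · obtain ⟨b1, b2⟩ := near_bounds near_f t ht x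
    exact ⟨b1, b2.trans (le_of_eq (by ring))⟩

end

/-! ### The algebraic-exponential profile -/

section Real

/-- Let `w = n/L`, `z = n/M`. If `w ≥ 1`, then `M³ ≤ L³(1+Tw)` gives `w³ ≤ z³(1+Tw)`, hence `w² ≤
(1+T)z³`. So `w` grows at most like `z^{3/2}`, and any small multiple of `z²` plus a constant
dominates it. -/
theorem le_add_of_transport {L M n T ε : ℝ} (hL : 0 < L) (hM : 0 < M) (hn : 0 ≤ n) (hT : 0 ≤ T)
    (hε : 0 < ε) (hL1 : 1 ≤ L) (h : M ^ 3 ≤ L ^ 3 + T * n) :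
    n / L ≤ 1 + (1 + T) ^ 2 / ε ^ 3 + ε * (n / M) ^ 2 := by
  set z := n / M with hz
  set w := n / L with hw
  have hz0 : 0 ≤ z := by positivity
  have hw0 : 0 ≤ w := by positivity
  have hnw : n = w * L := by rw [hw]; field_simp
  have hnz : n = z * M := by rw [hz]; field_simp
  rcases le_total w 1 with h1 | h1
  · have : 0 ≤ (1 + T) ^ 2 / ε ^ 3 + ε * z ^ 2 := by positivity
    linarith
  by_contra! hcon
  have k0 : 0 ≤ (1 + T) ^ 2 / ε ^ 3 := by positivity
  have c1 : ε * z ^ 2 < w := by linarith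
  have c2 : (1 + T) ^ 2 / ε ^ 3 < w := by nlinarith [mul_nonneg hε.le (sq_nonneg z)]
  have e1 : M ^ 3 ≤ L ^ 3 * (1 + T * w) := by
    have : T * n ≤ L ^ 3 * (T * w) := by
      rw [hnw]
      have : L ≤ L ^ 3 := by nlinarith [sq_nonneg (L - 1)]
      calc T * (w * L) = L * (T * w) := by ring
        _ ≤ _ := by gcongr
    linarith
  have e2 : w ^ 3 ≤ z ^ 3 * (1 + T * w) := by
    have : w ^ 3 * L ^ 3 ≤ z ^ 3 * (1 + T * w) * L ^ 3 := by
      calc w ^ 3 * L ^ 3 = z ^ 3 * M ^ 3 := by rw [← mul_pow, ← mul_pow, ← hnw, ← hnz]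
        _ ≤ z ^ 3 * (L ^ 3 * (1 + T * w)) := by gcongr
        _ = _ := by ring
    exact le_of_mul_le_mul_right this (by positivity)
  have e3 : w ^ 2 ≤ (1 + T) * z ^ 3 := by
    have h2 : z ^ 3 * (1 + T * w) ≤ z ^ 3 * ((1 + T) * w) := by gcongr; linarith
    have h3 : w ^ 2 * w ≤ (1 + T) * z ^ 3 * w := by nlinarith
    exact le_of_mul_le_mul_right h3 (by linarith)
  have hzpos : 0 < z := by
    rcases hz0.eq_or_lt with h0 | h0
    · rw [← h0] at e3
      norm_num at e3
      nlinarith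
    · exact h0
  have e4 : z < (1 + T) / ε ^ 2 := by
    rw [lt_div_iff₀ (by positivity)]
    have : (ε * z ^ 2) ^ 2 < w ^ 2 := by gcongr
    have h2 : z * ε ^ 2 * z ^ 3 < (1 + T) * z ^ 3 := by nlinarith
    exact lt_of_mul_lt_mul_right h2 (by positivity)
  have e5 : w ^ 2 ≤ ((1 + T) ^ 2 / ε ^ 3) ^ 2 := by
    calc w ^ 2 ≤ (1 + T) * z ^ 3 := e3
      _ ≤ (1 + T) * ((1 + T) / ε ^ 2) ^ 3 := by gcongr
      _ = _ := by field_simp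
  exact absurd (le_of_pow_le_pow_left₀ two_ne_zero k0 e5) (not_le.2 c2)

/-- For `M ≤ L`, `L^β - M^β ≤ L²(1 - (M/L)³) = (L³ - M³)/L`. Here `β ≤ 2` matters: the change of the
exponent of the amplitude is then linear in `n/L`. -/
theorem rpow_sub_le_of_transport {L M n T β : ℝ} (hL1 : 1 ≤ L) (hM : 0 < M) (hn : 0 ≤ n)
    (hT : 0 ≤ T) (hβ : 0 < β) (hβ2 : β ≤ 2) (h : L ^ 3 ≤ M ^ 3 + T * n) :
    L ^ β - M ^ β ≤ T * (n / L) := by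
  have hL : 0 < L := by linarith
  rcases le_total L M with hLM | hLM
  · have : L ^ β ≤ M ^ β := Real.rpow_le_rpow hL.le hLM hβ.le
    have : 0 ≤ T * (n / L) := by positivity
    linarith
  have hq : (M / L) ^ (3 : ℕ) ≤ (M / L) ^ β := by
    rw [← Real.rpow_natCast]
    exact Real.rpow_le_rpow_of_exponent_ge (by positivity) ((div_le_one hL).2 hLM)
      (by push_cast; linarith)
  have hML : M ^ β = L ^ β * (M / L) ^ β := by
    rw [← Real.mul_rpow hL.le (by positivity)]
    congr 1
    field_simp
  have hLβ : L ^ β ≤ L ^ 2 := by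
    rw [← Real.rpow_natCast]
    exact Real.rpow_le_rpow_of_exponent_le hL1 (by push_cast; linarith)
  have h0 : 0 ≤ 1 - (M / L) ^ 3 := by
    have : (M / L) ^ 3 ≤ 1 := pow_le_one₀ (by positivity) ((div_le_one hL).2 hLM)
    linarith
  calc L ^ β - M ^ β = L ^ β * (1 - (M / L) ^ β) := by rw [hML]; ring
    _ ≤ L ^ β * (1 - (M / L) ^ 3) := by gcongr
    _ ≤ L ^ 2 * (1 - (M / L) ^ 3) := by gcongr
    _ = (L ^ 3 - M ^ 3) / L := by field_simp
    _ ≤ T * n / L := by gcongr; linarith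
    _ = _ := by ring

theorem exists_one_add_rpow_le {m T κ : ℝ} (hT : 0 ≤ T) (hκ : 0 < κ) :
    ∃ C > 0, ∀ z : ℝ, 0 ≤ z → (1 + T * z) ^ m ≤ C * Real.exp (κ * z ^ 2) := by
  obtain ⟨k, hk⟩ := exists_nat_ge m
  refine ⟨k.factorial * Real.exp (1 + T ^ 2 / (4 * κ)), by positivity, fun z hz => ?_⟩
  have h0 : 0 ≤ T * z := by positivity
  have h1 := Real.pow_div_factorial_le_exp (1 + T * z) (by positivity) k
  rw [div_le_iff₀ (by positivity)] at h1
  have h2 : (1 + T * z) ^ m ≤ (1 + T * z) ^ k := by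
    rw [← Real.rpow_natCast]
    exact Real.rpow_le_rpow_of_exponent_le (by linarith) hk
  -- Completing the square lets the Gaussian absorb the linear exponent.
  have h3 : T * z ≤ T ^ 2 / (4 * κ) + κ * z ^ 2 := by
    have h4 : T ^ 2 / (4 * κ) + κ * z ^ 2 - T * z = (T - 2 * κ * z) ^ 2 / (4 * κ) := by
      field_simp
      ring
    have : 0 ≤ (T - 2 * κ * z) ^ 2 / (4 * κ) := by positivity
    linarith
  calc (1 + T * z) ^ m ≤ Real.exp (1 + T * z) * k.factorial := h2.trans h1
    _ ≤ Real.exp ((1 + T ^ 2 / (4 * κ)) + κ * z ^ 2) * k.factorial :=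
        mul_le_mul_of_nonneg_right (Real.exp_le_exp.2 (by linarith)) (by positivity)
    _ = _ := by rw [Real.exp_add]; ring

/-- The amplitude `L^{-m} e^{-α L^β}` as a function of the width `L`. -/
def amplitude (α β m L : ℝ) : ℝ := L ^ (-m) * Real.exp (-α * L ^ β)

theorem amplitude_pos {α β m L : ℝ} (hL : 0 < L) : 0 < amplitude α β m L :=
  mul_pos (Real.rpow_pos_of_pos hL _) (Real.exp_pos _)

theorem exists_amplitude_transport {α β m κ T : ℝ} (hα : 0 < α) (hβ : 0 < β) (hβ2 : β ≤ 2)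
    (hm : 0 ≤ m) (hκ : 0 < κ) (hT : 0 < T) :
    ∃ C > 0, ∀ L M n : ℝ, 1 ≤ L → 1 ≤ M → 0 ≤ n → L ^ 3 ≤ M ^ 3 + T * n →
      M ^ 3 ≤ L ^ 3 + T * n →
      amplitude α β m M * Real.exp (-κ * (n / M) ^ 2) ≤
        C * (amplitude α β m L * Real.exp (-(n / L))) := by
  obtain ⟨C, hC, h⟩ := exists_one_add_rpow_le (m := m) hT.le (half_pos hκ)
  -- The exponent `κz²` is split in two. One half absorbs the polynomial factor `(1+Tz)^m`; the
  -- other absorbs `(1+αT)w`, where `w` is the target envelope and `αTw` the change of amplitude.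
  set ε := κ / (2 * (1 + α * T)) with hε
  have hε0 : 0 < ε := by positivity
  set B := 1 + (1 + T) ^ 2 / ε ^ 3 with hB
  refine ⟨C * Real.exp ((1 + α * T) * B), by positivity, ?_⟩
  intro L M n hL1 hM1 hn h1 h2
  have hL : 0 < L := by linarith
  have hM : 0 < M := by linarith
  have hz0 : 0 ≤ n / M := by positivity
  have k1 := rpow_sub_le_of_transport hL1 hM hn hT.le hβ hβ2 h1
  have k2 := le_add_of_transport hL hM hn hT.le hε0 hL1 h2
  have k3 := h _ hz0
  have hnz : n = n / M * M := by field_simp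
  set z := n / M with hz
  set w := n / L
  have k4 : L ≤ M * (1 + T * z) := by
    refine le_of_pow_le_pow_left₀ (n := 3) (by norm_num) (by positivity) (h1.trans ?_)
    have hTz : 0 ≤ T * z := by positivity
    have e1 : M ≤ M ^ 3 := by nlinarith [sq_nonneg (M - 1)]
    have e2 : T * n ≤ M ^ 3 * (T * z) := by
      calc T * n = M * (T * z) := by rw [hnz]; ring
        _ ≤ _ := by gcongr
    have e3 : 1 + T * z ≤ (1 + T * z) ^ 3 := by nlinarith [sq_nonneg (T * z), pow_nonneg hTz 3]
    calc M ^ 3 + T * n ≤ M ^ 3 * (1 + T * z) := by linarith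
      _ ≤ M ^ 3 * (1 + T * z) ^ 3 := by gcongr
      _ = _ := by ring
  have k5 : M ^ (-m) ≤ L ^ (-m) * (C * Real.exp (κ / 2 * z ^ 2)) := by
    have e1 : L ^ m ≤ M ^ m * (1 + T * z) ^ m := by
      rw [← Real.mul_rpow hM.le (by positivity)]
      exact Real.rpow_le_rpow hL.le k4 hm
    have hLm := Real.rpow_pos_of_pos hL m
    have hMm := Real.rpow_pos_of_pos hM m
    rw [Real.rpow_neg hM.le, Real.rpow_neg hL.le, inv_mul_eq_div, le_div_iff₀ hLm,
      inv_mul_le_iff₀ hMm]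
    exact e1.trans (by gcongr)
  have k6 : κ / 2 * z ^ 2 + -α * M ^ β + -κ * z ^ 2 ≤
      (1 + α * T) * B + (-α * L ^ β + -w) := by
    have e1 : α * (L ^ β - M ^ β) ≤ α * (T * w) := by gcongr
    have e2 : (1 + α * T) * w ≤ (1 + α * T) * (B + ε * z ^ 2) := by gcongr
    have e3 : (1 + α * T) * (ε * z ^ 2) = κ / 2 * z ^ 2 := by rw [hε]; field_simp
    nlinarith
  unfold amplitude
  calc M ^ (-m) * Real.exp (-α * M ^ β) * Real.exp (-κ * z ^ 2)
      ≤ L ^ (-m) * (C * Real.exp (κ / 2 * z ^ 2)) * Real.exp (-α * M ^ β) *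
        Real.exp (-κ * z ^ 2) := by gcongr
    _ = L ^ (-m) * C * Real.exp (κ / 2 * z ^ 2 + -α * M ^ β + -κ * z ^ 2) := by
        rw [Real.exp_add, Real.exp_add]; ring
    _ ≤ L ^ (-m) * C * Real.exp ((1 + α * T) * B + (-α * L ^ β + -w)) := by
        have := Real.rpow_pos_of_pos hL (-m)
        gcongr
    _ = _ := by rw [Real.exp_add, Real.exp_add]; ring

end Real

/-! ### The cube-root width and its profile. -/

section

variable {N : ℕ}

/-- The width `(1 + |x|)^{1/3}`. -/
def width (R : ℝ) : ℝ := (1 + R) ^ (1 / 3 : ℝ)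

theorem width_cube {R : ℝ} (hR : 0 ≤ R) : width R ^ 3 = 1 + R := by
  unfold width
  rw [← Real.rpow_natCast, ← Real.rpow_mul (by positivity)]
  norm_num

theorem one_le_width {R : ℝ} (hR : 0 ≤ R) : 1 ≤ width R :=
  Real.one_le_rpow (by linarith) (by norm_num)

theorem width_pos {R : ℝ} (hR : 0 ≤ R) : 0 < width R :=
  lt_of_lt_of_le one_pos (one_le_width hR)

theorem width_rpow {R : ℝ} (hR : 0 ≤ R) (e : ℝ) : width R ^ (3 * e) = (1 + R) ^ e := by
  unfold width
  rw [← Real.rpow_mul (by positivity)]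
  congr 1
  ring

theorem norm_sub_smul_le (x v : Space N) {τ : ℝ} (hτ : 0 ≤ τ) :
    ‖x - τ • v‖ ≤ ‖x‖ + τ * ‖v‖ := by
  refine (norm_sub_le _ _).trans (le_of_eq ?_)
  rw [norm_smul, Real.norm_of_nonneg hτ]

theorem norm_le_sub_smul (x v : Space N) {τ : ℝ} (hτ : 0 ≤ τ) :
    ‖x‖ ≤ ‖x - τ • v‖ + τ * ‖v‖ := by
  have := norm_le_norm_add_norm_sub' x (τ • v)
  have h2 : ‖τ • v‖ = τ * ‖v‖ := by rw [norm_smul, Real.norm_of_nonneg hτ]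
  linarith

/-- The profile with width `(1+|x|)^{1/3}` and amplitude `L^{-m} e^{-α L^β}`. -/
def cubeProfile (N : ℕ) {α β m : ℝ} (hα : 0 < α) (hβ : 0 < β) (hβ2 : β ≤ 2) (hm : 0 ≤ m) :
    Profile N where
  amp x := amplitude α β m (width ‖x‖)
  width x := width ‖x‖
  amp_pos x := amplitude_pos (width_pos (norm_nonneg x))
  width_pos x := BGK.width_pos (norm_nonneg x)
  measurable_amp := by unfold amplitude BGK.width; fun_prop
  measurable_width := by unfold BGK.width; fun_prop
  transport κ hκ T hT := by
    obtain ⟨C, hC, h⟩ := exists_amplitude_transport hα hβ hβ2 hm hκ hT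
    refine ⟨C, hC, fun x v τ hτ => ?_⟩
    -- The cubes of the widths are `1 + |x|`, so transport changes them by at most `T|v|` in either
    -- direction.
    have hTv : τ * ‖v‖ ≤ T * ‖v‖ := by gcongr; exact hτ.2
    apply h _ _ _ (one_le_width (norm_nonneg _)) (one_le_width (norm_nonneg _)) (norm_nonneg v)
    · rw [width_cube (norm_nonneg _), width_cube (norm_nonneg _)]
      linarith [norm_le_sub_smul x v hτ.1]
    · rw [width_cube (norm_nonneg _), width_cube (norm_nonneg _)]
      linarith [norm_sub_smul_le x v hτ.1]

end

/-! ### The radial form of the truncated datum -/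

section

/-- The cube root. -/
def cbrt (R : ℝ) : ℝ := R ^ (1 / 3 : ℝ)

theorem cbrt_nonneg {R : ℝ} (hR : 0 ≤ R) : 0 ≤ cbrt R := Real.rpow_nonneg hR _

theorem cbrt_cube {R : ℝ} (hR : 0 ≤ R) : cbrt R ^ 3 = R := by
  unfold cbrt
  rw [← Real.rpow_natCast, ← Real.rpow_mul hR]
  norm_num

theorem cbrt_le_width {R : ℝ} (hR : 0 ≤ R) : cbrt R ≤ width R :=
  Real.rpow_le_rpow hR (by linarith) (by norm_num)

/-- Since `L³ - r³ = 1`, the smooth width and the actual edge differ by at most `L^{-2}`, so either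
may be used in the estimates. -/
theorem width_sub_cbrt_le {R : ℝ} (hR : 0 ≤ R) : width R - cbrt R ≤ 1 / width R ^ 2 := by
  have hL := width_pos hR
  have hr := cbrt_nonneg hR
  have h1 := width_cube hR
  have h2 := cbrt_cube hR
  have h3 := cbrt_le_width hR
  rw [le_div_iff₀ (by positivity)]
  have : (width R - cbrt R) * (width R ^ 2 + width R * cbrt R + cbrt R ^ 2) = 1 := by
    linear_combination h1 - h2
  have h4 : 0 ≤ (width R - cbrt R) * (width R * cbrt R + cbrt R ^ 2) :=
    mul_nonneg (by linarith) (by positivity)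
  linarith

/-! ### The layer of thickness `L ^ (1 - β)` near speed `L`, on which `exp (-α s ^ β)` varies by a
bounded factor. -/

theorem inv_le_rpow_one_sub {L β : ℝ} (hL : 1 ≤ L) (hβ2 : β ≤ 2) : 1 / L ≤ L ^ (1 - β) := by
  rw [one_div, ← Real.rpow_neg_one]
  exact Real.rpow_le_rpow_of_exponent_le hL (by linarith)

theorem rpow_one_sub_le {L β : ℝ} (hL : 1 ≤ L) (hβ : 0 < β) : L ^ (1 - β) ≤ L := by
  calc L ^ (1 - β) ≤ L ^ (1 : ℝ) := Real.rpow_le_rpow_of_exponent_le hL (by linarith)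
    _ = L := Real.rpow_one L

theorem rpow_eq_mul_div {L s β : ℝ} (hL : 0 < L) (hs : 0 ≤ s) :
    s ^ β = L ^ β * (s / L) ^ β := by
  rw [← Real.mul_rpow hL.le (by positivity)]
  congr 1
  field_simp

theorem rpow_div_self_eq {L β : ℝ} (hL : 0 < L) : L ^ β / L = (L ^ (1 - β))⁻¹ := by
  rw [← Real.rpow_neg hL.le, ← Real.rpow_sub_one hL.ne']
  congr 1
  ring

/-- For `q = s/L ≤ 1` one has `1 - q^β ≤ 1 - q² ≤ 2(1 - q)`. -/
theorem rpow_sub_rpow_le_of_le {L s β : ℝ} (hL : 0 < L) (hs : 0 ≤ s) (hsL : s ≤ L)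
    (hβ : 0 < β) (hβ2 : β ≤ 2) : L ^ β - s ^ β ≤ 2 * ((L - s) / L ^ (1 - β)) := by
  have hq : (s / L) ^ (2 : ℕ) ≤ (s / L) ^ β := by
    rw [← Real.rpow_natCast]
    exact Real.rpow_le_rpow_of_exponent_ge' (by positivity) ((div_le_one hL).2 hsL)
      hβ.le (by push_cast; linarith)
  have hLβ := Real.rpow_pos_of_pos hL β
  have hq1 : s / L ≤ 1 := (div_le_one hL).2 hsL
  have hq0 : 0 ≤ s / L := by positivity
  calc L ^ β - s ^ β = L ^ β * (1 - (s / L) ^ β) := by rw [rpow_eq_mul_div hL hs]; ring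
    _ ≤ L ^ β * (2 * (1 - s / L)) := by
        gcongr
        nlinarith
    _ = 2 * ((L - s) * (L ^ β / L)) := by field_simp
    _ = _ := by rw [rpow_div_self_eq hL]; ring

/-- For `β < 1` the power is concave, so a linear lower bound holds only on a bounded range of
`s/L`. It follows from `q^β ≥ 1 + β log q` and `log q ≥ 1 - 1/q ≥ (q-1)/K`. -/
theorem le_rpow_sub_rpow {L s β K : ℝ} (hL : 0 < L) (hsL : L ≤ s) (hsK : s ≤ K * L)
    (hβ : 0 < β) : β / K * ((s - L) / L ^ (1 - β)) ≤ s ^ β - L ^ β := by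
  have hs : 0 < s := hL.trans_le hsL
  have hq1 : 1 ≤ s / L := (one_le_div hL).2 hsL
  have hqK : s / L ≤ K := (div_le_iff₀ hL).2 hsK
  have hK : 0 < K := by linarith
  have hLβ := Real.rpow_pos_of_pos hL β
  have hlog : 1 - (s / L)⁻¹ ≤ Real.log (s / L) :=
    Real.one_sub_inv_le_log_of_pos (by positivity)
  have hpow : 1 + β * Real.log (s / L) ≤ (s / L) ^ β := by
    rw [Real.rpow_def_of_pos (by positivity)]
    linarith [Real.add_one_le_exp (Real.log (s / L) * β)]
  have h1 : (s / L - 1) / K ≤ 1 - (s / L)⁻¹ := by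
    calc (s / L - 1) / K ≤ (s / L - 1) / (s / L) := by gcongr
      _ = _ := by field_simp
  calc β / K * ((s - L) / L ^ (1 - β)) = L ^ β * (β * ((s / L - 1) / K)) := by
        rw [div_eq_mul_inv (s - L), ← rpow_div_self_eq hL]; field_simp
    _ ≤ L ^ β * ((s / L) ^ β - 1) := by
        gcongr
        have : β * ((s / L - 1) / K) ≤ β * Real.log (s / L) := by gcongr; linarith
        linarith
    _ = _ := by rw [rpow_eq_mul_div hL hs.le]; ring

theorem rpow_sub_rpow_le_of_ge {L s β : ℝ} (hL : 1 ≤ L) (hsL : L ≤ s)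
    (hs : s ≤ L + L ^ (1 - β)) (hβ : 0 < β) (hβ2 : β ≤ 2) : s ^ β - L ^ β ≤ 3 := by
  have hL0 : 0 < L := by linarith
  have hh := Real.rpow_pos_of_pos hL0 (1 - β)
  have hhL := rpow_one_sub_le hL hβ
  have hq1 : 1 ≤ s / L := (one_le_div hL0).2 hsL
  have hq2 : s / L ≤ 2 := (div_le_iff₀ hL0).2 (by linarith)
  have hLβ := Real.rpow_pos_of_pos hL0 β
  have hq : (s / L) ^ β ≤ (s / L) ^ (2 : ℕ) := by
    rw [← Real.rpow_natCast]
    exact Real.rpow_le_rpow_of_exponent_le hq1 (by push_cast; linarith)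
  calc s ^ β - L ^ β = L ^ β * ((s / L) ^ β - 1) := by
        rw [rpow_eq_mul_div hL0 (by linarith)]; ring
    _ ≤ L ^ β * (3 * (s / L - 1)) := by
        gcongr
        nlinarith
    _ = 3 * ((s - L) * (L ^ β / L)) := by field_simp
    _ = 3 * ((s - L) / L ^ (1 - β)) := by rw [rpow_div_self_eq hL0]; ring
    _ ≤ 3 * 1 := by
        gcongr
        rw [div_le_one hh]
        linarith
    _ = 3 := by norm_num

/-- The velocity decay `(1+s²)^{-δ} e^{-α s^β}`. -/
def decay (α β δ s : ℝ) : ℝ := (1 + s ^ 2) ^ (-δ) * Real.exp (-α * s ^ β)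

/-- The decay at the inner edge. -/
def edgeDecay (α β δ L : ℝ) : ℝ := L ^ (-(2 * δ)) * Real.exp (-α * L ^ β)

theorem decay_pos (α β δ s : ℝ) : 0 < decay α β δ s :=
  mul_pos (Real.rpow_pos_of_pos (by positivity) _) (Real.exp_pos _)

theorem edgeDecay_pos {α β δ L : ℝ} (hL : 0 < L) : 0 < edgeDecay α β δ L :=
  mul_pos (Real.rpow_pos_of_pos hL _) (Real.exp_pos _)

theorem decay_le_one {α β δ s : ℝ} (hα : 0 ≤ α) (hδ : 0 ≤ δ) (hs : 0 ≤ s) :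
    decay α β δ s ≤ 1 := by
  unfold decay
  have h1 : (1 + s ^ 2) ^ (-δ) ≤ 1 :=
    Real.rpow_le_one_of_one_le_of_nonpos (by nlinarith) (by linarith)
  have h2 : Real.exp (-α * s ^ β) ≤ 1 := by
    rw [Real.exp_le_one_iff]
    have := mul_nonneg hα (Real.rpow_nonneg hs β)
    linarith
  exact mul_le_one₀ h1 (Real.exp_pos _).le h2

theorem sq_rpow_neg {L δ : ℝ} (hL : 0 ≤ L) : (L ^ 2) ^ (-δ) = L ^ (-(2 * δ)) := by
  rw [← Real.rpow_natCast, ← Real.rpow_mul hL]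
  congr 1
  push_cast
  ring

/-- Speeds slightly below `L` are admitted: `1/L²` is the gap between `L` and the cube root, and
`L^{1-β}/4` leaves room for the displacement of the edge. In both regimes the decay is governed by
the exponential tail above the edge. -/
theorem decay_le {α β δ L s : ℝ} (hα : 0 < α) (hβ : 0 < β) (hβ2 : β ≤ 2) (hδ : 0 ≤ δ)
    (hL : 1 ≤ L) (hs : 0 ≤ s) (hsL : L - s ≤ 1 / L ^ 2 + L ^ (1 - β) / 4) (hsK : s ≤ 24 * L) :
    decay α β δ s ≤ 16 ^ δ * Real.exp (5 / 2 * α) * edgeDecay α β δ L *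
      Real.exp (-(α * β / 24) * ((s - L) / L ^ (1 - β))) := by
  have hL0 : 0 < L := by linarith
  have hh := Real.rpow_pos_of_pos hL0 (1 - β)
  have hhL := rpow_one_sub_le hL hβ
  have hhi := inv_le_rpow_one_sub hL hβ2
  have hL2 : 1 / L ^ 2 ≤ 1 / L := by gcongr; nlinarith
  have h1 : L ^ 2 / 16 ≤ 1 + s ^ 2 := by
    rcases le_total L 2 with h | h
    · nlinarith [sq_nonneg s]
    · have : 1 / L ^ 2 ≤ 1 / 4 := by gcongr; nlinarith
      have : L / 2 ≤ s := by linarith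
      nlinarith
  have h2 : (1 + s ^ 2) ^ (-δ) ≤ 16 ^ δ * L ^ (-(2 * δ)) := by
    calc (1 + s ^ 2) ^ (-δ) ≤ (L ^ 2 / 16) ^ (-δ) :=
          Real.rpow_le_rpow_of_nonpos (by positivity) h1 (by linarith)
      _ = _ := by
          rw [Real.div_rpow (by positivity) (by norm_num), sq_rpow_neg hL0.le,
            Real.rpow_neg (by norm_num : (0 : ℝ) ≤ 16), div_inv_eq_mul, mul_comm]
  have h3 : -α * s ^ β ≤ 5 / 2 * α + -α * L ^ β + -(α * β / 24) * ((s - L) / L ^ (1 - β)) := by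
    rcases le_total s L with h | h
    · have e1 := rpow_sub_rpow_le_of_le hL0 hs h hβ hβ2
      have e2 : (L - s) / L ^ (1 - β) ≤ 5 / 4 := by
        rw [div_le_iff₀ hh]; linarith
      have e3 : (s - L) / L ^ (1 - β) ≤ 0 := div_nonpos_of_nonpos_of_nonneg (by linarith) hh.le
      have e4 : 0 ≤ -(α * β / 24) * ((s - L) / L ^ (1 - β)) :=
        mul_nonneg_of_nonpos_of_nonpos (by have := mul_pos hα hβ; linarith) e3
      have e5 : α * (L ^ β - s ^ β) ≤ α * (5 / 2) := by gcongr; linarith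
      linarith
    · have e1 := le_rpow_sub_rpow hL0 h hsK hβ
      have e2 := mul_le_mul_of_nonneg_left e1 hα.le
      have e3 : α * (β / 24 * ((s - L) / L ^ (1 - β))) =
        α * β / 24 * ((s - L) / L ^ (1 - β)) := by ring
      linarith
  unfold decay edgeDecay
  calc _ ≤ 16 ^ δ * L ^ (-(2 * δ)) * Real.exp (5 / 2 * α + -α * L ^ β +
        -(α * β / 24) * ((s - L) / L ^ (1 - β))) := by
        have := Real.rpow_pos_of_pos hL0 (-(2 * δ))
        gcongr
    _ = _ := by rw [Real.exp_add, Real.exp_add]; ring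

theorem le_decay {α β δ L s : ℝ} (hα : 0 < α) (hβ : 0 < β) (hβ2 : β ≤ 2) (hδ : 0 ≤ δ)
    (hL : 1 ≤ L) (hsL : L ≤ s) (hs : s ≤ L + L ^ (1 - β)) :
    5 ^ (-δ) * Real.exp (-3 * α) * edgeDecay α β δ L ≤ decay α β δ s := by
  have hL0 : 0 < L := by linarith
  have hhL := rpow_one_sub_le hL hβ
  have h1 : 5 ^ (-δ) * L ^ (-(2 * δ)) ≤ (1 + s ^ 2) ^ (-δ) := by
    rw [← sq_rpow_neg hL0.le, ← Real.mul_rpow (by norm_num) (by positivity)]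
    exact Real.rpow_le_rpow_of_nonpos (by positivity) (by nlinarith) (by linarith)
  have h2 := mul_le_mul_of_nonneg_left (rpow_sub_rpow_le_of_ge hL hsL hs hβ hβ2) hα.le
  unfold decay edgeDecay
  calc _ = 5 ^ (-δ) * L ^ (-(2 * δ)) * Real.exp (-3 * α + -α * L ^ β) := by
        rw [Real.exp_add]; ring
    _ ≤ _ := by
        gcongr
        linarith

open Classical in
/-- The truncated datum as a function of `|x|` and `|v|`. -/
def radialDatum (α β δ ω c R s : ℝ) : ℝ :=
  if cbrt R ≤ s ∧ s ≤ 2 * cbrt R + 10 then c * (1 + R) ^ (-ω) * decay α β δ s else 0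

theorem truncatedDatum_eq {N : ℕ} (α β δ ω c : ℝ) (x v : Space N) :
    truncatedDatum α β (1 / 3) δ ω c x v = radialDatum α β δ ω c ‖x‖ ‖v‖ := by
  unfold truncatedDatum radialDatum cbrt decay
  simp only [mul_assoc]

theorem radialDatum_nonneg {α β δ ω c R s : ℝ} (hc : 0 ≤ c) (hR : 0 ≤ R) :
    0 ≤ radialDatum α β δ ω c R s := by
  have := (decay_pos α β δ s).le
  unfold radialDatum
  split_ifs <;> positivity

theorem rpow_neg_le_one {R ω : ℝ} (hR : 0 ≤ R) (hω : 0 ≤ ω) : (1 + R) ^ (-ω) ≤ 1 :=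
  Real.rpow_le_one_of_one_le_of_nonpos (by linarith) (by linarith)

theorem radialDatum_le {α β δ ω c R s : ℝ} (hα : 0 ≤ α) (hδ : 0 ≤ δ) (hω : 0 ≤ ω) (hc : 0 ≤ c)
    (hR : 0 ≤ R) (hs : 0 ≤ s) : radialDatum α β δ ω c R s ≤ c := by
  unfold radialDatum
  split_ifs
  · have h1 := rpow_neg_le_one hR hω
    have h2 := decay_le_one (β := β) hα hδ hs
    have h3 : c * (1 + R) ^ (-ω) ≤ c := mul_le_of_le_one_right hc h1
    exact (mul_le_of_le_one_right (by positivity) h2).trans h3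
  · exact hc

/-! ### Effect of a spatial displacement on the width, the edge and the spatial factor. -/

theorem le_width_of_mem {R s : ℝ} (hR : 0 ≤ R) (hs : s ≤ 2 * cbrt R + 10) : s ≤ 12 * width R := by
  linarith [cbrt_le_width hR, one_le_width hR]

/-- Widths at nearby points are comparable on the support of the datum. -/
theorem width_le_two_mul {R R' s t : ℝ} (hR : 0 ≤ R) (hR' : 0 ≤ R') (ht0 : 0 ≤ t)
    (ht : t ≤ 1 / 48) (h : R' ≤ R + t * s) (hs : s ≤ 2 * cbrt R' + 10) :
    width R' ≤ 2 * width R := by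
  have h1 := le_width_of_mem hR' hs
  have hL := one_le_width hR
  have hM := one_le_width hR'
  have h2 := width_cube hR
  have h3 := width_cube hR'
  have h4 : width R' ≤ width R' ^ 3 := by nlinarith [sq_nonneg (width R' - 1)]
  -- The displacement is at most a quarter of the new cube, which can be absorbed on the left.
  have h5 : t * s ≤ 1 / 48 * (12 * width R' ^ 3) := by
    calc t * s ≤ t * (12 * width R' ^ 3) := by gcongr; linarith
      _ ≤ _ := by gcongr
  refine le_of_pow_le_pow_left₀ (n := 3) (by norm_num) (by positivity) ?_
  have : 0 < width R ^ 3 := by positivity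
  rw [mul_pow]
  linarith

/-- Away from the origin the cube root has slope of order `L^{-2}`, so the edge moves by `O(t/L)`.
Near the origin (`L ≤ 2`) only `Δ³ ≤ 48 t` is available; the power `t^{1/4}`, weaker than `t^{1/3}`,
covers both cases. -/
theorem abs_cbrt_sub_le {R R' t β : ℝ} (hR : 0 ≤ R) (hR' : 0 ≤ R') (ht0 : 0 ≤ t) (ht1 : t ≤ 1)
    (hβ2 : β ≤ 2) (h : |R' - R| ≤ t * (24 * width R)) :
    |cbrt R' - cbrt R| ≤ 96 * t ^ (1 / 4 : ℝ) * width R ^ (1 - β) := by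
  have hL1 := one_le_width hR
  have hL := width_pos hR
  have hr := cbrt_nonneg hR
  have hr' := cbrt_nonneg hR'
  have h2 := cbrt_cube hR
  have h3 := cbrt_cube hR'
  have hd := width_sub_cbrt_le hR
  have hi := inv_le_rpow_one_sub hL1 hβ2
  have hq := le_rpow_quarter ht0 ht1
  have hq0 : 0 ≤ t ^ (1 / 4 : ℝ) := Real.rpow_nonneg ht0 _
  set L := width R
  set r := cbrt R
  set r' := cbrt R'
  set Δ := |r' - r| with hΔ
  have hΔ0 : 0 ≤ Δ := abs_nonneg _
  have hfac : |R' - R| = Δ * (r' ^ 2 + r' * r + r ^ 2) := by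
    rw [← h2, ← h3, hΔ, ← abs_of_nonneg (by positivity : 0 ≤ r' ^ 2 + r' * r + r ^ 2), ← abs_mul]
    congr 1
    ring
  rw [hfac] at h
  suffices hs : Δ ≤ 96 * t ^ (1 / 4 : ℝ) * (1 / L) from hs.trans (by gcongr)
  rcases le_total (L / 2) r with hc | hc
  · have e1 : Δ * (L ^ 2 / 4) ≤ t * (24 * L) := by
      refine le_trans ?_ h
      gcongr
      nlinarith [mul_nonneg hr hr', sq_nonneg r']
    have e2 : Δ * L ≤ 96 * t := by
      have : Δ * L * L ≤ 96 * t * L := by linarith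
      exact le_of_mul_le_mul_right this hL
    rw [mul_one_div, le_div_iff₀ hL]
    linarith
  · have e1 : L ≤ 2 := by
      have e2 : L / 2 ≤ 1 / L ^ 2 := by linarith
      rw [le_div_iff₀ (by positivity)] at e2
      by_contra! hcon
      nlinarith [mul_pos hL hL]
    have e3 : Δ ^ 3 ≤ t * (24 * L) := by
      refine le_trans ?_ h
      rw [pow_succ']
      gcongr
      rw [hΔ, sq_abs]
      nlinarith [mul_nonneg hr hr']
    have e4 : t ≤ (t ^ (1 / 4 : ℝ)) ^ 3 := by
      rw [← Real.rpow_natCast, ← Real.rpow_mul ht0]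
      exact Real.self_le_rpow_of_le_one ht0 ht1 (by norm_num)
    have e5 : Δ ≤ 4 * t ^ (1 / 4 : ℝ) := by
      refine le_of_pow_le_pow_left₀ (n := 3) (by norm_num) (by positivity) ?_
      rw [mul_pow]
      nlinarith
    have e6 : 1 / 2 ≤ 1 / L := by gcongr
    nlinarith

/-- The quotient `(1+R')/(1+R)` is within `24t` of 1, because the width is at most `1 + R`. For `t ≤
1/48` it is at least 1/2, where the negative power is Lipschitz. -/
theorem abs_rpow_neg_sub_le {R R' t ω : ℝ} (hR : 0 ≤ R) (hω : 0 ≤ ω) (ht : t ≤ 1 / 48)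
    (hR' : 0 ≤ R') (h : |R' - R| ≤ t * (24 * width R)) :
    |(1 + R') ^ (-ω) - (1 + R) ^ (-ω)| ≤ 48 * ω * (2 ^ ω + 1) * t * (1 + R) ^ (-ω) := by
  have h1 : width R ≤ 1 + R := by
    rw [← width_cube hR]
    have := one_le_width hR
    nlinarith [sq_nonneg (width R - 1)]
  have hL := width_pos hR
  have hp : 0 < 1 + R := by linarith
  have ht0 : 0 ≤ t := by
    by_contra! hcon
    have := abs_nonneg (R' - R)
    nlinarith
  set q := (1 + R') / (1 + R) with hq
  have hq0 : 0 < q := by positivity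
  have hq1 : |q - 1| ≤ 24 * t := by
    have : q - 1 = (R' - R) / (1 + R) := by rw [hq]; field_simp; ring
    rw [this, abs_div, abs_of_pos hp, div_le_iff₀ hp]
    calc _ ≤ t * (24 * width R) := h
      _ ≤ t * (24 * (1 + R)) := by gcongr
      _ = _ := by ring
  have hq2 : 1 / 2 ≤ q := by have := (abs_le.1 hq1).1; linarith
  have e1 : (1 + R') ^ (-ω) = (1 + R) ^ (-ω) * q ^ (-ω) := by
    rw [← Real.mul_rpow hp.le hq0.le]
    congr 1
    rw [hq]; field_simp
  have e2 : |q ^ (-ω) - 1| ≤ 48 * ω * (2 ^ ω + 1) * t := by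
    have k1 : |Real.log q - Real.log 1| ≤ |q - 1| / (1 / 2) :=
      abs_log_sub_log_le (by norm_num) hq2 (by norm_num)
    rw [Real.log_one, sub_zero] at k1
    have k2 : q ^ (-ω) ≤ 2 ^ ω := by
      calc q ^ (-ω) ≤ (1 / 2) ^ (-ω) := Real.rpow_le_rpow_of_nonpos (by norm_num) hq2 (by linarith)
        _ = _ := by rw [one_div, Real.inv_rpow (by norm_num), Real.rpow_neg (by norm_num), inv_inv]
    have k3 := abs_exp_sub_exp_le (Real.log q * -ω) 0
    rw [← Real.rpow_def_of_pos hq0, Real.exp_zero, sub_zero, abs_mul, abs_neg,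
      abs_of_nonneg hω] at k3
    calc _ ≤ |Real.log q| * ω * (q ^ (-ω) + 1) := k3
      _ ≤ (24 * t / (1 / 2)) * ω * (2 ^ ω + 1) := by
          gcongr
          exact k1.trans (by gcongr)
      _ = _ := by ring
  rw [e1, show (1 + R) ^ (-ω) * q ^ (-ω) - (1 + R) ^ (-ω) = (1 + R) ^ (-ω) * (q ^ (-ω) - 1) by
    ring, abs_mul, abs_of_pos (Real.rpow_pos_of_pos hp _), mul_comm]
  gcongr

end

/-! ### Radial integrals -/

section Radial

variable {N : ℕ}

/-- The surface constant of the unit sphere. -/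
def sphereConst (N : ℕ) : ℝ := N * volume.real (Metric.ball (0 : Space N) 1)

theorem sphereConst_pos (hN : 1 ≤ N) : 0 < sphereConst N := by
  have : (0 : ℝ) < N := by exact_mod_cast hN
  exact mul_pos this (ENNReal.toReal_pos (Metric.measure_ball_pos _ _ one_pos).ne'
    measure_ball_lt_top.ne)

theorem nontrivial_space (hN : 1 ≤ N) : Nontrivial (Space N) := by
  have : Nonempty (Fin N) := ⟨⟨0, hN⟩⟩
  infer_instance

theorem integrable_radial (hN : 1 ≤ N) {G : ℝ → ℝ} (hG : Integrable G) (K : ℝ) :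
    Integrable fun v : Space N => (Iic K).indicator G ‖v‖ := by
  have := nontrivial_space hN
  rw [integrable_fun_norm_addHaar]
  rw [finrank_euclideanSpace, Fintype.card_fin]
  have h1 : Integrable ((Ioc 0 K).indicator G) := hG.indicator measurableSet_Ioc
  have h2 : Integrable fun y => (Ioc 0 K).indicator (fun y => y ^ (N - 1)) y *
      (Ioc 0 K).indicator G y := by
    refine h1.bdd_mul (c := |K| ^ (N - 1)) ?_ (Filter.Eventually.of_forall fun y => ?_)
    · exact ((measurable_id.pow_const (N - 1)).indicator
        (measurableSet_Ioc (a := (0 : ℝ)) (b := K))).aestronglyMeasurable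
    · by_cases hy : y ∈ Ioc 0 K
      · rw [indicator_of_mem hy, norm_pow, Real.norm_of_nonneg hy.1.le]
        gcongr
        · exact hy.1.le
        · exact hy.2.trans (le_abs_self K)
      · rw [indicator_of_notMem hy, norm_zero]
        positivity
  refine (h2.integrableOn (s := Ioi 0)).congr_fun (fun y hy => ?_) measurableSet_Ioi
  by_cases hK : y ≤ K
  · have : y ∈ Ioc 0 K := ⟨hy, hK⟩
    simp [indicator_of_mem this, hK]
  · simp [hK]

/-- The cut-off at `K` bounds the surface factor `s^{N-1}` by `K^{N-1}`, which reduces a velocity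
integral to one in the speed. -/
theorem integral_radial_le (hN : 1 ≤ N) {G : ℝ → ℝ} (hG : Integrable G) (h0 : ∀ s, 0 ≤ G s)
    {K : ℝ} (hK : 0 ≤ K) :
    ∫ v : Space N, (Iic K).indicator G ‖v‖ ≤ sphereConst N * K ^ (N - 1) * ∫ s, G s := by
  have := nontrivial_space hN
  have hi := integrable_radial hN hG K
  rw [integrable_fun_norm_addHaar] at hi
  rw [integral_fun_norm_addHaar, finrank_euclideanSpace, Fintype.card_fin] at *
  rw [nsmul_eq_mul, smul_eq_mul, sphereConst, mul_assoc, mul_assoc]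
  gcongr
  calc _ ≤ ∫ y in Ioi (0 : ℝ), K ^ (N - 1) * G y := by
        refine setIntegral_mono_on hi ((hG.const_mul _).integrableOn) measurableSet_Ioi
          fun y hy => ?_
        by_cases hyK : y ≤ K
        · simp only [mem_Iic, hyK, indicator_of_mem, smul_eq_mul]
          have := h0 y
          have : (0 : ℝ) ≤ y := le_of_lt hy
          gcongr
        · simp only [mem_Iic, hyK, not_false_eq_true, indicator_of_notMem, smul_zero]
          exact mul_nonneg (by positivity) (h0 y)
    _ ≤ ∫ y, K ^ (N - 1) * G y := setIntegral_le_integral (hG.const_mul _)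
        (Filter.Eventually.of_forall fun y => mul_nonneg (by positivity) (h0 y))
    _ = _ := integral_const_mul _ _

/-- The shell `L ≤ |v| ≤ L + h` has volume at least the area of its inner sphere times `h`. -/
theorem le_integral_radial (hN : 1 ≤ N) {g : Space N → ℝ} (hg : Integrable g)
    (h0 : ∀ v, 0 ≤ g v) {L h m : ℝ} (hL : 0 < L) (hh : 0 ≤ h) (hm : 0 ≤ m)
    (hgm : ∀ v : Space N, ‖v‖ ∈ Icc L (L + h) → m ≤ g v) :
    m * (sphereConst N * L ^ (N - 1) * h) ≤ ∫ v, g v := by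
  have := nontrivial_space hN
  have hint : Integrable ((Icc L (L + h)).indicator fun _ : ℝ => (1 : ℝ)) :=
    (integrable_indicator_iff measurableSet_Icc).2 (by simp)
  have key : sphereConst N * L ^ (N - 1) * h ≤
      ∫ v : Space N, (Icc L (L + h)).indicator (fun _ => (1 : ℝ)) ‖v‖ := by
    rw [integral_fun_norm_addHaar volume ((Icc L (L + h)).indicator fun _ => (1 : ℝ)),
      finrank_euclideanSpace, Fintype.card_fin, nsmul_eq_mul, smul_eq_mul, sphereConst,
      mul_assoc, mul_assoc]
    gcongr
    have hsub : Icc L (L + h) ⊆ Ioi 0 := fun y hy => hL.trans_le hy.1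
    have e : ∫ y in Ioi (0 : ℝ), y ^ (N - 1) • (Icc L (L + h)).indicator (fun _ => (1 : ℝ)) y =
        ∫ y in Icc L (L + h), y ^ (N - 1) := by
      rw [← integral_indicator measurableSet_Ioi, ← integral_indicator measurableSet_Icc]
      congr 1
      funext y
      by_cases hy : y ∈ Icc L (L + h)
      · rw [indicator_of_mem (hsub hy), indicator_of_mem hy, indicator_of_mem hy]
        simp
      · rw [indicator_of_notMem hy]
        by_cases hy0 : y ∈ Ioi (0 : ℝ)
        · rw [indicator_of_mem hy0, indicator_of_notMem hy, smul_zero]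
        · rw [indicator_of_notMem hy0]
    rw [e]
    calc L ^ (N - 1) * h = ∫ _ in Icc L (L + h), L ^ (N - 1) := by
          rw [setIntegral_const, measureReal_def, Real.volume_Icc, smul_eq_mul,
            add_sub_cancel_left, ENNReal.toReal_ofReal hh, mul_comm]
      _ ≤ _ := by
          refine setIntegral_mono_on (by simp) ?_ measurableSet_Icc fun y hy => ?_
          · exact (continuous_pow (N - 1)).integrableOn_Icc
          · have := hy.1
            gcongr
  have hle : ∫ v : Space N, m * (Icc L (L + h)).indicator (fun _ => (1 : ℝ)) ‖v‖ ≤ ∫ v, g v := by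
    refine integral_mono_of_nonneg (Filter.Eventually.of_forall fun v => ?_) hg
      (Filter.Eventually.of_forall fun v => ?_)
    · exact mul_nonneg hm (indicator_nonneg (fun _ _ => zero_le_one) _)
    · by_cases hv : ‖v‖ ∈ Icc L (L + h)
      · simpa [indicator_of_mem hv] using hgm v hv
      · simpa [indicator_of_notMem hv] using h0 v
  rw [integral_const_mul] at hle
  exact le_trans (by gcongr) hle

/-- The one-sided exponential tail. -/
def expTail (κ L h : ℝ) : ℝ → ℝ :=
  (Ioi (L - 2 * h)).indicator fun s => Real.exp (-κ * ((s - L) / h))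

theorem expTail_nonneg (κ L h s : ℝ) : 0 ≤ expTail κ L h s :=
  indicator_nonneg (fun _ _ => (Real.exp_pos _).le) _

theorem exp_tail_eq {κ L h s : ℝ} :
    Real.exp (-κ * ((s - L) / h)) = Real.exp (κ * L / h) * Real.exp (-κ / h * s) := by
  rw [← Real.exp_add]
  ring_nf

theorem integrable_expTail {κ L h : ℝ} (hκ : 0 < κ) (hh : 0 < h) : Integrable (expTail κ L h) := by
  rw [expTail, integrable_indicator_iff measurableSet_Ioi]
  simp_rw [exp_tail_eq]
  exact (integrableOn_exp_mul_Ioi (by rw [neg_div]; exact neg_neg_of_pos (by positivity))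
    _).const_mul _

theorem integral_expTail {κ L h : ℝ} (hκ : 0 < κ) (hh : 0 < h) :
    ∫ s, expTail κ L h s = Real.exp (2 * κ) / κ * h := by
  unfold expTail
  rw [integral_indicator measurableSet_Ioi]
  simp_rw [exp_tail_eq]
  have e : 2 * κ = κ * L / h + -κ / h * (L - 2 * h) := by field_simp; ring
  rw [integral_const_mul,
    integral_exp_mul_Ioi (by rw [neg_div]; exact neg_neg_of_pos (by positivity)), e, Real.exp_add]
  field_simp

/-- The indicator of the interval of radius `e` about `s₀`. -/
def bump (s₀ e : ℝ) : ℝ → ℝ := (Icc (s₀ - e) (s₀ + e)).indicator fun _ => 1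

theorem bump_nonneg (s₀ e s : ℝ) : 0 ≤ bump s₀ e s := indicator_nonneg (fun _ _ => zero_le_one) _

theorem integrable_bump (s₀ e : ℝ) : Integrable (bump s₀ e) :=
  (integrable_indicator_iff measurableSet_Icc).2 (by simp)

theorem integral_bump {s₀ e : ℝ} (he : 0 ≤ e) : ∫ s, bump s₀ e s = 2 * e := by
  unfold bump
  rw [integral_indicator measurableSet_Icc, setIntegral_const, measureReal_def, Real.volume_Icc,
    ENNReal.toReal_ofReal (by linarith), smul_eq_mul]
  ring

/-- The radial majorant of the variation of the datum under free transport. -/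
def edgeMajorant (κ L h r t e s : ℝ) : ℝ :=
  t * expTail κ L h s + bump r e s + bump (2 * r + 10) (2 * e) s

theorem edgeMajorant_nonneg {κ L h r t e s : ℝ} (ht : 0 ≤ t) :
    0 ≤ edgeMajorant κ L h r t e s :=
  add_nonneg (add_nonneg (mul_nonneg ht (expTail_nonneg _ _ _ _)) (bump_nonneg _ _ _))
    (bump_nonneg _ _ _)

theorem integrable_edgeMajorant {κ L h r t e : ℝ} (hκ : 0 < κ) (hh : 0 < h) :
    Integrable (edgeMajorant κ L h r t e) :=
  (((integrable_expTail hκ hh).const_mul t).add (integrable_bump r e)).add (integrable_bump _ _)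

theorem integral_edgeMajorant {κ L h r t e : ℝ} (hκ : 0 < κ) (hh : 0 < h) (he : 0 ≤ e) :
    ∫ s, edgeMajorant κ L h r t e s = t * (Real.exp (2 * κ) / κ * h) + 6 * e := by
  have i1 := (integrable_expTail (L := L) hκ hh).const_mul t
  have i2 := integrable_bump r e
  have i12 : Integrable fun s => t * expTail κ L h s + bump r e s := i1.add i2
  unfold edgeMajorant
  rw [integral_add i12 (integrable_bump _ _), integral_add i1 i2, integral_const_mul,
    integral_expTail hκ hh, integral_bump he, integral_bump (by linarith)]
  ring

end Radial

/-! ### Variation of the datum under free transport -/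

section Variation

variable {α β δ ω c : ℝ}

theorem radialDatum_eq_zero {R s : ℝ} (h : ¬ (cbrt R ≤ s ∧ s ≤ 2 * cbrt R + 10)) :
    radialDatum α β δ ω c R s = 0 := by
  unfold radialDatum
  rw [if_neg h]

theorem radialDatum_eq {R s : ℝ} (h : cbrt R ≤ s ∧ s ≤ 2 * cbrt R + 10) :
    radialDatum α β δ ω c R s = c * (1 + R) ^ (-ω) * decay α β δ s := by
  unfold radialDatum
  rw [if_pos h]

theorem radialDatum_le_expTail (hα : 0 < α) (hβ : 0 < β) (hβ2 : β ≤ 2) (hδ : 0 ≤ δ)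
    (hc : 0 ≤ c) {R s : ℝ} (hR : 0 ≤ R) (hs : 0 ≤ s) :
    radialDatum α β δ ω c R s ≤ c * (1 + R) ^ (-ω) * (16 ^ δ * Real.exp (5 / 2 * α)) *
      edgeDecay α β δ (width R) *
      (Iic (24 * width R)).indicator
        (expTail (α * β / 24) (width R) (width R ^ (1 - β))) s := by
  have hL1 := one_le_width hR
  have hL := width_pos hR
  have he := (edgeDecay_pos (α := α) (β := β) (δ := δ) hL).le
  by_cases h : cbrt R ≤ s ∧ s ≤ 2 * cbrt R + 10
  · have h12 := le_width_of_mem hR h.2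
    have hw := width_sub_cbrt_le hR
    have hh := Real.rpow_pos_of_pos hL (1 - β)
    have hi := inv_le_rpow_one_sub hL1 hβ2
    have hi2 : 1 / width R ^ 2 ≤ 1 / width R := by gcongr; nlinarith
    have hmem : s ∈ Iic (24 * width R) := by
      rw [mem_Iic]; linarith
    have hmem2 : s ∈ Ioi (width R - 2 * width R ^ (1 - β)) := by
      rw [mem_Ioi]; linarith [h.1]
    rw [radialDatum_eq h, indicator_of_mem hmem, expTail, indicator_of_mem hmem2]
    calc _ ≤ c * (1 + R) ^ (-ω) * (16 ^ δ * Real.exp (5 / 2 * α) * edgeDecay α β δ (width R) *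
          Real.exp (-(α * β / 24) * ((s - width R) / width R ^ (1 - β)))) := by
          gcongr
          exact decay_le hα hβ hβ2 hδ hL1 hs (by linarith [h.1]) hmem
      _ = _ := by ring
  · rw [radialDatum_eq_zero h]
    have := indicator_nonneg (s := Iic (24 * width R)) (fun y _ =>
      expTail_nonneg (α * β / 24) (width R) (width R ^ (1 - β)) y) s
    positivity

/-- A speed in exactly one of the two windows lies between the old and new position of an edge. The
inner edge `r` moves by at most `e`, the outer edge `2r + 10` by at most `2e`. -/
theorem mem_edges {r r' s e : ℝ} (h : |r' - r| ≤ e)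
    (h1 : (r ≤ s ∧ s ≤ 2 * r + 10) ∧ ¬ (r' ≤ s ∧ s ≤ 2 * r' + 10) ∨
      ¬ (r ≤ s ∧ s ≤ 2 * r + 10) ∧ (r' ≤ s ∧ s ≤ 2 * r' + 10)) :
    r - e ≤ s ∧ (s ∈ Icc (r - e) (r + e) ∨ s ∈ Icc (2 * r + 10 - 2 * e) (2 * r + 10 + 2 * e)) := by
  rw [abs_le] at h
  simp only [mem_Icc]
  rcases h1 with ⟨⟨a, b⟩, h2⟩ | ⟨h2, ⟨a, b⟩⟩ <;> rw [not_and_or, not_le, not_le] at h2 <;>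
    refine ⟨by linarith, ?_⟩ <;> rcases h2 with h2 | h2
  · left; constructor <;> linarith
  · right; constructor <;> linarith
  · left; constructor <;> linarith
  · right; constructor <;> linarith

/-- The variation of the datum is concentrated at the edges of its support, up to a small
relative change. -/
theorem exists_radialDatum_variation (hα : 0 < α) (hβ : 0 < β) (hβ2 : β ≤ 2) (hδ : 0 ≤ δ)
    (hω : 0 ≤ ω) (hc : 0 ≤ c) :
    ∃ C > 0, ∀ R R' s t : ℝ, 0 ≤ R → 0 ≤ R' → 0 ≤ s → 0 ≤ t → t ≤ 1 / 48 →
      96 * t ^ (1 / 4 : ℝ) ≤ 1 / 4 → |R' - R| ≤ t * s →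
      |radialDatum α β δ ω c R' s - radialDatum α β δ ω c R s| ≤
        C * (c * (1 + R) ^ (-ω) * edgeDecay α β δ (width R)) *
        (Iic (24 * width R)).indicator (edgeMajorant (α * β / 24) (width R)
          (width R ^ (1 - β)) (cbrt R) t
          (96 * t ^ (1 / 4 : ℝ) * width R ^ (1 - β))) s := by
  set U : ℝ := 16 ^ δ * Real.exp (5 / 2 * α) with hU
  have hU0 : 0 < U := by positivity
  set P : ℝ := 48 * ω * (2 ^ ω + 1) with hP
  have hP0 : 0 ≤ P := by positivity
  set κ : ℝ := α * β / 24 with hκ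
  have hκ0 : 0 < κ := by positivity
  set E : ℝ := (1 + P) * Real.exp (5 / 4 * κ) with hE
  refine ⟨U * (P + E), by positivity, ?_⟩
  intro R R' s t hR hR' hs ht0 ht ht4 hd
  have hL1 := one_le_width hR
  have hL := width_pos hR
  have hw := width_sub_cbrt_le hR
  have hi := inv_le_rpow_one_sub hL1 hβ2
  have hi2 : 1 / width R ^ 2 ≤ 1 / width R := by gcongr; nlinarith
  have hh := Real.rpow_pos_of_pos hL (1 - β)
  have hhL := rpow_one_sub_le hL1 hβ
  have hed := edgeDecay_pos (α := α) (β := β) (δ := δ) hL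
  have hρ0 : 0 < (1 + R) ^ (-ω) := Real.rpow_pos_of_pos (by linarith) _
  set L := width R
  set h := L ^ (1 - β)
  set r := cbrt R
  set e := 96 * t ^ (1 / 4 : ℝ) * h
  have he4 : e ≤ h / 4 := by
    have := mul_le_mul_of_nonneg_right ht4 hh.le
    linarith
  have he0 : 0 ≤ e := by positivity
  -- At the edges the variation is as large as the datum itself. The majorant only has to be at
  -- least 1 there, and smallness comes from the length of the bumps upon integration.
  have edge_case : ∀ X, s ∈ Iic (24 * L) →
      X ≤ c * ((1 + P) * (1 + R) ^ (-ω)) * decay α β δ s → (r - e ≤ s ∧ (s ∈ Icc (r - e) (r + e) ∨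
        s ∈ Icc (2 * r + 10 - 2 * e) (2 * r + 10 + 2 * e))) →
      X ≤ U * (P + E) * (c * (1 + R) ^ (-ω) * edgeDecay α β δ L) *
        (Iic (24 * L)).indicator (edgeMajorant κ L h r t e) s := by
    intro X hs24 hX hm
    have hdec := decay_le hα hβ hβ2 hδ hL1 hs (by linarith [hm.1]) hs24
    have hmaj : 1 ≤ edgeMajorant κ L h r t e s := by
      have h0 := mul_nonneg ht0 (expTail_nonneg κ L h s)
      have h1 := bump_nonneg r e s
      have h2 := bump_nonneg (2 * r + 10) (2 * e) s
      unfold edgeMajorant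
      rcases hm.2 with h3 | h3
      · have h4 : bump r e s = 1 := indicator_of_mem h3 _
        linarith
      · have h4 : bump (2 * r + 10) (2 * e) s = 1 := indicator_of_mem h3 _
        linarith
    have hexp : Real.exp (-κ * ((s - L) / h)) ≤ Real.exp (5 / 4 * κ) := by
      have h1 : -(5 / 4) ≤ (s - L) / h := by
        rw [le_div_iff₀ hh]
        linarith [hm.1]
      have h2 := mul_le_mul_of_nonneg_left h1 hκ0.le
      exact Real.exp_le_exp.2 (by linarith)
    rw [indicator_of_mem hs24]
    calc X ≤ c * ((1 + P) * (1 + R) ^ (-ω)) *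
          (U * edgeDecay α β δ L * Real.exp (5 / 4 * κ)) := by
          refine hX.trans ?_
          gcongr
          exact hdec.trans (by gcongr)
      _ = U * E * (c * (1 + R) ^ (-ω) * edgeDecay α β δ L) * 1 := by rw [hE]; ring
      _ ≤ _ := by
        gcongr
        linarith
  by_cases hon' : cbrt R' ≤ s ∧ s ≤ 2 * cbrt R' + 10
  swap
  · by_cases hon : r ≤ s ∧ s ≤ 2 * r + 10
    swap
    · rw [radialDatum_eq_zero hon', radialDatum_eq_zero hon, sub_self, abs_zero]
      exact mul_nonneg (by positivity) (indicator_nonneg (fun _ _ => edgeMajorant_nonneg ht0) _)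
    · have hs12 : s ≤ 12 * L := le_width_of_mem hR hon.2
      have hs24 : s ∈ Iic (24 * L) := by rw [mem_Iic]; linarith
      have hdL : |R' - R| ≤ t * (24 * L) := hd.trans (by gcongr; exact hs24)
      have hΔ := abs_cbrt_sub_le hR hR' ht0 (by linarith) hβ2 hdL
      refine edge_case _ hs24 ?_ (mem_edges hΔ (Or.inl ⟨hon, hon'⟩))
      rw [radialDatum_eq_zero hon', zero_sub, abs_neg,
        abs_of_nonneg (radialDatum_nonneg hc hR), radialDatum_eq hon]
      have := (decay_pos α β δ s).le
      have : (1 + R) ^ (-ω) ≤ (1 + P) * (1 + R) ^ (-ω) := by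
        have := mul_nonneg hP0 hρ0.le
        linarith
      gcongr
  -- If only the displaced point is known to carry mass at speed `s`, comparability of the widths is
  -- what bounds `s` by `24 L`.
  · have hLL : width R' ≤ 2 * L :=
      width_le_two_mul hR hR' ht0 ht (by linarith [(abs_le.1 hd).2]) hon'.2
    have hs24 : s ∈ Iic (24 * L) := by
      rw [mem_Iic]; linarith [le_width_of_mem hR' hon'.2]
    have hdL : |R' - R| ≤ t * (24 * L) := hd.trans (by gcongr; exact hs24)
    have hΔ := abs_cbrt_sub_le hR hR' ht0 (by linarith) hβ2 hdL
    have hρ := abs_rpow_neg_sub_le hR hω ht hR' hdL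
    by_cases hon : r ≤ s ∧ s ≤ 2 * r + 10
    swap
    · refine edge_case _ hs24 ?_ (mem_edges hΔ (Or.inr ⟨hon, hon'⟩))
      rw [radialDatum_eq_zero hon, sub_zero, abs_of_nonneg (radialDatum_nonneg hc hR'),
        radialDatum_eq hon']
      have := (decay_pos α β δ s).le
      have : (1 + R') ^ (-ω) ≤ (1 + P) * (1 + R) ^ (-ω) := by
        have h1 := (abs_le.1 hρ).2
        have h2 : P * t * (1 + R) ^ (-ω) ≤ P * 1 * (1 + R) ^ (-ω) := by gcongr; linarith
        linarith
      gcongr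
    -- With `s` in both windows the velocity decay is the same on both sides. Only the spatial
    -- factor changes, and it yields the factor `t`.
    · have hmem2 : s ∈ Ioi (L - 2 * h) := by
        rw [mem_Ioi]; linarith [hon.1]
      have hdec := decay_le hα hβ hβ2 hδ hL1 hs (by linarith [hon.1]) hs24
      rw [radialDatum_eq hon, radialDatum_eq hon', indicator_of_mem hs24]
      have hmaj : t * Real.exp (-κ * ((s - L) / h)) ≤ edgeMajorant κ L h r t e s := by
        have h1 := bump_nonneg r e s
        have h2 := bump_nonneg (2 * r + 10) (2 * e) s
        have h3 : expTail κ L h s = Real.exp (-κ * ((s - L) / h)) := indicator_of_mem hmem2 _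
        unfold edgeMajorant
        rw [h3]
        linarith
      have hdp := (decay_pos α β δ s).le
      calc |c * (1 + R') ^ (-ω) * decay α β δ s - c * (1 + R) ^ (-ω) * decay α β δ s|
          = c * decay α β δ s * |(1 + R') ^ (-ω) - (1 + R) ^ (-ω)| := by
            rw [← sub_mul, ← mul_sub, abs_mul, abs_mul, abs_of_nonneg hc, abs_of_nonneg hdp]
            ring
        _ ≤ c * (U * edgeDecay α β δ L * Real.exp (-κ * ((s - L) / h))) *
              (P * t * (1 + R) ^ (-ω)) := by gcongr
        _ = U * P * (c * (1 + R) ^ (-ω) * edgeDecay α β δ L) *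
              (t * Real.exp (-κ * ((s - L) / h))) := by ring
        _ ≤ U * (P + E) * (c * (1 + R) ^ (-ω) * edgeDecay α β δ L) *
              edgeMajorant κ L h r t e s := by
            gcongr
            have : 0 ≤ E := by positivity
            linarith

end Variation

/-! ### The truncated datum is centred with comparable, slowly varying moments -/

section

variable {N : ℕ} {α β δ ω c : ℝ}

/-- Bookkeeping of exponents: `(1+R)^{-ω} = L^{-3ω}`, the edge value `L^{-2δ} e^{-αL^β}` and the
shell volume `L^{N-1} L^{1-β}` combine to the amplitude with `m = 3ω + 2δ + β`, times `L^N`. -/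
theorem amplitude_mul_width (hN : 1 ≤ N) {R : ℝ} (hR : 0 ≤ R) :
    (1 + R) ^ (-ω) * edgeDecay α β δ (width R) * (width R ^ (N - 1) * width R ^ (1 - β)) =
      amplitude α β (3 * ω + 2 * δ + β) (width R) * width R ^ N := by
  have hL := width_pos hR
  obtain ⟨n, rfl⟩ : ∃ n, N = n + 1 := ⟨N - 1, by omega⟩
  rw [← width_rpow hR, edgeDecay, amplitude, Nat.add_sub_cancel, ← Real.rpow_natCast,
    ← Real.rpow_natCast]
  have : width R ^ (3 * -ω) * (width R ^ (-(2 * δ)) * Real.exp (-α * width R ^ β)) *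
      (width R ^ (n : ℝ) * width R ^ (1 - β)) = width R ^ (3 * -ω) * width R ^ (-(2 * δ)) *
      width R ^ (n : ℝ) * width R ^ (1 - β) * Real.exp (-α * width R ^ β) := by ring
  rw [this, ← Real.rpow_add hL, ← Real.rpow_add hL, ← Real.rpow_add hL, mul_right_comm,
    ← Real.rpow_add hL]
  congr 2
  push_cast
  ring

theorem measurable_radialDatum :
    Measurable fun p : ℝ × ℝ => radialDatum α β δ ω c p.1 p.2 := by
  unfold radialDatum cbrt decay
  refine Measurable.ite ?_ (by fun_prop) measurable_const
  exact (measurableSet_le (f := fun p : ℝ × ℝ => p.1 ^ (1 / 3 : ℝ)) (by fun_prop)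
    measurable_snd).inter (measurableSet_le measurable_snd (by fun_prop))

theorem measurable_truncatedDatum (N : ℕ) :
    Measurable fun z : Space N × Space N => truncatedDatum α β (1 / 3) δ ω c z.1 z.2 := by
  simp_rw [truncatedDatum_eq]
  exact measurable_radialDatum.comp
    (by fun_prop : Measurable fun z : Space N × Space N => (‖z.1‖, ‖z.2‖))

theorem truncatedDatum_nonneg (hc : 0 ≤ c) (x v : Space N) :
    0 ≤ truncatedDatum α β (1 / 3) δ ω c x v := by
  rw [truncatedDatum_eq]
  exact radialDatum_nonneg hc (norm_nonneg x)

/-- Integrability of a bounded measurable function supported in a ball, with weight. -/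
theorem integrable_weighted_of_bounded {g : Space N → ℝ} (hg : Measurable g) {B K : ℝ}
    (hB : ∀ v, |g v| ≤ B) (hK : ∀ v, K < ‖v‖ → g v = 0) :
    Integrable fun v : Space N => (1 + ‖v‖ ^ 2) * g v := by
  have hB0 : 0 ≤ B := (abs_nonneg _).trans (hB 0)
  have h1 : Integrable ((Metric.closedBall (0 : Space N) K).indicator
      fun _ => (1 + K ^ 2) * B) :=
    (integrable_indicator_iff Metric.isClosed_closedBall.measurableSet).2
      (integrableOn_const measure_closedBall_lt_top.ne)
  refine h1.mono' (by fun_prop) (Filter.Eventually.of_forall fun v => ?_)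
  by_cases hv : ‖v‖ ≤ K
  · rw [indicator_of_mem (by simpa using hv), norm_mul, Real.norm_of_nonneg (by positivity),
      Real.norm_eq_abs]
    have := hB v
    gcongr
  · rw [indicator_of_notMem (by simpa using hv), hK v (not_le.1 hv)]
    simp

/-- For short times the transported slice is bounded with compact support in `v`, since the width at
`x - tv` is at most twice the width at `x` where it does not vanish. -/
theorem integrable_transported_datum (hα : 0 < α) (hδ : 0 ≤ δ) (hω : 0 ≤ ω) (hc : 0 ≤ c)
    {t : ℝ} (ht0 : 0 ≤ t) (ht : t ≤ 1 / 48) (x : Space N) :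
    Integrable fun v : Space N =>
      (1 + ‖v‖ ^ 2) * truncatedDatum α β (1 / 3) δ ω c (x - t • v) v := by
  refine integrable_weighted_of_bounded
    (g := fun v => truncatedDatum α β (1 / 3) δ ω c (x - t • v) v)
    (B := c) (K := 24 * width ‖x‖) ?_ (fun v => ?_) (fun v hv => ?_)
  · have hm : Measurable fun v : Space N => (x - t • v, v) := by fun_prop
    have := (measurable_truncatedDatum (α := α) (β := β) (δ := δ) (ω := ω) (c := c) N).comp hm
    exact this
  · rw [abs_of_nonneg (truncatedDatum_nonneg hc _ _), truncatedDatum_eq]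
    exact radialDatum_le hα.le hδ hω hc (norm_nonneg _) (norm_nonneg _)
  · rw [truncatedDatum_eq]
    refine radialDatum_eq_zero fun h => ?_
    have h1 := le_width_of_mem (norm_nonneg _) h.2
    have h2 := width_le_two_mul (norm_nonneg x) (norm_nonneg _) ht0 ht
      (norm_sub_smul_le x v ht0) h.2
    linarith

theorem momentum_truncatedDatum (x : Space N) :
    momentum (truncatedDatum α β (1 / 3) δ ω c x) = 0 := by
  have h := integral_neg_eq_self (fun v : Space N => truncatedDatum α β (1 / 3) δ ω c x v • v)
    volume
  simp only [truncatedDatum_eq, norm_neg, smul_neg, integral_neg] at h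
  unfold momentum
  simp only [truncatedDatum_eq]
  have h2 : (2 : ℝ) • ∫ v : Space N, radialDatum α β δ ω c ‖x‖ ‖v‖ • v = 0 := by
    rw [two_smul]
    nth_rewrite 1 [← h]
    exact neg_add_cancel _
  exact (smul_eq_zero.1 h2).resolve_left two_ne_zero

theorem exists_density_le (hN : 1 ≤ N) (hα : 0 < α) (hβ : 0 < β) (hβ2 : β ≤ 2)
    (hδ : 0 ≤ δ) (hc : 0 < c) :
    ∃ C > 0, ∀ x : Space N, density (truncatedDatum α β (1 / 3) δ ω c x) ≤
      C * (amplitude α β (3 * ω + 2 * δ + β) (width ‖x‖) * width ‖x‖ ^ N) := by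
  set κ := α * β / 24 with hκ
  have hκ0 : 0 < κ := by positivity
  set U : ℝ := 16 ^ δ * Real.exp (5 / 2 * α) with hU
  have hS := sphereConst_pos hN
  refine ⟨c * U * sphereConst N * 24 ^ (N - 1) * (Real.exp (2 * κ) / κ), by positivity, ?_⟩
  intro x
  have hL := width_pos (norm_nonneg x)
  have hh := Real.rpow_pos_of_pos hL (1 - β)
  set L := width ‖x‖
  have hρ0 : 0 < (1 + ‖x‖) ^ (-ω) := Real.rpow_pos_of_pos (by positivity) _
  have hed := edgeDecay_pos (α := α) (β := β) (δ := δ) hL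
  have hint := integrable_expTail (L := L) hκ0 hh
  calc density (truncatedDatum α β (1 / 3) δ ω c x)
      ≤ ∫ v : Space N, c * (1 + ‖x‖) ^ (-ω) * U * edgeDecay α β δ L *
          (Iic (24 * L)).indicator (expTail κ L (L ^ (1 - β))) ‖v‖ := by
        refine integral_mono_of_nonneg
          (Filter.Eventually.of_forall fun v => truncatedDatum_nonneg hc.le x v)
          ((integrable_radial hN hint _).const_mul _) (Filter.Eventually.of_forall fun v => ?_)
        change truncatedDatum α β (1 / 3) δ ω c x v ≤ _
        rw [truncatedDatum_eq]
        exact radialDatum_le_expTail hα hβ hβ2 hδ hc.le (norm_nonneg x) (norm_nonneg v)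
    _ ≤ c * (1 + ‖x‖) ^ (-ω) * U * edgeDecay α β δ L *
          (sphereConst N * (24 * L) ^ (N - 1) * (Real.exp (2 * κ) / κ * L ^ (1 - β))) := by
        rw [integral_const_mul, ← integral_expTail (L := L) hκ0 hh]
        gcongr
        exact integral_radial_le hN hint (fun s => expTail_nonneg _ _ _ s) (by positivity)
    _ = _ := by
        rw [← amplitude_mul_width hN (norm_nonneg x), mul_pow]
        ring

/-- The layer `L ≤ |v| ≤ L + L^{1-β}` lies in the support, because `L + L^{1-β} ≤ 2L ≤ 2r + 2` for
the cube root `r`; this uses the constant `+10`. The weight `w` will be `1` for the density and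
`|v|²` for the energy. -/
theorem le_integral_datum (hN : 1 ≤ N) (hα : 0 < α) (hβ : 0 < β) (hβ2 : β ≤ 2)
    (hδ : 0 ≤ δ) (hc : 0 < c) (x : Space N) {w : Space N → ℝ} {m : ℝ} (hm : 0 ≤ m)
    (hw0 : ∀ v, 0 ≤ w v) (hwm : ∀ v, width ‖x‖ ≤ ‖v‖ → m ≤ w v)
    (hi : Integrable fun v => w v * truncatedDatum α β (1 / 3) δ ω c x v) :
    m * (c * (5 ^ (-δ) * Real.exp (-3 * α)) * sphereConst N *
      (amplitude α β (3 * ω + 2 * δ + β) (width ‖x‖) * width ‖x‖ ^ N)) ≤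
      ∫ v, w v * truncatedDatum α β (1 / 3) δ ω c x v := by
  have hL1 := one_le_width (norm_nonneg x)
  have hL := width_pos (norm_nonneg x)
  have hh := Real.rpow_pos_of_pos hL (1 - β)
  have hhL := rpow_one_sub_le hL1 hβ
  have hrL := cbrt_le_width (norm_nonneg x)
  have hLr := width_sub_cbrt_le (norm_nonneg x)
  have hi2 : 1 / width ‖x‖ ^ 2 ≤ 1 := by
    rw [div_le_one (by positivity)]
    nlinarith
  rw [← amplitude_mul_width hN (norm_nonneg x)]
  set L := width ‖x‖
  have hρ0 : 0 < (1 + ‖x‖) ^ (-ω) := Real.rpow_pos_of_pos (by positivity) _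
  have hed := edgeDecay_pos (α := α) (β := β) (δ := δ) hL
  refine le_trans (le_of_eq ?_) (le_integral_radial hN hi (L := L) (h := L ^ (1 - β))
    (m := m * (c * (1 + ‖x‖) ^ (-ω) * (5 ^ (-δ) * Real.exp (-3 * α) * edgeDecay α β δ L)))
    (fun v => mul_nonneg (hw0 v) (truncatedDatum_nonneg hc.le x v)) hL hh.le (by positivity) ?_)
  · ring
  · intro v hv
    have hd := le_decay hα hβ hβ2 hδ hL1 hv.1 hv.2
    rw [truncatedDatum_eq, radialDatum_eq ⟨by linarith [hv.1], by linarith [hv.2]⟩]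
    have := hw0 v
    gcongr
    exact hwm v hv.1

theorem exists_momentDist_le (hN : 1 ≤ N) (hα : 0 < α) (hβ : 0 < β) (hβ2 : β ≤ 2)
    (hδ : 0 ≤ δ) (hω : 0 ≤ ω) (hc : 0 < c) :
    ∃ K ≥ 0, ∀ t : ℝ, 0 ≤ t → t ≤ 1 / 48 → 96 * t ^ (1 / 4 : ℝ) ≤ 1 / 4 → ∀ x : Space N,
      momentDist (width ‖x‖) (fun v => truncatedDatum α β (1 / 3) δ ω c (x - t • v) v)
        (truncatedDatum α β (1 / 3) δ ω c x) ≤ K * t ^ (1 / 4 : ℝ) *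
        (amplitude α β (3 * ω + 2 * δ + β) (width ‖x‖) * width ‖x‖ ^ N) := by
  obtain ⟨C, hC, h⟩ := exists_radialDatum_variation hα hβ hβ2 hδ hω hc.le
  set κ := α * β / 24 with hκ
  have hκ0 : 0 < κ := by positivity
  have hS := sphereConst_pos hN
  -- `577 = 1 + 24²` bounds the moment weight on `|v| ≤ 24L`; `576 = 6 · 96` is the total length of
  -- the two bumps in units of `t^{1/4} L^{1-β}`.
  refine ⟨577 * C * c * sphereConst N * 24 ^ (N - 1) * (Real.exp (2 * κ) / κ + 576),
    by positivity, ?_⟩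
  intro t ht0 ht ht4 x
  have hL := width_pos (norm_nonneg x)
  have hh := Real.rpow_pos_of_pos hL (1 - β)
  have hρ0 : 0 < (1 + ‖x‖) ^ (-ω) := Real.rpow_pos_of_pos (by positivity) _
  have hed := edgeDecay_pos (α := α) (β := β) (δ := δ) hL
  have hq := le_rpow_quarter ht0 (by linarith)
  have hq0 : 0 ≤ t ^ (1 / 4 : ℝ) := Real.rpow_nonneg ht0 _
  have h := fun v : Space N => h ‖x‖ ‖x - t • v‖ ‖v‖ t (norm_nonneg x) (norm_nonneg _)
    (norm_nonneg v) ht0 ht ht4 (abs_le.2 ⟨by linarith [norm_le_sub_smul x v ht0],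
      by linarith [norm_sub_smul_le x v ht0]⟩)
  rw [← amplitude_mul_width hN (norm_nonneg x)]
  set L := width ‖x‖
  set e := 96 * t ^ (1 / 4 : ℝ) * L ^ (1 - β) with he
  have he0 : 0 ≤ e := by positivity
  have hint := integrable_edgeMajorant (L := L) (r := cbrt ‖x‖) (t := t) (e := e) hκ0 hh
  calc momentDist L (fun v => truncatedDatum α β (1 / 3) δ ω c (x - t • v) v)
        (truncatedDatum α β (1 / 3) δ ω c x)
      ≤ ∫ v : Space N, 577 * (C * (c * (1 + ‖x‖) ^ (-ω) * edgeDecay α β δ L)) *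
          (Iic (24 * L)).indicator (edgeMajorant κ L (L ^ (1 - β)) (cbrt ‖x‖) t e) ‖v‖ := by
        refine integral_mono_of_nonneg (Filter.Eventually.of_forall fun v => by positivity)
          ((integrable_radial hN hint _).const_mul _) (Filter.Eventually.of_forall fun v => ?_)
        have hv := h v
        simp only [truncatedDatum_eq]
        by_cases hv24 : ‖v‖ ∈ Iic (24 * L)
        · have h1 : 1 + (‖v‖ / L) ^ 2 ≤ 577 := by
            have h2 : ‖v‖ / L ≤ 24 := (div_le_iff₀ hL).2 hv24
            have h3 : 0 ≤ ‖v‖ / L := by positivity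
            nlinarith
          rw [mul_assoc]
          gcongr
        · rw [indicator_of_notMem hv24, mul_zero] at hv ⊢
          rw [abs_nonpos_iff.1 hv, abs_zero, mul_zero]
    _ ≤ 577 * (C * (c * (1 + ‖x‖) ^ (-ω) * edgeDecay α β δ L)) *
          (sphereConst N * (24 * L) ^ (N - 1) *
            (t * (Real.exp (2 * κ) / κ * L ^ (1 - β)) + 6 * e)) := by
        rw [integral_const_mul, ← integral_edgeMajorant (L := L) (r := cbrt ‖x‖) hκ0 hh he0]
        gcongr
        exact integral_radial_le hN hint (fun s => edgeMajorant_nonneg ht0) (by positivity)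
    _ ≤ 577 * (C * (c * (1 + ‖x‖) ^ (-ω) * edgeDecay α β δ L)) *
          (sphereConst N * (24 * L) ^ (N - 1) *
            (t ^ (1 / 4 : ℝ) * (Real.exp (2 * κ) / κ * L ^ (1 - β)) + 6 * e)) := by
        gcongr
    _ = _ := by
        rw [he, mul_pow]
        ring

/-- The truncated datum is centred, with fields comparable with the cubic profile. -/
theorem exists_centredDatum (hN : 1 ≤ N) (hα : 0 < α) (hβ : 0 < β) (hβ2 : β ≤ 2)
    (hδ : 0 ≤ δ) (hω : 0 ≤ ω) (hc : 0 < c) (hm : 0 ≤ 3 * ω + 2 * δ + β) :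
    ∃ a > 0, a ≤ 1 ∧ ∃ K ≥ 0, ∃ τ₀ > 0, (cubeProfile N hα hβ hβ2 hm).CentredDatum
      (truncatedDatum α β (1 / 3) δ ω c) a K τ₀ := by
  obtain ⟨C, hC, hup⟩ := exists_density_le (N := N) (ω := ω) hN hα hβ hβ2 hδ hc
  obtain ⟨K, hK, hdist⟩ := exists_momentDist_le (N := N) hN hα hβ hβ2 hδ hω hc
  have hS := sphereConst_pos hN
  set u : ℝ := c * (5 ^ (-δ) * Real.exp (-3 * α)) * sphereConst N with hu
  have hu0 : 0 < u := by positivity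
  have htime : ∀ t ∈ Icc (0 : ℝ) ((1 / 384) ^ 4),
      t ≤ 1 / 48 ∧ 96 * t ^ (1 / 4 : ℝ) ≤ 1 / 4 := by
    intro t ht
    refine ⟨ht.2.trans (by norm_num), ?_⟩
    have : t ^ (1 / 4 : ℝ) ≤ ((1 / 384 : ℝ) ^ 4) ^ (1 / 4 : ℝ) :=
      Real.rpow_le_rpow ht.1 ht.2 (by norm_num)
    rw [← Real.rpow_natCast, ← Real.rpow_mul (by norm_num)] at this
    norm_num at this
    linarith
  have int0 : ∀ x : Space N, Integrable fun v : Space N =>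
      (1 + ‖v‖ ^ 2) * truncatedDatum α β (1 / 3) δ ω c x v := fun x => by
    simpa using integrable_transported_datum (β := β) hα hδ hω hc.le le_rfl (by norm_num) x
  -- `u` bounds density and energy from below. `144 = 12²` comes from `|v| ≤ 12 L` on the support
  -- and bounds the energy by the density.
  set a := min 1 (min u (1 / (144 * C))) with ha
  have ha0 : 0 < a := by positivity
  have hau : a ≤ u := (min_le_right _ _).trans (min_le_left _ _)
  have haC : a ≤ 1 / (144 * C) := (min_le_right _ _).trans (min_le_right _ _)
  have hCa : 144 * C ≤ 1 / a := by
    rw [le_div_iff₀ (by positivity)] at haC ⊢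
    linarith
  refine ⟨a, ha0, min_le_left _ _, K, hK, (1 / 384) ^ 4, by positivity, ?_⟩
  refine ⟨measurable_truncatedDatum N, truncatedDatum_nonneg hc.le, fun t ht x => ?_,
    fun x => ?_, fun x => ?_, momentum_truncatedDatum, fun t ht x => ?_⟩
  · exact integrable_transported_datum hα hδ hω hc.le ht.1 (htime t ht).1 x
  · change _ ∈ Icc (a * (amplitude α β (3 * ω + 2 * δ + β) (width ‖x‖) * width ‖x‖ ^ N))
      (amplitude α β (3 * ω + 2 * δ + β) (width ‖x‖) * width ‖x‖ ^ N / a)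
    have hB : 0 < amplitude α β (3 * ω + 2 * δ + β) (width ‖x‖) * width ‖x‖ ^ N :=
      mul_pos (amplitude_pos (width_pos (norm_nonneg x)))
        (pow_pos (width_pos (norm_nonneg x)) _)
    constructor
    · have := le_integral_datum (ω := ω) hN hα hβ hβ2 hδ hc x (w := fun _ => 1) zero_le_one
        (fun _ => zero_le_one) (fun _ _ => le_rfl)
        (by simpa using integrable_of_weighted (int0 x))
      simp only [one_mul] at this
      exact le_trans (by gcongr) this
    · refine (hup x).trans ?_
      rw [← one_div_mul_eq_div]
      gcongr
      linarith
  · change _ ∈ Icc (a * (amplitude α β (3 * ω + 2 * δ + β) (width ‖x‖) * width ‖x‖ ^ N) *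
      width ‖x‖ ^ 2) (amplitude α β (3 * ω + 2 * δ + β) (width ‖x‖) * width ‖x‖ ^ N *
      width ‖x‖ ^ 2 / a)
    have hL := width_pos (norm_nonneg x)
    have hB : 0 < amplitude α β (3 * ω + 2 * δ + β) (width ‖x‖) * width ‖x‖ ^ N :=
      mul_pos (amplitude_pos hL) (pow_pos hL _)
    constructor
    · have := le_integral_datum (ω := ω) hN hα hβ hβ2 hδ hc x (w := fun v => ‖v‖ ^ 2)
        (m := width ‖x‖ ^ 2) (by positivity) (fun _ => by positivity)
        (fun v hv => by gcongr) (integrable_normSq_mul_of_weighted (int0 x))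
      refine le_trans ?_ this
      rw [mul_comm]
      gcongr
    · calc energy (truncatedDatum α β (1 / 3) δ ω c x)
          ≤ ∫ v, (12 * width ‖x‖) ^ 2 * truncatedDatum α β (1 / 3) δ ω c x v := by
            refine integral_mono (integrable_normSq_mul_of_weighted (int0 x))
              ((integrable_of_weighted (int0 x)).const_mul _) fun v => ?_
            have h0 := truncatedDatum_nonneg (α := α) (β := β) (δ := δ) (ω := ω) hc.le x v
            simp only [truncatedDatum_eq] at h0 ⊢
            by_cases hv : cbrt ‖x‖ ≤ ‖v‖ ∧ ‖v‖ ≤ 2 * cbrt ‖x‖ + 10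
            · have := le_width_of_mem (norm_nonneg x) hv.2
              gcongr
            · rw [radialDatum_eq_zero hv, mul_zero, mul_zero]
        _ = (12 * width ‖x‖) ^ 2 * density (truncatedDatum α β (1 / 3) δ ω c x) :=
            integral_const_mul _ _
        _ ≤ (12 * width ‖x‖) ^ 2 * (C *
            (amplitude α β (3 * ω + 2 * δ + β) (width ‖x‖) * width ‖x‖ ^ N)) := by
            gcongr
            exact hup x
        _ = 144 * C * (amplitude α β (3 * ω + 2 * δ + β) (width ‖x‖) * width ‖x‖ ^ N *
            width ‖x‖ ^ 2) := by ring
        _ ≤ 1 / a * (amplitude α β (3 * ω + 2 * δ + β) (width ‖x‖) * width ‖x‖ ^ N *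
            width ‖x‖ ^ 2) := by gcongr
        _ = _ := by ring
  · exact hdist t ht.1 (htime t ht).1 (htime t ht).2 x

end

/-! ### Macroscopic bounds in terms of the cubic profile -/

section Macroscopic

variable {N : ℕ} {α β δ ω : ℝ}

/-- The reference density in the macroscopic bounds, for the exponent `1/3`. -/
def refDensity (N : ℕ) (α β δ ω R : ℝ) : ℝ :=
  (1 + R) ^ ((N - 2 * δ - β) * (1 / 3) - ω) * Real.exp (-α * R ^ (β * (1 / 3)))

/-- Replacing `|x|^{1/3}` by `L` in the exponential costs at most `e^{2α}`, since the two differ by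
less than the layer thickness. -/
theorem refDensity_bounds (hα : 0 < α) (hβ : 0 < β) (hβ2 : β ≤ 2) {R : ℝ} (hR : 0 ≤ R) :
    amplitude α β (3 * ω + 2 * δ + β) (width R) * width R ^ N ≤ refDensity N α β δ ω R ∧
    refDensity N α β δ ω R ≤
      Real.exp (2 * α) * (amplitude α β (3 * ω + 2 * δ + β) (width R) * width R ^ N) := by
  have hL1 := one_le_width hR
  have hL := width_pos hR
  have hr := cbrt_nonneg hR
  have hrL := cbrt_le_width hR
  have hLr := width_sub_cbrt_le hR
  have hh := Real.rpow_pos_of_pos hL (1 - β)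
  have hi := inv_le_rpow_one_sub hL1 hβ2
  have hi2 : 1 / width R ^ 2 ≤ 1 / width R := by gcongr; nlinarith
  have e1 : R ^ (β * (1 / 3)) = cbrt R ^ β := by
    rw [cbrt, ← Real.rpow_mul hR, mul_comm]
  have e2 : refDensity N α β δ ω R = width R ^ (-(3 * ω + 2 * δ + β)) * width R ^ N *
      Real.exp (-α * cbrt R ^ β) := by
    rw [refDensity, e1, ← width_rpow hR, ← Real.rpow_natCast, ← Real.rpow_add hL]
    congr 2
    ring
  have h1 : cbrt R ^ β ≤ width R ^ β := Real.rpow_le_rpow hr hrL hβ.le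
  have h2 : width R ^ β ≤ cbrt R ^ β + 2 := by
    have k1 := rpow_sub_rpow_le_of_le hL hr hrL hβ hβ2
    have k2 : (width R - cbrt R) / width R ^ (1 - β) ≤ 1 := by
      rw [div_le_one hh]
      linarith
    linarith
  have hp := Real.rpow_pos_of_pos hL (-(3 * ω + 2 * δ + β))
  rw [e2, amplitude]
  constructor
  · rw [mul_right_comm]
    gcongr ?_ * ?_
    exact Real.exp_le_exp.2 (by nlinarith)
  · calc _ ≤ width R ^ (-(3 * ω + 2 * δ + β)) * width R ^ N *
          Real.exp (2 * α + -α * width R ^ β) := by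
          gcongr ?_ * ?_
          exact Real.exp_le_exp.2 (by nlinarith)
      _ = _ := by rw [Real.exp_add]; ring

theorem width_bounds {R : ℝ} (hR : 0 ≤ R) :
    width R ≤ 1 + cbrt R ∧ cbrt R ≤ width R ∧ width R ^ 2 ≤ 2 * (1 + R ^ (2 * (1 / 3) : ℝ)) ∧
      1 + R ^ (2 * (1 / 3) : ℝ) ≤ 2 * width R ^ 2 := by
  have hL1 := one_le_width hR
  have hL := width_pos hR
  have hr := cbrt_nonneg hR
  have hrL := cbrt_le_width hR
  have hLr := width_sub_cbrt_le hR
  have hi2 : 1 / width R ^ 2 ≤ 1 := by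
    rw [div_le_one (by positivity)]; nlinarith
  have e : R ^ (2 * (1 / 3) : ℝ) = cbrt R ^ 2 := by
    rw [cbrt, ← Real.rpow_natCast, ← Real.rpow_mul hR]
    congr 1
    push_cast
    ring
  rw [e]
  refine ⟨by linarith, hrL, ?_, ?_⟩
  · have : width R ^ 2 ≤ (1 + cbrt R) ^ 2 := by gcongr; linarith
    nlinarith [sq_nonneg (1 - cbrt R)]
  · nlinarith

/-- Of the velocity bound only `|u| ≲ L` on the bounded interval is kept; smallness in `t` plays no
role for uniqueness or blow-up. -/
theorem HasMacroscopicBounds.exists_bounds (hα : 0 < α) (hβ : 0 < β) (hβ2 : β ≤ 2)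
    (hm : 0 ≤ 3 * ω + 2 * δ + β) {T : ℝ} (hT : 0 ≤ T) {f : ℝ → Space N → Space N → ℝ}
    (h : HasMacroscopicBounds α β (1 / 3) δ ω T f) :
    ∃ A > 0, ∀ t ∈ Icc 0 T, ∀ᵐ x : Space N, (cubeProfile N hα hβ hβ2 hm).Bounds A x (f t x) := by
  obtain ⟨C₁, h₁, C₂, h₂, C₃, h₃, C₄, h₄, C₅, h₅, h⟩ := h
  have hq := Real.rpow_nonneg hT (1 / 4)
  set A := 1 / C₁ + C₂ * Real.exp (2 * α) + 2 * C₃ * T ^ (1 / 4 : ℝ) + 2 / C₄ + 2 * C₅ with hA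
  have hA0 : 0 < A := by positivity
  have p1 : 0 < 1 / C₁ := by positivity
  have p2 : 0 < C₂ * Real.exp (2 * α) := by positivity
  have p3 : 0 ≤ 2 * C₃ * T ^ (1 / 4 : ℝ) := by positivity
  have p4 : 0 < 2 / C₄ := by positivity
  have p5 : 0 < 2 * C₅ := by positivity
  refine ⟨A, hA0, fun t ht => ?_⟩
  filter_upwards [h t ht] with x hx
  obtain ⟨hρ, hu, hθ⟩ := hx
  have hL := width_pos (norm_nonneg x)
  obtain ⟨w1, w2, w3, w4⟩ := width_bounds (norm_nonneg x)
  obtain ⟨d1, d2⟩ := refDensity_bounds (N := N) (ω := ω) (δ := δ) hα hβ hβ2 (norm_nonneg x)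
  set D := density (f t x)
  change D / refDensity N α β δ ω ‖x‖ ∈ _ at hρ
  change _ ≤ C₃ * (1 + cbrt ‖x‖) * _ at hu
  have hB : 0 < amplitude α β (3 * ω + 2 * δ + β) (width ‖x‖) * width ‖x‖ ^ N :=
    mul_pos (amplitude_pos hL) (pow_pos hL _)
  have hD := hB.trans_le d1
  have hθ0 : 0 < 1 + ‖x‖ ^ (2 * (1 / 3) : ℝ) := by positivity
  constructor
  · change amplitude α β (3 * ω + 2 * δ + β) (width ‖x‖) * width ‖x‖ ^ N / A ≤ D
    have k := (le_div_iff₀ hD).1 hρ.1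
    refine le_trans ?_ ((mul_le_mul_of_nonneg_left d1 h₁.le).trans k)
    rw [div_le_iff₀ hA0]
    have : 1 ≤ C₁ * A := by
      calc 1 = C₁ * (1 / C₁) := by field_simp
        _ ≤ _ := by gcongr; linarith
    nlinarith
  · change D ≤ A * (amplitude α β (3 * ω + 2 * δ + β) (width ‖x‖) * width ‖x‖ ^ N)
    have k := (div_le_iff₀ hD).1 hρ.2
    refine (k.trans (mul_le_mul_of_nonneg_left d2 h₂.le)).trans ?_
    rw [← mul_assoc]
    gcongr
    linarith
  · change _ ≤ A * width ‖x‖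
    have k : t ^ (1 / 4 : ℝ) ≤ T ^ (1 / 4 : ℝ) := Real.rpow_le_rpow ht.1 ht.2 (by norm_num)
    calc _ ≤ C₃ * (1 + cbrt ‖x‖) * t ^ (1 / 4 : ℝ) := hu
      _ ≤ C₃ * (2 * width ‖x‖) * T ^ (1 / 4 : ℝ) := by
          have := Real.rpow_nonneg ht.1 (1 / 4)
          gcongr
          linarith [one_le_width (norm_nonneg x)]
      _ = 2 * C₃ * T ^ (1 / 4 : ℝ) * width ‖x‖ := by ring
      _ ≤ _ := by gcongr; linarith
  · change width ‖x‖ ^ 2 / A ≤ _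
    have k := (le_div_iff₀ hθ0).1 hθ.1
    refine le_trans ?_ k
    rw [div_le_iff₀ hA0]
    have : 2 ≤ C₄ * A := by
      calc 2 = C₄ * (2 / C₄) := by field_simp
        _ ≤ _ := by gcongr; linarith
    nlinarith
  · change _ ≤ A * width ‖x‖ ^ 2
    have k := (div_le_iff₀ hθ0).1 hθ.2
    calc _ ≤ C₅ * (1 + ‖x‖ ^ (2 * (1 / 3) : ℝ)) := k
      _ ≤ C₅ * (2 * width ‖x‖ ^ 2) := by gcongr
      _ = 2 * C₅ * width ‖x‖ ^ 2 := by ring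
      _ ≤ _ := by gcongr; linarith

theorem hasMacroscopicBounds_of_bounds (hα : 0 < α) (hβ : 0 < β) (hβ2 : β ≤ 2)
    (hm : 0 ≤ 3 * ω + 2 * δ + β) {T A C : ℝ} (hA : 0 < A) (hC : 0 < C)
    {f : ℝ → Space N → Space N → ℝ}
    (h : ∀ t ∈ Icc 0 T, ∀ x : Space N, (cubeProfile N hα hβ hβ2 hm).Bounds A x (f t x) ∧
      ‖bulkVelocity (f t x)‖ ≤ C * t ^ (1 / 4 : ℝ) * (cubeProfile N hα hβ hβ2 hm).width x) :
    HasMacroscopicBounds α β (1 / 3) δ ω T f := by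
  refine ⟨Real.exp (-(2 * α)) / A, by positivity, A, hA, C, hC, 1 / (2 * A), by positivity,
    2 * A, by positivity, fun t ht => Filter.Eventually.of_forall fun x => ?_⟩
  obtain ⟨F, hu⟩ := h t ht x
  have hL := width_pos (norm_nonneg x)
  obtain ⟨w1, w2, w3, w4⟩ := width_bounds (norm_nonneg x)
  obtain ⟨d1, d2⟩ := refDensity_bounds (N := N) (ω := ω) (δ := δ) hα hβ hβ2 (norm_nonneg x)
  have hB : 0 < amplitude α β (3 * ω + 2 * δ + β) (width ‖x‖) * width ‖x‖ ^ N :=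
    mul_pos (amplitude_pos hL) (pow_pos hL _)
  have hD := hB.trans_le d1
  have hθ0 : 0 < 1 + ‖x‖ ^ (2 * (1 / 3) : ℝ) := by positivity
  have f1 : amplitude α β (3 * ω + 2 * δ + β) (width ‖x‖) * width ‖x‖ ^ N / A ≤
    density (f t x) := F.le_density
  have f2 : density (f t x) ≤ A * (amplitude α β (3 * ω + 2 * δ + β) (width ‖x‖) *
    width ‖x‖ ^ N) := F.density_le
  have f3 : width ‖x‖ ^ 2 / A ≤ temperature (f t x) := F.le_temp
  have f4 : temperature (f t x) ≤ A * width ‖x‖ ^ 2 := F.temp_le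
  change ‖bulkVelocity (f t x)‖ ≤ C * t ^ (1 / 4 : ℝ) * width ‖x‖ at hu
  refine ⟨?_, ?_, ?_⟩
  · change density (f t x) / refDensity N α β δ ω ‖x‖ ∈ _
    constructor
    · rw [le_div_iff₀ hD]
      refine le_trans ?_ f1
      rw [div_mul_eq_mul_div]
      refine div_le_div_of_nonneg_right ?_ hA.le
      rw [Real.exp_neg, inv_mul_le_iff₀ (Real.exp_pos _)]
      exact d2
    · rw [div_le_iff₀ hD]
      exact f2.trans (by gcongr)
  · change _ ≤ C * (1 + cbrt ‖x‖) * _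
    have := Real.rpow_nonneg ht.1 (1 / 4)
    calc _ ≤ C * t ^ (1 / 4 : ℝ) * width ‖x‖ := hu
      _ ≤ C * t ^ (1 / 4 : ℝ) * (1 + cbrt ‖x‖) := by gcongr
      _ = _ := by ring
  · constructor
    · rw [le_div_iff₀ hθ0]
      refine le_trans ?_ f3
      rw [one_div_mul_eq_div, div_le_div_iff₀ (by positivity) hA]
      nlinarith
    · rw [div_le_iff₀ hθ0]
      refine f4.trans ?_
      nlinarith

end Macroscopic

/-! ### Lower bounds for mixed norms -/

section MixedNorm

variable {N : ℕ}

theorem le_eLpNorm_of_le_on {X E : Type*} [MeasurableSpace X] {μ : Measure X}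
    [TopologicalSpace E] [ESeminormedAddMonoid E] {h : X → E} {S : Set X} {k : ℝ≥0∞} {p : ℝ≥0∞}
    (hS : MeasurableSet S) (hμ : 1 ≤ μ S) (hp : p ≠ 0)
    (hk : ∀ᵐ x ∂μ, x ∈ S → k ≤ ‖h x‖ₑ) : k ≤ eLpNorm h p μ := by
  calc k = k * 1 := (mul_one k).symm
    -- For `p = ∞` the exponent is `1 / 0 = 0`; measure at least one makes the inequality hold for
    -- all exponents alike.
    _ ≤ k * μ S ^ (1 / p.toReal) := by
        gcongr
        simpa using ENNReal.rpow_le_rpow hμ (z := 1 / p.toReal) (by positivity)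
    _ = eLpNorm (S.indicator fun _ => k) p μ := by
        rw [eLpNorm_indicator_const' hS (by intro h0; simp [h0] at hμ) hp]
        rfl
    _ ≤ eLpNorm h p μ := by
        refine eLpNorm_mono_enorm_ae ?_
        filter_upwards [hk] with x hx
        by_cases hxS : x ∈ S
        · rw [indicator_of_mem hxS]
          exact hx hxS
        · rw [indicator_of_notMem hxS]
          simp

theorem le_normXV_of_le_on {g : Space N → Space N → ℝ} {p q : ℝ≥0∞} {S V : Set (Space N)} {K : ℝ}
    (hp : p ≠ 0) (hq : q ≠ 0) (hS : MeasurableSet S) (hV : MeasurableSet V)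
    (hS1 : 1 ≤ volume S) (hV1 : 1 ≤ volume V)
    (h : ∀ᵐ z : Space N × Space N, z.1 ∈ S → z.2 ∈ V → K ≤ g z.1 z.2) :
    ENNReal.ofReal K ≤ normXV p q g := by
  refine le_eLpNorm_of_le_on hS hS1 hp ?_
  filter_upwards [ae_ae_of_ae_phase (P := fun x v => x ∈ S → v ∈ V → K ≤ g x v) h] with x hx hxS
  rw [enorm_eq_self]
  refine le_eLpNorm_of_le_on hV hV1 hq ?_
  filter_upwards [hx] with v hv hvV
  exact (ENNReal.ofReal_le_ofReal (hv hxS hvV)).trans (Real.ofReal_le_enorm _)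

theorem ae_swap {P : Space N → Space N → Prop} (h : ∀ᵐ z : Space N × Space N, P z.1 z.2) :
    ∀ᵐ z : Space N × Space N, P z.2 z.1 :=
  (Measure.measurePreserving_swap (μ := (volume : Measure (Space N)))
    (ν := (volume : Measure (Space N)))).quasiMeasurePreserving.ae h

theorem normVX_eq_normXV_swap (p q : ℝ≥0∞) (g : Space N → Space N → ℝ) :
    normVX p q g = normXV q p fun v x => g x v := rfl

theorem le_normVX_of_le_on {g : Space N → Space N → ℝ} {p q : ℝ≥0∞} {S V : Set (Space N)} {K : ℝ}
    (hp : p ≠ 0) (hq : q ≠ 0) (hS : MeasurableSet S) (hV : MeasurableSet V)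
    (hS1 : 1 ≤ volume S) (hV1 : 1 ≤ volume V)
    (h : ∀ᵐ z : Space N × Space N, z.1 ∈ S → z.2 ∈ V → K ≤ g z.1 z.2) :
    ENNReal.ofReal K ≤ normVX p q g := by
  rw [normVX_eq_normXV_swap]
  refine le_normXV_of_le_on hq hp hV hS hV1 hS1 ?_
  filter_upwards [ae_swap (P := fun x v => x ∈ S → v ∈ V → K ≤ g x v) h] with z hz h1 h2
  exact hz h2 h1

/-! ### Upper bounds for mixed norms -/

/-- The integrable decay `(1+|x|)^{-(N+1)}`. -/
def japanese (N : ℕ) (x : Space N) : ℝ := (1 + ‖x‖) ^ (-((N : ℝ) + 1))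

theorem japanese_pos (x : Space N) : 0 < japanese N x :=
  Real.rpow_pos_of_pos (by positivity) _

theorem japanese_le_one (x : Space N) : japanese N x ≤ 1 :=
  rpow_neg_le_one (norm_nonneg x) (by positivity)

theorem measurable_japanese : Measurable (japanese N) := by
  unfold japanese
  fun_prop

theorem eLpNorm_japanese_ne_top {p : ℝ≥0∞} (hp : 1 ≤ p) :
    eLpNorm (japanese N) p volume ≠ ∞ := by
  refine MemLp.eLpNorm_ne_top ?_
  have hm := (measurable_japanese (N := N)).aestronglyMeasurable (μ := volume)
  by_cases hpt : p = ∞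
  · rw [hpt]
    refine memLp_top_of_bound hm 1 (Filter.Eventually.of_forall fun x => ?_)
    rw [Real.norm_of_nonneg (japanese_pos x).le]
    exact japanese_le_one x
  · have hp1 : 1 ≤ p.toReal := by
      rw [← ENNReal.toReal_one]
      exact ENNReal.toReal_mono hpt hp
    rw [← integrable_norm_rpow_iff hm (by positivity) hpt]
    have hr : (Module.finrank ℝ (Space N) : ℝ) < ((N : ℝ) + 1) * p.toReal := by
      rw [finrank_euclideanSpace, Fintype.card_fin]
      nlinarith [Nat.cast_nonneg (α := ℝ) N]
    refine (integrable_one_add_norm (μ := volume) hr).congr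
      (Filter.Eventually.of_forall fun x => ?_)
    change _ = ‖japanese N x‖ ^ p.toReal
    rw [Real.norm_of_nonneg (japanese_pos x).le, japanese, ← Real.rpow_mul (by positivity),
      neg_mul]

/-- A separated bound factorises the mixed norm, and being symmetric it serves both orders of
integration. -/
theorem normXV_le_of_product {g : Space N → Space N → ℝ} {p q : ℝ≥0∞} {c : ℝ} (hc : 0 ≤ c)
    (hq : 1 ≤ q)
    (h : ∀ x v, |g x v| ≤ c * (japanese N x * japanese N v)) :
    normXV p q g ≤ ENNReal.ofReal c *
      (eLpNorm (japanese N) p volume * eLpNorm (japanese N) q volume) := by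
  set Q := eLpNorm (japanese N) q volume with hQ
  have inner : ∀ x, eLpNorm (fun v => g x v) q volume ≤
      ENNReal.ofReal (c * japanese N x) * Q := by
    intro x
    have h0 : 0 ≤ c * japanese N x := mul_nonneg hc (japanese_pos x).le
    calc eLpNorm (fun v => g x v) q volume ≤
          eLpNorm ((c * japanese N x) • japanese N) q volume := by
          refine eLpNorm_mono_real fun v => ?_
          rw [Real.norm_eq_abs, Pi.smul_apply, smul_eq_mul, mul_assoc]
          exact h x v
      _ = _ := by rw [eLpNorm_const_smul, Real.enorm_of_nonneg h0]
  unfold normXV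
  have hQt : Q ≠ ∞ := eLpNorm_japanese_ne_top hq
  calc _ ≤ eLpNorm ((c * Q.toReal) • japanese N) p volume := by
        refine eLpNorm_mono_enorm_ae (Filter.Eventually.of_forall fun x => ?_)
        have hj := (japanese_pos x).le
        rw [enorm_eq_self, Pi.smul_apply, smul_eq_mul, Real.enorm_of_nonneg (by positivity)]
        refine (inner x).trans (le_of_eq ?_)
        rw [mul_right_comm, ENNReal.ofReal_mul (p := c * japanese N x) (by positivity),
          ENNReal.ofReal_toReal hQt]
    _ = _ := by
        rw [eLpNorm_const_smul, Real.enorm_of_nonneg (by positivity), ENNReal.ofReal_mul hc,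
          ENNReal.ofReal_toReal hQt]
        ring

end MixedNorm

variable {N : ℕ}

/-! ### Smallness of the datum -/

theorem weight_pos (α β δ : ℝ) (v : Space N) : 0 < weight α β δ v :=
  mul_pos (Real.rpow_pos_of_pos (by positivity) _) (Real.exp_pos _)

theorem weight_mul_decay (α β δ : ℝ) (v : Space N) :
    weight α β δ v * decay α β δ ‖v‖ = 1 := by
  have h : 0 < 1 + ‖v‖ ^ 2 := by positivity
  unfold weight decay
  rw [mul_mul_mul_comm, ← Real.rpow_add h, ← Real.exp_add, neg_mul]
  simp

/-- The weight cancels the velocity decay of the datum exactly, leaving the spatial factor on the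
support. -/
theorem abs_weight_mul_truncatedDatum_le {α β δ ω c : ℝ} (hc : 0 ≤ c) (x v : Space N) :
    |weight α β δ v * truncatedDatum α β (1 / 3) δ ω c x v| ≤
      if ‖v‖ ≤ 12 * width ‖x‖ then c * (1 + ‖x‖) ^ (-ω) else 0 := by
  have h0 : 0 ≤ c * (1 + ‖x‖) ^ (-ω) := by positivity
  rw [abs_of_nonneg (mul_nonneg (weight_pos _ _ _ _).le (truncatedDatum_nonneg hc x v)),
    truncatedDatum_eq]
  unfold radialDatum
  split_ifs with h1 h2 h2
  · rw [mul_left_comm, weight_mul_decay, mul_one]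
  · exact absurd (le_width_of_mem (norm_nonneg x) h1.2) h2
  · rwa [mul_zero]
  · rw [mul_zero]

/-- This fixes `ω`: since `1 + |v| ≤ 13 L` on the support, the extra decay `(1+|x|)^{-(N+1)/3} =
L^{-(N+1)}` becomes decay of order `N + 1` in `v`. -/
theorem rpow_neg_le_japanese (x v : Space N) (h : ‖v‖ ≤ 12 * width ‖x‖) :
    (1 + ‖x‖) ^ (-(((N : ℝ) + 1) + ((N : ℝ) + 1) / 3)) ≤
      13 ^ ((N : ℝ) + 1) * (japanese N x * japanese N v) := by
  have hx : 0 < 1 + ‖x‖ := by positivity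
  have hw := one_le_width (norm_nonneg x)
  have hw0 := width_pos (norm_nonneg x)
  have e1 : (13 * width ‖x‖) ^ (-((N : ℝ) + 1)) ≤ japanese N v :=
    Real.rpow_le_rpow_of_nonpos (by positivity) (by linarith)
      (by linarith [Nat.cast_nonneg (α := ℝ) N])
  rw [Real.mul_rpow (by norm_num) hw0.le, Real.rpow_neg (by norm_num),
    inv_mul_le_iff₀ (by positivity)] at e1
  rw [neg_add, Real.rpow_add hx, mul_left_comm]
  have e2 : (1 + ‖x‖) ^ (-(((N : ℝ) + 1) / 3)) = width ‖x‖ ^ (-((N : ℝ) + 1)) := by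
    rw [← width_rpow (norm_nonneg x)]
    congr 1
    ring
  rw [e2]
  exact mul_le_mul_of_nonneg_left e1 (japanese_pos x).le

theorem exists_truncatedDatum_small (N : ℕ) {α β δ ω ε : ℝ}
    (hω : ω = ((N : ℝ) + 1) + ((N : ℝ) + 1) / 3) (hε : 0 < ε) {p q : ℝ≥0∞} (hp : 1 ≤ p)
    (hq : 1 ≤ q) {mixedNorm : (Space N → Space N → ℝ) → ℝ≥0∞}
    (hnorm : mixedNorm = normXV p q ∨ mixedNorm = normVX p q) :
    ∃ c > 0, mixedNorm (fun x v => weight α β δ v * truncatedDatum α β (1 / 3) δ ω c x v) +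
      normSup (fun x v : Space N => weight α β δ v * truncatedDatum α β (1 / 3) δ ω c x v) ≤
        ENNReal.ofReal ε := by
  have hQ : eLpNorm (japanese N) p volume * eLpNorm (japanese N) q volume ≠ ∞ :=
    ENNReal.mul_ne_top (eLpNorm_japanese_ne_top hp) (eLpNorm_japanese_ne_top hq)
  set Q := (eLpNorm (japanese N) p volume * eLpNorm (japanese N) q volume).toReal with hQdef
  have hQ0 : 0 ≤ Q := ENNReal.toReal_nonneg
  set M : ℝ := 13 ^ ((N : ℝ) + 1) with hM
  have hM0 : 0 < M := by positivity
  -- `M Q` accounts for the mixed norm, `1` for the supremum norm.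
  set c := ε / (2 * (M * Q + 1)) with hcdef
  have hc : 0 < c := by positivity
  have hc1 : c * (M * Q + 1) = ε / 2 := by rw [hcdef]; field_simp
  have hMQ : 0 ≤ c * M * Q := by positivity
  refine ⟨c, hc, ?_⟩
  have hsupp : ∀ x v : Space N, |weight α β δ v * truncatedDatum α β (1 / 3) δ ω c x v| ≤
      c * M * (japanese N x * japanese N v) := by
    intro x v
    have hj := mul_pos (japanese_pos x) (japanese_pos v)
    refine (abs_weight_mul_truncatedDatum_le hc.le x v).trans ?_
    split_ifs with h
    · rw [hω, mul_assoc]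
      exact mul_le_mul_of_nonneg_left (rpow_neg_le_japanese x v h) hc.le
    · positivity
  have hbound : ∀ x v : Space N, |weight α β δ v * truncatedDatum α β (1 / 3) δ ω c x v| ≤ c := by
    intro x v
    refine (abs_weight_mul_truncatedDatum_le hc.le x v).trans ?_
    split_ifs
    · exact mul_le_of_le_one_right hc.le (rpow_neg_le_one (norm_nonneg x) (by rw [hω]; positivity))
    · exact hc.le
  have h1 : mixedNorm (fun x v => weight α β δ v * truncatedDatum α β (1 / 3) δ ω c x v) ≤
      ENNReal.ofReal (c * M * Q) := by
    rw [ENNReal.ofReal_mul (by positivity), hQdef, ENNReal.ofReal_toReal hQ]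
    rcases hnorm with rfl | rfl
    · exact normXV_le_of_product (by positivity) hq hsupp
    · rw [normVX_eq_normXV_swap, mul_comm (eLpNorm _ p _)]
      refine normXV_le_of_product (by positivity) hp fun v x => ?_
      rw [mul_comm (japanese N v)]
      exact hsupp x v
  have h2 : normSup (fun x v : Space N =>
      weight α β δ v * truncatedDatum α β (1 / 3) δ ω c x v) ≤ ENNReal.ofReal c := by
    unfold normSup
    rw [eLpNorm_exponent_top]
    refine eLpNormEssSup_le_of_ae_bound (Filter.Eventually.of_forall fun z => ?_)
    exact hbound z.1 z.2
  calc _ ≤ ENNReal.ofReal (c * M * Q) + ENNReal.ofReal c := add_le_add h1 h2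
    _ = ENNReal.ofReal (c * M * Q + c) := (ENNReal.ofReal_add hMQ hc.le).symm
    _ ≤ _ := ENNReal.ofReal_le_ofReal (by linarith)

/-! ### Spatial inhomogeneity -/

/-- For `1 < |v| < 10` the datum is positive when `|x| < 1`, but vanishes when `|x| > 1000`, since
then `|x|^{1/3} > 10`. Sets of full measure are dense, so such points can be compared. -/
theorem not_spatiallyHomogeneous (hN : 1 ≤ N) {α β δ ω c : ℝ} (hc : 0 < c) :
    ¬ SpatiallyHomogeneous (truncatedDatum (N := N) α β (1 / 3) δ ω c) := by
  rintro ⟨h, hh⟩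
  have := nontrivial_space hN
  have hd := Measure.dense_of_ae (ae_ae_of_ae_phase
    (P := fun x v => truncatedDatum (N := N) α β (1 / 3) δ ω c x v = h v) hh)
  obtain ⟨y, hy⟩ := exists_norm_eq (E := Space N) (show (0 : ℝ) ≤ 8000 by norm_num)
  obtain ⟨w, hw⟩ := exists_norm_eq (E := Space N) (show (0 : ℝ) ≤ 5 by norm_num)
  obtain ⟨x₁, k₁, hx₁⟩ := hd.exists_mem_open (Metric.isOpen_ball (x := (0 : Space N)) (ε := 1))
    ⟨0, by simp⟩
  obtain ⟨x₂, k₂, hx₂⟩ := hd.exists_mem_open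
    (isOpen_lt (continuous_const (y := (1000 : ℝ))) (continuous_norm (E := Space N)))
    ⟨y, by simp only [mem_ofPred_eq, hy]; norm_num⟩
  simp only [mem_ofPred_eq] at k₁ k₂
  have hv := Measure.dense_of_ae (k₁.and k₂)
  obtain ⟨v, ⟨e₁, e₂⟩, hv1, hv2⟩ := hv.exists_mem_open
    ((isOpen_lt (continuous_const (y := (1 : ℝ))) (continuous_norm (E := Space N))).inter
      (isOpen_lt (continuous_norm (E := Space N)) (continuous_const (y := (10 : ℝ)))))
    ⟨w, by simp only [mem_inter_iff, mem_ofPred_eq, hw]; norm_num⟩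
  simp only [mem_ofPred_eq] at hv1 hv2 hx₂
  rw [mem_ball_zero_iff] at hx₁
  rw [← e₂, truncatedDatum_eq, truncatedDatum_eq] at e₁
  have c1 := cbrt_cube (norm_nonneg x₁)
  have c2 := cbrt_cube (norm_nonneg x₂)
  have n1 := cbrt_nonneg (norm_nonneg x₁)
  have n2 := cbrt_nonneg (norm_nonneg x₂)
  have b1 : cbrt ‖x₁‖ ≤ 1 :=
    le_of_pow_le_pow_left₀ (n := 3) (by norm_num) (by norm_num) (by linarith)
  have b2 : 10 < cbrt ‖x₂‖ :=
    lt_of_pow_lt_pow_left₀ 3 n2 (by linarith)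
  unfold radialDatum at e₁
  rw [if_pos ⟨by linarith, by linarith⟩, if_neg (fun h => by linarith [h.1])] at e₁
  have := decay_pos α β δ ‖v‖
  have : 0 < c * (1 + ‖x₁‖) ^ (-ω) * decay α β δ ‖v‖ := by positivity
  exact this.ne' e₁

/-! ### Instantaneous blow-up -/

theorem exists_le_rpow_mul_exp {β m k K L₁ : ℝ} (hβ : 0 < β) (hk : 0 < k) :
    ∃ L, L₁ ≤ L ∧ K ≤ k * (2 * L) ^ (-m) * Real.exp (L ^ β) := by
  have h1 : Filter.Tendsto (fun L : ℝ => Real.exp (L ^ β) / (L ^ β) ^ (m / β))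
      Filter.atTop Filter.atTop :=
    (tendsto_exp_div_rpow_atTop (m / β)).comp (tendsto_rpow_atTop hβ)
  have h2 := h1.eventually_ge_atTop (K / (k * 2 ^ (-m)))
  obtain ⟨L, hL, hL1, hL0⟩ := (h2.and ((Filter.eventually_ge_atTop L₁).and
    (Filter.eventually_gt_atTop 0))).exists
  refine ⟨L, hL1, ?_⟩
  rw [div_le_iff₀ (by positivity), ← Real.rpow_mul hL0.le, mul_div_cancel₀ _ hβ.ne'] at hL
  rw [Real.mul_rpow (by norm_num) hL0.le, Real.rpow_neg hL0.le]
  refine hL.trans (le_of_eq ?_)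
  rw [div_eq_mul_inv]
  ring

theorem exists_one_le_volume_ball (hN : 1 ≤ N) :
    ∃ r ≥ 1, ∀ x : Space N, 1 ≤ volume (Metric.ball x r) := by
  have := nontrivial_space hN
  set b := (volume (Metric.ball (0 : Space N) 1)).toReal with hb
  have hbt : volume (Metric.ball (0 : Space N) 1) ≠ ∞ := measure_ball_lt_top.ne
  have hb0 : 0 < b := ENNReal.toReal_pos (Metric.measure_ball_pos _ _ one_pos).ne' hbt
  have hr : 1 ≤ 1 / b + 1 := le_add_of_nonneg_left (by positivity)
  refine ⟨1 / b + 1, hr, fun x => ?_⟩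
  rw [Measure.addHaar_ball _ _ (by linarith), ← ENNReal.ofReal_toReal hbt, ← hb,
    ← ENNReal.ofReal_mul (by positivity), ENNReal.one_le_ofReal, finrank_euclideanSpace,
    Fintype.card_fin]
  calc 1 ≤ (1 / b + 1) * b := by
        rw [add_mul, one_div_mul_cancel hb0.ne']
        linarith
    _ ≤ _ := by
        gcongr
        exact le_self_pow₀ hr (by omega)

/-- Where `1 + |y|` is within a factor 8 of `L³`, the width is within a factor 2 of `L`. The `4α`
comes from `(2L)^β ≤ 4 L^β`, and the Gaussian is bounded below at speeds `O(L)`. -/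
theorem le_cubeProfile_gauss {α β m : ℝ} (hα : 0 < α) (hβ : 0 < β) (hβ2 : β ≤ 2) (hm : 0 ≤ m)
    {A B L : ℝ} (hA : 0 ≤ A) (hL : 0 < L) {y v : Space N} (h1 : L ^ 3 ≤ 8 * (1 + ‖y‖))
    (h2 : 1 + ‖y‖ ≤ 8 * L ^ 3) (hv : ‖v‖ ≤ 2 * B * L) :
    (2 * L) ^ (-m) * Real.exp (-(4 * α) * L ^ β) * Real.exp (-A * (4 * B) ^ 2) ≤
      (cubeProfile N hα hβ hβ2 hm).gauss A y v := by
  have hw := width_cube (norm_nonneg y)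
  have hw0 := width_pos (norm_nonneg y)
  have w1 : L ≤ 2 * width ‖y‖ :=
    le_of_pow_le_pow_left₀ (n := 3) (by norm_num) (by positivity) (by rw [mul_pow]; linarith)
  have w2 : width ‖y‖ ≤ 2 * L :=
    le_of_pow_le_pow_left₀ (n := 3) (by norm_num) (by positivity) (by rw [mul_pow]; linarith)
  have hB : 0 ≤ B := by
    by_contra! hcon
    have := norm_nonneg v
    nlinarith
  have e1 : (2 * L) ^ (-m) ≤ width ‖y‖ ^ (-m) :=
    Real.rpow_le_rpow_of_nonpos hw0 w2 (by linarith)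
  have e2 : width ‖y‖ ^ β ≤ 4 * L ^ β := by
    have : (2 : ℝ) ^ β ≤ 4 := by
      calc (2 : ℝ) ^ β ≤ 2 ^ (2 : ℝ) := Real.rpow_le_rpow_of_exponent_le (by norm_num) hβ2
        _ = 4 := by norm_num
    calc width ‖y‖ ^ β ≤ (2 * L) ^ β := Real.rpow_le_rpow hw0.le w2 hβ.le
      _ = 2 ^ β * L ^ β := Real.mul_rpow (by norm_num) hL.le
      _ ≤ _ := by gcongr
  have e3 : ‖v‖ / width ‖y‖ ≤ 4 * B := by
    rw [div_le_iff₀ hw0]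
    nlinarith
  change _ ≤ width ‖y‖ ^ (-m) * Real.exp (-α * width ‖y‖ ^ β) *
    Real.exp (-A * (‖v‖ / width ‖y‖) ^ 2)
  have e4 : (‖v‖ / width ‖y‖) ^ 2 ≤ (4 * B) ^ 2 := by gcongr
  gcongr ?_ * Real.exp ?_ * Real.exp ?_
  · nlinarith
  · nlinarith

theorem le_weight {α β δ B L : ℝ} (hα : 0 ≤ α) (hβ : 0 < β) (hδ : 0 ≤ δ) (hB : 0 ≤ B)
    (hL : 0 ≤ L) {v : Space N} (hv : B * L ≤ ‖v‖) :
    Real.exp (α * B ^ β * L ^ β) ≤ weight α β δ v := by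
  have h1 : 1 ≤ (1 + ‖v‖ ^ 2) ^ δ := Real.one_le_rpow (by nlinarith [norm_nonneg v]) hδ
  have h2 : B ^ β * L ^ β ≤ ‖v‖ ^ β := by
    rw [← Real.mul_rpow hB hL]
    exact Real.rpow_le_rpow (by positivity) hv hβ.le
  unfold weight
  calc _ ≤ Real.exp (α * ‖v‖ ^ β) := Real.exp_le_exp.2 (by rw [mul_assoc]; gcongr)
    _ ≤ _ := le_mul_of_one_le_left (Real.exp_pos _).le h1

/-- Arbitrarily large lower bounds on balls of volume at least one. -/
theorem exists_le_weight_mul (hN : 1 ≤ N) {α α' β δ m : ℝ} (hα : 0 < α) (hα' : 0 < α')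
    (hβ : 0 < β) (hβ2 : β ≤ 2) (hδ : 0 ≤ δ) (hm : 0 ≤ m) {A T c : ℝ} (hA : 0 < A) (hT : 0 ≤ T)
    (hc : 0 < c) {f : Space N → Space N → ℝ}
    (hf : ∀ᵐ z : Space N × Space N, ∀ k : ℝ,
      (∀ τ ∈ Icc 0 T, k ≤ (cubeProfile N hα hβ hβ2 hm).gauss A (z.1 - τ • z.2) z.2) →
        c * k ≤ f z.1 z.2) (K : ℝ) :
    ∃ S V : Set (Space N), MeasurableSet S ∧ MeasurableSet V ∧ 1 ≤ volume S ∧ 1 ≤ volume V ∧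
      ∀ᵐ z : Space N × Space N, z.1 ∈ S → z.2 ∈ V → K ≤ weight α' β δ z.2 * f z.1 z.2 := by
  have := nontrivial_space hN
  obtain ⟨r, hr1, hr⟩ := exists_one_le_volume_ball hN
  -- Chosen so that at speeds at least `bL` the weight is at least `e^{(4α+1)L^β}`, which beats the
  -- amplitude by `e^{L^β}`.
  set b := ((4 * α + 1) / α') ^ (1 / β) with hb
  have hb0 : 0 < b := by positivity
  have hbβ : α' * b ^ β = 4 * α + 1 := by
    rw [hb, ← Real.rpow_mul (by positivity), one_div_mul_cancel hβ.ne', Real.rpow_one]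
    field_simp
  obtain ⟨L, hL, hK⟩ := exists_le_rpow_mul_exp (β := β) (m := m) (K := K)
    (k := c * Real.exp (-A * (4 * (2 * b)) ^ 2))
    (L₁ := 2 * (1 + r + T * (2 * b + r)) + r / b) hβ (by positivity)
  have hrb : 0 < r / b := by positivity
  have hTr : 0 ≤ T * (2 * b + r) := by positivity
  have hL1 : 1 ≤ L := by linarith
  have hL0 : 0 < L := by linarith
  have hLr : r ≤ b * L := by
    rw [← div_le_iff₀' hb0]
    linarith
  -- The ball radius and the transport distance are `O(L)`, negligible against `|x₀| = L³`. So every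
  -- characteristic from these balls stays where the profile has width of order `L`.
  have hL3 : 1 + r + T * (2 * b * L + r) ≤ L ^ 3 / 2 := by
    have h1 : L ^ 2 ≤ L ^ 3 := pow_le_pow_right₀ hL1 (by norm_num)
    have h2 : 1 + r + T * (2 * b * L + r) ≤ (1 + r + T * (2 * b + r)) * L := by
      have : 0 ≤ T * r * (L - 1) := mul_nonneg (by positivity) (by linarith)
      have : 0 ≤ (1 + r) * (L - 1) := mul_nonneg (by positivity) (by linarith)
      nlinarith
    nlinarith
  obtain ⟨x₀, hx₀⟩ := exists_norm_eq (E := Space N) (show 0 ≤ L ^ 3 by positivity)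
  obtain ⟨v₀, hv₀⟩ := exists_norm_eq (E := Space N) (show 0 ≤ 2 * b * L by positivity)
  refine ⟨Metric.ball x₀ r, Metric.ball v₀ r, Metric.isOpen_ball.measurableSet,
    Metric.isOpen_ball.measurableSet, hr x₀, hr v₀, ?_⟩
  filter_upwards [hf] with z hz hx hv
  rw [mem_ball_iff_norm] at hx hv
  have x1 := norm_sub_norm_le z.1 x₀
  have x2 := norm_sub_norm_le x₀ z.1
  have v1 := norm_sub_norm_le z.2 v₀
  have v2 := norm_sub_norm_le v₀ z.2
  rw [norm_sub_rev] at x2 v2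
  have vle : ‖z.2‖ ≤ 2 * b * L + r := by linarith
  have key := hz _ fun τ hτ => by
    have t1 : τ * ‖z.2‖ ≤ T * (2 * b * L + r) := by
      have := hτ.1
      gcongr
      exact hτ.2
    have y1 := norm_sub_smul_le z.1 z.2 hτ.1
    have y2 := norm_le_sub_smul z.1 z.2 hτ.1
    exact le_cubeProfile_gauss (B := 2 * b) hα hβ hβ2 hm hA.le hL0 (by linarith) (by linarith)
      (by linarith)
  have hw := le_weight (δ := δ) (v := z.2) hα'.le hβ hδ hb0.le hL0.le (by linarith)
  rw [hbβ] at hw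
  have hpos := Real.rpow_pos_of_pos (show 0 < 2 * L by linarith) (-m)
  calc K ≤ c * Real.exp (-A * (4 * (2 * b)) ^ 2) * (2 * L) ^ (-m) * Real.exp (L ^ β) := hK
    _ = Real.exp ((4 * α + 1) * L ^ β) * (c * ((2 * L) ^ (-m) * Real.exp (-(4 * α) * L ^ β) *
          Real.exp (-A * (4 * (2 * b)) ^ 2))) := by
        have : Real.exp (L ^ β) =
            Real.exp ((4 * α + 1) * L ^ β) * Real.exp (-(4 * α) * L ^ β) := by
          rw [← Real.exp_add]
          congr 1
          ring
        rw [this]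
        ring
    _ ≤ weight α' β δ z.2 * f z.1 z.2 :=
        mul_le_mul hw key (by positivity) (weight_pos _ _ _ _).le

theorem mixedNorm_eq_top {p q : ℝ≥0∞} (hp : p ≠ 0) (hq : q ≠ 0)
    {mixedNorm : (Space N → Space N → ℝ) → ℝ≥0∞}
    (hnorm : mixedNorm = normXV p q ∨ mixedNorm = normVX p q) {g : Space N → Space N → ℝ}
    (h : ∀ K : ℝ, ∃ S V : Set (Space N), MeasurableSet S ∧ MeasurableSet V ∧ 1 ≤ volume S ∧
      1 ≤ volume V ∧ ∀ᵐ z : Space N × Space N, z.1 ∈ S → z.2 ∈ V → K ≤ g z.1 z.2) :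
    mixedNorm g = ∞ := by
  refine ENNReal.eq_top_of_forall_nnreal_le fun K => ?_
  obtain ⟨S, V, hS, hV, hS1, hV1, hK⟩ := h K
  rw [← ENNReal.ofReal_coe_nnreal]
  rcases hnorm with rfl | rfl
  · exact le_normXV_of_le_on hp hq hS hV hS1 hV1 hK
  · exact le_normVX_of_le_on hp hq hS hV hS1 hV1 hK

end

end BGK

theorem theorem2 (N : ℕ) (hN : 1 ≤ N) (α α' β δ ε : ℝ) (hα' : 0 < α') (hα'α : α' ≤ α)
    (hβ : 0 < β) (hβ2 : β ≤ 2) (hδ : 0 ≤ δ) (hε : 0 < ε) (p q : ℝ≥0∞) (hp : 1 ≤ p) (hq : 1 ≤ q)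
    (mixedNorm : (BGK.Space N → BGK.Space N → ℝ) → ℝ≥0∞)
    (hnorm : mixedNorm = BGK.normXV p q ∨ mixedNorm = BGK.normVX p q) :
    ∃ (f₀ : BGK.Space N → BGK.Space N → ℝ) (γ ω c : ℝ),
      -- the datum is a truncated Maxwellian, measurable, non-negative, spatially inhomogeneous
      1 / 3 ≤ γ ∧ γ ≤ 1 / (β + 1) ∧ γ ≤ 1 / 2 ∧ 0 ≤ ω ∧ 0 < c ∧
      f₀ = BGK.truncatedDatum α β γ δ ω c ∧
      Measurable (fun z : BGK.Space N × BGK.Space N => f₀ z.1 z.2) ∧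
      (∀ x v, 0 ≤ f₀ x v) ∧
      ¬ BGK.SpatiallyHomogeneous f₀ ∧
      -- it is small
      mixedNorm (fun x v => BGK.weight α β δ v * f₀ x v) +
        BGK.normSup (fun x v => BGK.weight α β δ v * f₀ x v) ≤ ENNReal.ofReal ε ∧
      -- a solution with the macroscopic bounds exists on some time interval
      (∃ T > 0, ∃ f, BGK.IsMildSolution T f₀ f ∧ BGK.HasMacroscopicBounds α β γ δ ω T f) ∧
      -- on every time interval there is at most one such solution
      (∀ T > 0, ∀ f g,
        BGK.IsMildSolution T f₀ f → BGK.HasMacroscopicBounds α β γ δ ω T f →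
        BGK.IsMildSolution T f₀ g → BGK.HasMacroscopicBounds α β γ δ ω T g →
        ∀ t ∈ Icc 0 T, ∀ᵐ z : BGK.Space N × BGK.Space N, f t z.1 z.2 = g t z.1 z.2) ∧
      -- this solution, and every continuation of it, has infinite norm at every positive time
      (∀ T > 0, ∀ f, BGK.IsMildSolution T f₀ f →
        (∃ s ∈ Ioc 0 T, BGK.HasMacroscopicBounds α β γ δ ω s f) →
        ∀ t ∈ Ioc 0 T, mixedNorm (fun x v => BGK.weight α' β δ v * f t x v) = ∞) := by
  have hα : 0 < α := hα'.trans_le hα'α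
  obtain ⟨ω, hωdef⟩ : ∃ ω : ℝ, ω = ((N : ℝ) + 1) + ((N : ℝ) + 1) / 3 := ⟨_, rfl⟩
  have hω : 0 ≤ ω := by rw [hωdef]; positivity
  have hm : 0 ≤ 3 * ω + 2 * δ + β := by positivity
  obtain ⟨c, hc, hsmall⟩ := BGK.exists_truncatedDatum_small N (α := α) (β := β) (δ := δ)
    hωdef hε hp hq hnorm
  -- The smallest admissible exponent `γ = 1/3` works for all `β ≤ 2` at once.
  refine ⟨BGK.truncatedDatum α β (1 / 3) δ ω c, 1 / 3, ω, c, le_rfl, ?_, by norm_num, hω, hc, rfl,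
    BGK.measurable_truncatedDatum N, BGK.truncatedDatum_nonneg hc.le,
    BGK.not_spatiallyHomogeneous hN hc, hsmall, ?_, ?_, ?_⟩
  · exact one_div_le_one_div_of_le (by linarith) (by linarith)
  · obtain ⟨a, ha, ha1, K, hK, τ₀, hτ₀, hcent⟩ :=
      BGK.exists_centredDatum (N := N) hN hα hβ hβ2 hδ hω hc hm
    obtain ⟨T, hT, f, hf, A, hA, C, hC, hb⟩ := hcent.exists_solution hN ha ha1 hK hτ₀
    exact ⟨T, hT, f, hf, BGK.hasMacroscopicBounds_of_bounds hα hβ hβ2 hm hA hC hb⟩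
  · intro T hT f g hf bf hg bg
    obtain ⟨A, hA, hAf⟩ := bf.exists_bounds hα hβ hβ2 hm hT.le
    obtain ⟨B, hB, hBg⟩ := bg.exists_bounds hα hβ hβ2 hm hT.le
    set p := BGK.cubeProfile N hα hβ hβ2 hm
    -- The two solutions come with different constants; `A + B` places both in one class.
    refine p.unique hN hT (add_pos hA hB) hf hg (fun t ht => ?_) fun t ht => ?_
    · filter_upwards [hAf t ht] with x hx
      exact BGK.FieldBounds.mono hA (by linarith)
        (p.amp_pos x) (p.width_pos x) hx
    · filter_upwards [hBg t ht] with x hx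
      exact BGK.FieldBounds.mono hB (by linarith)
        (p.amp_pos x) (p.width_pos x) hx
  · rintro T hT f hf ⟨s, hs, bf⟩ t ht
    obtain ⟨A, hA, hAf⟩ := bf.exists_bounds hα hβ hβ2 hm hs.1.le
    obtain ⟨k, hk, hle⟩ := BGK.Profile.exists_le_solution _ hA hf
      (BGK.truncatedDatum_nonneg hc.le) hs hAf ht
    exact BGK.mixedNorm_eq_top (zero_lt_one.trans_le hp).ne' (zero_lt_one.trans_le hq).ne' hnorm
      (BGK.exists_le_weight_mul hN hα hα' hβ hβ2 hδ hm hA hT.le hk hle)
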